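/- A \emph{linear pipeline} is a chain of operators $op_0,\dots,op_{n-1}$ ($n\ge 0$) where $op_j$ maps every input tuple of type $T_j$ to a finite (possibly empty) list of tuples of type $T_{j+1}$. Each operator is \emph{stateless} (a pure function), \emph{stateful} (with an internal state $\sigma$ that each input may read and update) or \emph{partitioned-stateful} (every input has a key, each key has its own state, an input accesses only the state of its key; the keys are mapped to $p$ buckets). The pipeline is executed by finitely many worker threads, an ingress thread and a scheduler, and an execution is an interleaving of the atomic steps of these agents (sequential consistency; the queues are linearizable FIFO queues). Implementation. Tuples are added one at a time to the worklist of the next operator, or to the output after the last operator; for stateless and partitioned operators every tuple first gets a serial number $1,2,\dots$ from an atomic counter of that operator. \emph{Stateful:} a FIFO queue; at most one worker at a time is allotted to the operator; it repeatedly dequeues a tuple, reads the state, writes the new state, and adds the outputs to the next worklist. \emph{Stateless:} a shared FIFO queue; each worker repeatedly dequeues a numbered tuple, computes its list of outputs $o$, and invokes $\mathtt{send}$ with it until this succeeds. \emph{Partitioned-stateful (hybrid queue):} a tuple is enqueued in the partition queue of its bucket $p$, and then $p$ is enqueued in a master queue. A worker repeatedly dequeues a bucket $p$ from the master queue and, if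 $\mathtt{count}[p].\mathtt{fetch\_add}(1)=0$, executes: do \{ dequeue a tuple from partition queue $p$; read the state of its key, write the new state; $\mathtt{send}$ its output list until this succeeds \} while $\mathtt{count}[p].\mathtt{fetch\_sub}(1)>1$. \emph{Reordering buffer:} each operator has a counter $\mathtt{next}$, initially $1$, a circular array $\mathtt{buffer}[0..s-1]$ ($s\ge 1$), initially EMPTY, and an atomic flag, initially clear. $\mathtt{send}(o_t)$, for the output list $o_t$ of the tuple with serial number $t$: load $n=\mathtt{next}$; if $n\le t<n+s$ set $\mathtt{buffer}[t \bmod s]$ to $o_t$, otherwise the call will report failure; in both cases perform $\mathtt{send\_pending\_outputs}$: if $\mathtt{test\_and\_set}$ of the flag finds it already set, return; otherwise repeat: load $n=\mathtt{next}$ and $o=\mathtt{buffer}[n\bmod s]$; if $o$ is not EMPTY, add its tuples one by one downstream, set this slot to EMPTY and increment $\mathtt{next}$; if $o$ is EMPTY, clear the flag and leave the loop. Finally load $\mathtt{buffer}[n\bmod s]$ again, and start $\mathtt{send\_pending\_outputs}$ anew if it is not EMPTY. \emph{Dynamic runtime:} at any time the scheduler may allot any idle worker to any operator, following any policy, subject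 only to the restriction for stateful operators. A worker may return to the scheduler after any number $\geq 1$ of iterations of its (outer) loop, and returns when it finds the worklist (the master queue for a partitioned operator) empty. The \emph{sequential execution} pushes the input tuples through the whole pipeline one after the other. An execution is \emph{complete} if it is not broken off while there is work to do: the ingress thread does not stop for ever while inputs remain or an addition is in progress, a worker that is allotted to an operator does not stop for ever, and an operator whose worklist remains non-empty from some time on is not left without workers for ever. \textbf{Theorem.} Consider any such pipeline, any buffer sizes $s\ge1$, any number of workers, any finite or infinite input sequence $i_1,i_2,\dots$, and any concurrent execution on it. (a) At every time, the sequence of tuples output so far is a prefix of the output sequence of the sequential execution on the inputs that have arrived so far. (b) If the execution is complete, then it is ordered: its (finite or infinite) output sequence equals the output sequence of the sequential execution on $i_1,i_2,\dots$. -/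

import Mathlib

universe u v

namespace OrderedStream

/-! ## Operators and the sequential semantics -/

/-- The three kinds of operators. -/
inductive OpKind where
  | stateful
  | stateless
  | partitioned

/-- A unary streaming operator with inputs in `α` and outputs in `β`; every input is mapped to a
sequence of zero or more outputs.
* `stateful`: an internal state `σ` that every input may read and update;
* `stateless`: a pure function;
* `partitioned`: a separate state for each key `k : K`; an input `x` reads and updates only the
  state of its key `key x`. The key space is divided into `p` buckets by `bucket`. -/
inductive Operator (α β : Type u) : Type (max u (v + 1)) where
  | stateful (σ : Type v) (init : σ) (run : σ → α → σ × List β)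
  | stateless (f : α → List β)
  | partitioned (σ K : Type v) (p : ℕ) (key : α → K) (bucket : K → Fin p) (init : K → σ)
      (run : σ → α → σ × List β)

namespace Operator

variable {α β : Type u}

/-- The kind of an operator. -/
def kind : Operator.{u, v} α β → OpKind
  | stateful .. => .stateful
  | stateless .. => .stateless
  | partitioned .. => .partitioned

/-- The whole state of an operator. -/
def Store : Operator.{u, v} α β → Type v
  | stateful σ _ _ => σ
  | stateless _ => PUnit
  | partitioned σ K _ _ _ _ _ => K → σ

/-- The part of the state that is accessed when one input is processed. -/
def Cell : Operator.{u, v} α β → Type v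
  | stateful σ _ _ => σ
  | stateless _ => PUnit
  | partitioned σ _ _ _ _ _ _ => σ

/-- The initial state. -/
def initStore : (op : Operator.{u, v} α β) → op.Store
  | stateful _ init _ => init
  | stateless _ => PUnit.unit
  | partitioned _ _ _ _ _ init _ => init

/-- Reading the part of the state that belongs to the input `x`. -/
def read : (op : Operator.{u, v} α β) → op.Store → α → op.Cell
  | stateful _ _ _, s, _ => s
  | stateless _, _, _ => PUnit.unit
  | partitioned _ _ _ key _ _ _, s, x => s (key x)

open Classical in
/-- Writing the part of the state that belongs to the input `x`. -/
noncomputable def write : (op : Operator.{u, v} α β) → op.Store → α → op.Cell → op.Store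
  | stateful _ _ _, _, _, c => c
  | stateless _, _, _, _ => PUnit.unit
  | partitioned _ _ _ key _ _ _, s, x, c => Function.update s (key x) c

/-- The user-specified operator logic: new state and outputs. -/
def run : (op : Operator.{u, v} α β) → op.Cell → α → op.Cell × List β
  | stateful _ _ run, c, x => run c x
  | stateless f, c, x => (c, f x)
  | partitioned _ _ _ _ _ _ run, c, x => run c x

/-- The number of the bucket of an input (used for partitioned operators only). -/
def bucketOf : Operator.{u, v} α β → α → ℕ
  | stateful _ _ _, _ => 0
  | stateless _, _ => 0
  | partitioned _ _ _ key bucket _ _, x => (bucket (key x)).val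

/-- Sequential processing of one input. -/
noncomputable def seqStep (op : Operator.{u, v} α β) (s : op.Store) (x : α) :
    op.Store × List β :=
  (op.write s x (op.run (op.read s x) x).1, (op.run (op.read s x) x).2)

/-- Sequential processing of a list of inputs, one at a time. -/
noncomputable def seqMany (op : Operator.{u, v} α β) : op.Store → List α → op.Store × List β
  | s, [] => (s, [])
  | s, x :: xs =>
    ((op.seqMany (op.seqStep s x).1 xs).1, (op.seqStep s x).2 ++ (op.seqMany (op.seqStep s x).1 xs).2)

end Operator

/-- A linear pipeline with `len` operators: operator `j` turns tuples of type `Ty j` into tuples of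
type `Ty (j + 1)` (the types `Ty k` with `k > len` play no role), and has a reordering buffer with
`bufSize j` slots. -/
structure Pipeline where
  len : ℕ
  Ty : ℕ → Type u
  op : (j : Fin len) → Operator.{u, v} (Ty j.val) (Ty (j.val + 1))
  bufSize : Fin len → ℕ
  bufSize_pos : ∀ j, 0 < bufSize j

namespace Pipeline

variable (P : Pipeline.{u, v})

/-- The states of all operators. -/
abbrev Stores : Type v := (j : Fin P.len) → (P.op j).Store

/-- The tuples that reach stage `k` when the single input `x` is pushed through the pipeline, the
operators being in the states `S`. -/
noncomputable def wave (S : P.Stores) (x : P.Ty 0) : (k : ℕ) → List (P.Ty k)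
  | 0 => [x]
  | k + 1 =>
    if h : k < P.len then ((P.op ⟨k, h⟩).seqMany (S ⟨k, h⟩) (wave S x k)).2 else []

/-- The states of the operators after the single input `x` has been pushed through. -/
noncomputable def seqNext (S : P.Stores) (x : P.Ty 0) : P.Stores :=
  fun j => ((P.op j).seqMany (S j) (P.wave S x j.val)).1

/-- Sequential execution: the inputs are pushed through the whole pipeline one after the other. -/
noncomputable def seqFrom : P.Stores → List (P.Ty 0) → List (P.Ty P.len)
  | _, [] => []
  | S, x :: xs => P.wave S x P.len ++ seqFrom (P.seqNext S x) xs

/-- The output of the sequential execution on a finite list of inputs. -/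
noncomputable def seqOutput (xs : List (P.Ty 0)) : List (P.Ty P.len) :=
  P.seqFrom (fun j => (P.op j).initStore) xs

end Pipeline

/-! ## The concurrent implementation of one operator -/

/-- The shared memory of an operator. All queues are linearizable FIFO queues: items are enqueued
at the end of the list and dequeued at its head. Only the worklists of the operator's kind are ever
used. -/
structure OpMem {α β : Type u} (op : Operator.{u, v} α β) where
  /-- the operator's state -/
  store : op.Store
  /-- worklist of a stateful operator -/
  inbox : List α
  /-- worklist of a stateless operator: tuples with their serial numbers -/
  shared : List (ℕ × α)
  /-- partition queues of a partitioned operator: tuples with their serial numbers -/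
  part : ℕ → List (ℕ × α)
  /-- master queue of a partitioned operator -/
  master : List ℕ
  /-- the counters `count[p]` of a partitioned operator -/
  count : ℕ → ℕ
  /-- the atomic counter from which serial numbers are drawn -/
  serial : ℕ
  /-- reordering buffer: serial number of the next output to be sent -/
  next : ℕ
  /-- reordering buffer: the circular array, `none` for EMPTY; slot `i` is used for `i < s` only -/
  buffer : ℕ → Option (List β)
  /-- reordering buffer: the atomic flag -/
  flag : Bool

/-- Initial memory: empty queues and buffer; serial numbers start from `1`. -/
def OpMem.init {α β : Type u} (op : Operator.{u, v} α β) : OpMem op where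
  store := op.initStore
  inbox := []
  shared := []
  part := fun _ => []
  master := []
  count := fun _ => 0
  serial := 1
  next := 1
  buffer := fun _ => none
  flag := false

/-- The worklist has no waiting input. For a partitioned operator this is the master queue. -/
def OpMem.WorklistEmpty {α β : Type u} {op : Operator.{u, v} α β} (m : OpMem op) : Prop :=
  match op.kind with
  | .stateful => m.inbox = []
  | .stateless => m.shared = []
  | .partitioned => m.master = []

/-- Progress of a producer that adds a list of tuples, one by one, to the worklist of an operator. -/
inductive Feed (α : Type u) : Type u where
  /-- `xs` remains to be added -/
  | ready (xs : List α)
  /-- the serial number `t` has been drawn for the tuple `x`; afterwards `xs` remains -/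
  | numbered (t : ℕ) (x : α) (xs : List α)
  /-- the current tuple is in partition queue `p`, and `p` is still to be enqueued in the master
  queue; afterwards `xs` remains -/
  | listed (p : ℕ) (xs : List α)

/-- The atomic steps of adding tuples to the worklist of the operator `op`. -/
inductive FeedStep {α β : Type u} (op : Operator.{u, v} α β) :
    Feed α → OpMem op → Feed α → OpMem op → Prop where
  | inbox {x xs m} : op.kind = .stateful →
      FeedStep op (.ready (x :: xs)) m (.ready xs) { m with inbox := m.inbox ++ [x] }
  | number {x xs m} : op.kind ≠ .stateful →
      FeedStep op (.ready (x :: xs)) m (.numbered m.serial x xs) { m with serial := m.serial + 1 }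
  | shared {t x xs m} : op.kind = .stateless →
      FeedStep op (.numbered t x xs) m (.ready xs) { m with shared := m.shared ++ [(t, x)] }
  | part {t x xs m} : op.kind = .partitioned →
      FeedStep op (.numbered t x xs) m (.listed (op.bucketOf x) xs)
        { m with part :=
            Function.update m.part (op.bucketOf x) (m.part (op.bucketOf x) ++ [(t, x)]) }
  | master {p xs m} : op.kind = .partitioned →
      FeedStep op (.listed p xs) m (.ready xs) { m with master := m.master ++ [p] }

/-- The tuple that a worker is processing, with its serial number (not used by stateful operators)
and the partition that the worker owns (used by partitioned operators only). -/
structure Job (α : Type u) where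
  serial : ℕ
  bucket : ℕ
  tuple : α

/-- Control state of a worker that is allotted to the operator `op`. In the states that belong to
the procedure `send`, the argument `r` is `none` if `try_add` has succeeded, and `some o` if it has
failed, so that `send` has to be invoked again with the same output `o`. -/
inductive Pc {α β : Type u} (op : Operator.{u, v} α β) : Type (max u v) where
  /-- about to dequeue from the worklist (of a partitioned operator: from the master queue) -/
  | start
  /-- one iteration is over: continue with `start`, or return to the scheduler -/
  | again
  /-- `p` was dequeued from the master queue; about to perform `count[p].fetch_add(1)` -/
  | claim (p : ℕ)
  /-- head of the do-while loop: about to dequeue from partition queue `p` -/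
  | take (p : ℕ)
  /-- end of the do-while loop: about to perform `count[p].fetch_sub(1)` -/
  | release (p : ℕ)
  /-- about to read the operator's state -/
  | load (b : Job α)
  /-- the state `c` has been read; about to write the new state back -/
  | store (b : Job α) (c : op.Cell)
  /-- stateful operator: adding the outputs to the downstream worklist -/
  | emit (a : Feed β)
  /-- `try_add`: about to load `next` and to test the entry condition -/
  | addLoad (b : Job α) (o : List β)
  /-- `try_add`: the entry condition held; about to set the slot of the buffer -/
  | addSet (b : Job α) (o : List β)
  /-- `send_pending_outputs`: about to perform `flag.test_and_set()` -/
  | testAndSet (b : Job α) (r : Option (List β))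
  /-- exit section: about to load `next` -/
  | exitNext (b : Job α) (r : Option (List β))
  /-- exit section: `next` was `n`; about to load slot `n mod s` -/
  | exitBuf (b : Job α) (r : Option (List β)) (n : ℕ)
  /-- exit section: inside `send_downstream` -/
  | exitSend (b : Job α) (r : Option (List β)) (n : ℕ) (a : Feed β)
  /-- exit section: about to set slot `n mod s` to EMPTY -/
  | exitEmpty (b : Job α) (r : Option (List β)) (n : ℕ)
  /-- exit section: about to perform `next.fetch_add(1)` -/
  | exitIncr (b : Job α) (r : Option (List β))
  /-- exit section: about to clear the flag -/
  | exitClear (b : Job α) (r : Option (List β)) (n : ℕ)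
  /-- the flag was cleared; about to load slot `n mod s` again -/
  | recheck (b : Job α) (r : Option (List β)) (n : ℕ)
  /-- `send` returns -/
  | sent (b : Job α) (r : Option (List β))

/-- The atomic steps of a worker at `op` that access only the memory of `op` itself, where `s` is
the size of the reordering buffer. -/
inductive LocalStep {α β : Type u} (op : Operator.{u, v} α β) (s : ℕ) :
    Pc op → OpMem op → Pc op → OpMem op → Prop where
  /- fetching work -/
  | continue {m} : LocalStep op s .again m .start m
  | popInbox {m x q} : op.kind = .stateful → m.inbox = x :: q →
      LocalStep op s .start m (.load ⟨0, 0, x⟩) { m with inbox := q }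
  | popShared {m t x q} : op.kind = .stateless → m.shared = (t, x) :: q →
      LocalStep op s .start m (.load ⟨t, 0, x⟩) { m with shared := q }
  | popMaster {m p q} : op.kind = .partitioned → m.master = p :: q →
      LocalStep op s .start m (.claim p) { m with master := q }
  | claimFree {m p} : m.count p = 0 →
      LocalStep op s (.claim p) m (.take p)
        { m with count := Function.update m.count p (m.count p + 1) }
  | claimBusy {m p} : m.count p ≠ 0 →
      LocalStep op s (.claim p) m .again
        { m with count := Function.update m.count p (m.count p + 1) }
  | take {m p t x q} : m.part p = (t, x) :: q →
      LocalStep op s (.take p) m (.load ⟨t, p, x⟩) { m with part := Function.update m.part p q }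
  | takeNone {m p} : m.part p = [] → LocalStep op s (.take p) m (.release p) m
  | releaseMore {m p} : 1 < m.count p →
      LocalStep op s (.release p) m (.take p)
        { m with count := Function.update m.count p (m.count p - 1) }
  | releaseLast {m p} : ¬ 1 < m.count p →
      LocalStep op s (.release p) m .again
        { m with count := Function.update m.count p (m.count p - 1) }
  /- the operator logic: the state is read and written in two separate steps -/
  | load {m b} : LocalStep op s (.load b) m (.store b (op.read m.store b.tuple)) m
  | storeStateful {m b c} : op.kind = .stateful →
      LocalStep op s (.store b c) m (.emit (.ready (op.run c b.tuple).2))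
        { m with store := op.write m.store b.tuple (op.run c b.tuple).1 }
  | storeOther {m b c} : op.kind ≠ .stateful →
      LocalStep op s (.store b c) m (.addLoad b (op.run c b.tuple).2)
        { m with store := op.write m.store b.tuple (op.run c b.tuple).1 }
  | emitDone {m} : LocalStep op s (.emit (.ready [])) m .again m
  /- `try_add` -/
  | addOk {m b o} : m.next ≤ b.serial ∧ b.serial < m.next + s →
      LocalStep op s (.addLoad b o) m (.addSet b o) m
  | addFail {m b o} : ¬ (m.next ≤ b.serial ∧ b.serial < m.next + s) →
      LocalStep op s (.addLoad b o) m (.testAndSet b (some o)) m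
  | addSet {m b o} :
      LocalStep op s (.addSet b o) m (.testAndSet b none)
        { m with buffer := Function.update m.buffer (b.serial % s) (some o) }
  /- `send_pending_outputs` -/
  | flagBusy {m b r} : m.flag = true → LocalStep op s (.testAndSet b r) m (.sent b r) m
  | flagFree {m b r} : m.flag = false →
      LocalStep op s (.testAndSet b r) m (.exitNext b r) { m with flag := true }
  | exitNext {m b r} : LocalStep op s (.exitNext b r) m (.exitBuf b r m.next) m
  | exitFull {m b r n o} : m.buffer (n % s) = some o →
      LocalStep op s (.exitBuf b r n) m (.exitSend b r n (.ready o)) m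
  | exitNone {m b r n} : m.buffer (n % s) = none →
      LocalStep op s (.exitBuf b r n) m (.exitClear b r n) m
  | exitSent {m b r n} : LocalStep op s (.exitSend b r n (.ready [])) m (.exitEmpty b r n) m
  | exitEmpty {m b r n} :
      LocalStep op s (.exitEmpty b r n) m (.exitIncr b r)
        { m with buffer := Function.update m.buffer (n % s) none }
  | exitIncr {m b r} :
      LocalStep op s (.exitIncr b r) m (.exitNext b r) { m with next := m.next + 1 }
  | exitClear {m b r n} :
      LocalStep op s (.exitClear b r n) m (.recheck b r n) { m with flag := false }
  | recheckFull {m b r n o} : m.buffer (n % s) = some o →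
      LocalStep op s (.recheck b r n) m (.testAndSet b r) m
  | recheckNone {m b r n} : m.buffer (n % s) = none →
      LocalStep op s (.recheck b r n) m (.sent b r) m
  /- return of `send` -/
  | retry {m b o} : LocalStep op s (.sent b (some o)) m (.addLoad b o) m
  | sentStateless {m b} : op.kind = .stateless → LocalStep op s (.sent b none) m .again m
  | sentPartitioned {m b} : op.kind = .partitioned →
      LocalStep op s (.sent b none) m (.release b.bucket) m

/-! ## The pipeline with the dynamic runtime -/

variable (P : Pipeline.{u, v}) (N : ℕ)

/-- Global state with `N` worker threads. -/
structure State where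
  /-- number of inputs that have arrived -/
  arrived : ℕ
  /-- the ingress thread, which adds arriving inputs to the pipeline -/
  source : Feed (P.Ty 0)
  /-- the memories of the operators -/
  mem : (j : Fin P.len) → OpMem (P.op j)
  /-- the tuples that have left the pipeline at the egress, in order -/
  out : List (P.Ty P.len)
  /-- a worker is either idle (`none`) or allotted to some operator `j` -/
  worker : Fin N → Option ((j : Fin P.len) × Pc (P.op j))

/-- The initial state. -/
def State.init : State P N where
  arrived := 0
  source := .ready []
  mem := fun j => OpMem.init (P.op j)
  out := []
  worker := fun _ => none

variable {P N}

/-- Worker `w` is currently allotted to operator `j`. -/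
def State.AllottedTo (S : State P N) (w : Fin N) (j : Fin P.len) : Prop :=
  ∃ pc : Pc (P.op j), S.worker w = some ⟨j, pc⟩

/-- One atomic step of a producer that adds tuples at stage `k`: to the worklist of operator `k`
if there is one, and to the output of the pipeline after the last operator. -/
inductive Deliver : (k : ℕ) → Feed (P.Ty k) → State P N → Feed (P.Ty k) → State P N → Prop where
  | worklist {k : ℕ} {a a' : Feed (P.Ty k)} {S : State P N} (h : k < P.len)
      {m' : OpMem (P.op ⟨k, h⟩)} : FeedStep (P.op ⟨k, h⟩) a (S.mem ⟨k, h⟩) a' m' →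
      Deliver k a S a' { S with mem := Function.update S.mem ⟨k, h⟩ m' }
  | egress {k : ℕ} {x : P.Ty k} {xs : List (P.Ty k)} {S : State P N} (h : k = P.len) :
      Deliver k (.ready (x :: xs)) S (.ready xs)
        { S with out := S.out ++ [cast (congrArg P.Ty h) x] }

variable (N) in
/-- The agents that perform steps. -/
inductive Agent where
  | ingress
  | scheduler
  | worker (w : Fin N)

/-- The atomic steps of the system on a given (finite or infinite) input sequence. The scheduler may
follow any policy: it may allot an idle worker to any operator, except that at most one worker is
allotted to a stateful operator at any time. A worker may return to the scheduler after any number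
of iterations, and returns when it finds the worklist empty. -/
inductive Step (input : Stream'.Seq (P.Ty 0)) : Agent N → State P N → State P N → Prop where
  | arrive {S : State P N} {x : P.Ty 0} :
      S.source = .ready [] → input.get? S.arrived = some x →
      Step input .ingress S { S with arrived := S.arrived + 1, source := .ready [x] }
  | ingress {S S' : State P N} {a' : Feed (P.Ty 0)} :
      Deliver 0 S.source S a' S' → Step input .ingress S { S' with source := a' }
  | allot {S : State P N} {w : Fin N} {j : Fin P.len} :
      S.worker w = none →
      ((P.op j).kind = .stateful → ∀ w', ¬ S.AllottedTo w' j) →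
      Step input .scheduler S { S with worker := Function.update S.worker w (some ⟨j, .start⟩) }
  | leaveEmpty {S : State P N} {w : Fin N} {j : Fin P.len} :
      S.worker w = some ⟨j, .start⟩ → (S.mem j).WorklistEmpty →
      Step input (.worker w) S { S with worker := Function.update S.worker w none }
  | leave {S : State P N} {w : Fin N} {j : Fin P.len} :
      S.worker w = some ⟨j, .again⟩ →
      Step input (.worker w) S { S with worker := Function.update S.worker w none }
  | local {S : State P N} {w : Fin N} {j : Fin P.len} {pc pc' : Pc (P.op j)}
      {m' : OpMem (P.op j)} :
      S.worker w = some ⟨j, pc⟩ → LocalStep (P.op j) (P.bufSize j) pc (S.mem j) pc' m' →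
      Step input (.worker w) S
        { S with
          mem := Function.update S.mem j m'
          worker := Function.update S.worker w (some ⟨j, pc'⟩) }
  | emit {S S' : State P N} {w : Fin N} {j : Fin P.len} {a a' : Feed (P.Ty (j.val + 1))} :
      S.worker w = some ⟨j, .emit a⟩ → Deliver (j.val + 1) a S a' S' →
      Step input (.worker w) S
        { S' with worker := Function.update S'.worker w (some ⟨j, .emit a'⟩) }
  | exitSend {S S' : State P N} {w : Fin N} {j : Fin P.len} {b : Job (P.Ty j.val)}
      {r : Option (List (P.Ty (j.val + 1)))} {n : ℕ} {a a' : Feed (P.Ty (j.val + 1))} :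
      S.worker w = some ⟨j, .exitSend b r n a⟩ → Deliver (j.val + 1) a S a' S' →
      Step input (.worker w) S
        { S' with worker := Function.update S'.worker w (some ⟨j, .exitSend b r n a'⟩) }

variable (P N) in
/-- A concurrent execution: an interleaving of atomic steps from the initial state. At time `n`
either the agent `act n` performs a step, or (`act n = none`) nothing happens; a finite execution is
one in which nothing happens from some time on. -/
structure Execution (input : Stream'.Seq (P.Ty 0)) where
  state : ℕ → State P N
  act : ℕ → Option (Agent N)
  state_zero : state 0 = State.init P N
  stay : ∀ n, act n = none → state (n + 1) = state n
  step : ∀ n a, act n = some a → Step input a (state n) (state (n + 1))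

namespace Execution

variable {input : Stream'.Seq (P.Ty 0)}

/-- The execution is complete: it is not broken off while there is work to do. That is, the ingress
thread never stops as long as inputs are left, a worker allotted to an operator never stops, and an
operator whose worklist remains non-empty is not left without workers forever. -/
structure Complete (E : Execution P N input) : Prop where
  ingress : ∀ n, ∃ m, n ≤ m ∧ (E.act m = some .ingress ∨
    ((E.state m).source = .ready [] ∧ input.get? (E.state m).arrived = none))
  worker : ∀ w n, ∃ m, n ≤ m ∧ (E.act m = some (.worker w) ∨ (E.state m).worker w = none)
  scheduler : ∀ j n, ∃ m, n ≤ m ∧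
    (((E.state m).mem j).WorklistEmpty ∨ ∃ w, (E.state m).AllottedTo w j)

/-- The execution is ordered: its (finite or infinite) output sequence is the output sequence of the
sequential execution on the same input sequence, i.e. `y` is the output at position `i` of the one
if and only if it is the output at position `i` of the other. -/
def Ordered (E : Execution P N input) : Prop :=
  ∀ (i : ℕ) (y : P.Ty P.len),
    (∃ n, (E.state n).out[i]? = some y) ↔ (∃ m, (P.seqOutput (input.take m))[i]? = some y)

end Execution

end OrderedStream

namespace OrderedStream

open Function (update)

set_option linter.unusedSectionVars false

/-! ## Lists and sequences -/

/-! The sequential execution can be carried out stage by stage: every operator turns its whole input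
sequence into one output sequence, and pushing the inputs through one after the other gives the same
result (`seqOutput_eq_stage`). The concurrent execution is compared with this form. A ghost history
records, for every stage `k`, the sequence `log k` of tuples whose addition there has begun. Each
stage has only one active producer at a time (the ingress thread, the single worker of a stateful
operator, or the worker that holds the flag), so serial numbers are positions in `log k`, and the
queues contain tuples in that order. It then suffices to show for a single operator that `log (k +
1)` is always a prefix of its sequential outputs on `log k`, and that in a complete execution every
such output eventually appears.

Safety is an inductive invariant (`GlobalInv.step`), one `OpInv` for each operator. For an operator
with serial numbers, every number is in exactly one place: queued, held by a worker, buffered, or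
done (`LocInv`). Buffered numbers, and those about to be buffered, lie in the window from `next` to
`next + s - 1`, where residues modulo `s` are distinct. So nothing is overwritten, and while `next`
itself is not yet done, a full slot of `next` contains the output of number `next`. The flag admits
one worker to the exit section (`FlagInv`), hence outputs leave in serial order (`OutInv`). They
also have the right values (`ValueInv`): for a stateless operator trivially; for a partitioned one
because the counter gives each bucket at most one owner and its partition queue is in serial order.
The tuples of a bucket are therefore processed one at a time and in order, and those of other
buckets do not touch its keys (`read_stateAfter_congr`, `StoreInv`). The counting identity
`PartInv.tokens` shows that an owner about to dequeue never meets an empty partition queue.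

Liveness views a complete execution from one operator (`OpRun`). Suppose that `next` has the value
`t` for ever (`Stuck`). Then the slot of `t` is never full: a full slot stays full, no worker can
read it in the exit section without sending, and `FlagInv.wake` provides a worker that would enter
that section once the flag is clear (`not_full`). So no worker holds `t` either, as it would fill
the slot (`serial_ne`), and every call of `send` returns (`exists_sent`). Consequently workers do
not get lost, the worklist is served up to position `t` (`exists_le_pop`), and a served tuple does
not stay in a partition queue (`not_le_pop`). What remains is that `t` exceeds the length of the log
(`length_lt`); in other words `next` passes every tuple that is ever added. For stateful operators
the single worker simply runs through its loop. Induction on the stage (`exists_stage_prefix`)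
carries this from the ingress to the egress. -/

/-- The list with its entries numbered consecutively from `t` on. -/
def numberFrom {α : Type u} : ℕ → List α → List (ℕ × α)
  | _, [] => []
  | t, x :: xs => (t, x) :: numberFrom (t + 1) xs

theorem numberFrom_append {α : Type u} (t : ℕ) (l l' : List α) :
    numberFrom t (l ++ l') = numberFrom t l ++ numberFrom (t + l.length) l' := by
  induction l generalizing t with
  | nil => simp [numberFrom]
  | cons x l ih => simp [numberFrom, ih, Nat.add_assoc, Nat.add_comm 1]

theorem length_numberFrom {α : Type u} (t : ℕ) (l : List α) :
    (numberFrom t l).length = l.length := by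
  induction l generalizing t with
  | nil => rfl
  | cons x l ih => simp [numberFrom, ih]

/-- Meant for a partition queue, which is the numbered log filtered by bucket: its head is the first
remaining tuple of the bucket, and all tuples that are skipped before it belong to other buckets. -/
theorem filter_numberFrom_eq_cons {α : Type u} {f : α → Bool} {t u : ℕ} {x : α} {l : List α}
    {r : List (ℕ × α)} (h : (numberFrom t l).filter (fun y => f y.2) = (u, x) :: r) :
    ∃ l₁ l₂, l = l₁ ++ x :: l₂ ∧ u = t + l₁.length ∧ (∀ y ∈ l₁, f y = false) ∧ f x = true ∧
      r = (numberFrom (u + 1) l₂).filter (fun y => f y.2) := by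
  induction l generalizing t with
  | nil => simp [numberFrom] at h
  | cons y l ih =>
    simp only [numberFrom, List.filter_cons] at h
    split at h
    · rename_i hy
      simp only [List.cons.injEq, Prod.mk.injEq] at h
      obtain ⟨⟨rfl, rfl⟩, rfl⟩ := h
      exact ⟨[], l, by simp, by simp, by simp, hy, rfl⟩
    · rename_i hy
      obtain ⟨l₁, l₂, rfl, rfl, h₁, h₂, rfl⟩ := ih h
      refine ⟨y :: l₁, l₂, by simp, by simp; omega, ?_, h₂, rfl⟩
      simpa using ⟨by simpa using hy, h₁⟩

theorem length_filter_numberFrom {α : Type u} (f : α → Bool) (t : ℕ) (l : List α) :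
    ((numberFrom t l).filter (fun y => f y.2)).length = (l.filter f).length := by
  induction l generalizing t with
  | nil => rfl
  | cons x l ih =>
    simp only [numberFrom, List.filter_cons]
    split <;> simp [ih]

/-- The `t`-th entry of the list `l`, counted from `1`, is `x`. -/
def At {α : Type u} (l : List α) (t : ℕ) (x : α) : Prop :=
  0 < t ∧ l[t - 1]? = some x

theorem At.le {α : Type u} {l : List α} {t : ℕ} {x : α} (h : At l t x) : t ≤ l.length := by
  obtain ⟨h0, h⟩ := h
  have := (List.getElem?_eq_some_iff.1 h).1
  omega

theorem At.unique {α : Type u} {l : List α} {t : ℕ} {x y : α} (h : At l t x) (h' : At l t y) :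
    x = y := by
  have := h.2.symm.trans h'.2
  simpa using this

theorem At.append {α : Type u} {l : List α} {t : ℕ} {x : α} (h : At l t x) (l' : List α) :
    At (l ++ l') t x := by
  have := h.le
  have h0 := h.1
  refine ⟨h.1, ?_⟩
  rw [List.getElem?_append_left (by omega)]
  exact h.2

theorem exists_at {α : Type u} {l : List α} {t : ℕ} (h0 : 0 < t) (h : t ≤ l.length) :
    ∃ x, At l t x :=
  ⟨l[t - 1], h0, List.getElem?_eq_getElem (by omega)⟩

theorem At.take_eq {α : Type u} {l : List α} {t : ℕ} {x : α} (h : At l t x) :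
    l.take t = l.take (t - 1) ++ [x] := by
  obtain ⟨h0, h⟩ := h
  obtain ⟨h1, h2⟩ := List.getElem?_eq_some_iff.1 h
  have : t = t - 1 + 1 := by omega
  rw [this, List.take_succ_eq_append_getElem (by simpa using h1)]
  simp [h2]

theorem at_append_of_drop {α : Type u} {l l₁ l₂ : List α} {h : ℕ} {x : α}
    (e : l.drop h = l₁ ++ x :: l₂) : At l (h + 1 + l₁.length) x := by
  refine ⟨by omega, ?_⟩
  have : h + 1 + l₁.length - 1 = h + l₁.length := by omega
  rw [this, ← List.getElem?_drop, e]
  simp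

theorem drop_of_drop_eq {α : Type u} {l l₁ l₂ : List α} {h : ℕ} {x : α}
    (e : l.drop h = l₁ ++ x :: l₂) : l.drop (h + 1 + l₁.length) = l₂ := by
  have : h + 1 + l₁.length = h + (l₁.length + 1) := by omega
  rw [this, ← List.drop_drop, e]
  simp

theorem at_of_mem_between {α : Type u} {l l₁ l₂ : List α} {h u : ℕ} {x : α}
    (e : l.drop h = l₁ ++ l₂) (hu : At l u x) (h1 : h < u) (h2 : u ≤ h + l₁.length) : x ∈ l₁ := by
  have h3 := hu.2
  have : u - 1 = h + (u - 1 - h) := by omega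
  rw [this, ← List.getElem?_drop, e, List.getElem?_append_left (by omega)] at h3
  exact List.mem_of_getElem? h3

theorem mem_drop_take_at {α : Type u} {l : List α} {a b : ℕ} {x : α}
    (h : x ∈ (l.take b).drop a) : ∃ u, a < u ∧ u ≤ b ∧ At l u x := by
  obtain ⟨i, hi, rfl⟩ := List.getElem_of_mem h
  simp only [List.length_drop, List.length_take] at hi
  refine ⟨a + i + 1, by omega, by omega, by omega, ?_⟩
  simp [List.getElem_drop, List.getElem_take]

theorem update_congr {K : Type*} {σ : Type*} [DecidableEq K] {s s' : K → σ} {k : K}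
    (h : s k = s' k) (k' : K) (c : σ) : Function.update s k' c k = Function.update s' k' c k := by
  simp only [Function.update_apply, h]

/-! ## Reading, writing and sequential processing -/

namespace Operator

variable {α β : Type u} (op : Operator.{u, v} α β)

theorem bucketOf_eq_zero (h : op.kind = .stateless) (x : α) : op.bucketOf x = 0 := by
  cases op <;> simp_all [kind, bucketOf]

theorem cell_eq_of_stateless (h : op.kind = .stateless) (c c' : op.Cell) : c = c' := by
  cases op with
  | stateless f => rfl
  | stateful => simp [kind] at h
  | partitioned => simp [kind] at h

theorem read_write_of_ne {x y : α} (h : op.bucketOf x ≠ op.bucketOf y) (s : op.Store)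
    (c : op.Cell) : op.read (op.write s x c) y = op.read s y := by
  cases op with
  | stateful => simp [bucketOf] at h
  | stateless => rfl
  | partitioned σ K p key bucket init run =>
    have : key y ≠ key x := by
      rintro e
      simp [bucketOf, e] at h
    classical
    exact Function.update_of_ne (β := fun _ => σ) this _ _

/-- The write either replaces the cell of `y` by a value that does not depend on the store, or
leaves that cell alone. -/
theorem read_write_congr {s s' : op.Store} {y : α} (h : op.read s y = op.read s' y) (x : α)
    (c : op.Cell) : op.read (op.write s x c) y = op.read (op.write s' x c) y := by
  cases op with
  | stateful => rfl
  | stateless => rfl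
  | partitioned σ K p key bucket init run =>
    classical
    exact update_congr (K := K) (σ := σ) h (key x) c

theorem seqMany_append (s : op.Store) (l l' : List α) :
    op.seqMany s (l ++ l') = ((op.seqMany (op.seqMany s l).1 l').1,
      (op.seqMany s l).2 ++ (op.seqMany (op.seqMany s l).1 l').2) := by
  induction l generalizing s with
  | nil => simp [seqMany]
  | cons x l ih => simp [seqMany, ih]

theorem seqMany_singleton (s : op.Store) (x : α) : op.seqMany s [x] = op.seqStep s x := by
  simp [seqMany]

theorem read_seqMany_of_forall_ne {l : List α} {y : α}
    (h : ∀ x ∈ l, op.bucketOf x ≠ op.bucketOf y) (s : op.Store) :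
    op.read (op.seqMany s l).1 y = op.read s y := by
  induction l generalizing s with
  | nil => rfl
  | cons x l ih =>
    rw [seqMany, ih (fun z hz => h z (List.mem_cons_of_mem _ hz))]
    exact op.read_write_of_ne (h x List.mem_cons_self) _ _

/-- The state after the first `i` tuples of `l`. -/
noncomputable def stateAfter (l : List α) (i : ℕ) : op.Store :=
  (op.seqMany op.initStore (l.take i)).1

/-- The outputs of the first `i` tuples of `l`. -/
noncomputable def outputsOf (l : List α) (i : ℕ) : List β :=
  (op.seqMany op.initStore (l.take i)).2

/-- `o` is the output list of the `t`-th tuple of `l`. -/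
def OutIs (l : List α) (t : ℕ) (o : List β) : Prop :=
  ∃ x, At l t x ∧ o = (op.run (op.read (op.stateAfter l (t - 1)) x) x).2

theorem outputsOf_append {l l' : List α} {i : ℕ} (h : i ≤ l.length) :
    op.outputsOf (l ++ l') i = op.outputsOf l i := by
  simp [outputsOf, List.take_append_of_le_length h]

theorem stateAfter_append {l l' : List α} {i : ℕ} (h : i ≤ l.length) :
    op.stateAfter (l ++ l') i = op.stateAfter l i := by
  simp [stateAfter, List.take_append_of_le_length h]

variable {op}

theorem OutIs.append {l : List α} {t : ℕ} {o : List β} (h : op.OutIs l t o) (l' : List α) :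
    op.OutIs (l ++ l') t o := by
  obtain ⟨x, hx, rfl⟩ := h
  have := hx.le
  exact ⟨x, hx.append l', by rw [stateAfter_append _ (by omega)]⟩

theorem OutIs.outputsOf_eq {l : List α} {t : ℕ} {o : List β} (h : op.OutIs l t o) :
    op.outputsOf l t = op.outputsOf l (t - 1) ++ o := by
  obtain ⟨x, hx, rfl⟩ := h
  rw [outputsOf, hx.take_eq, seqMany_append, seqMany_singleton]
  rfl

variable (op)

theorem stateAfter_of_at {l : List α} {t : ℕ} {x : α} (h : At l t x) :
    op.stateAfter l t = op.write (op.stateAfter l (t - 1)) x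
      (op.run (op.read (op.stateAfter l (t - 1)) x) x).1 := by
  rw [stateAfter, h.take_eq, seqMany_append, seqMany_singleton]
  rfl

/-- This is what allows tuples of different buckets to be processed out of serial order: only tuples
of the bucket of `y` can change what is read for `y`. -/
theorem read_stateAfter_congr {l : List α} {a b : ℕ} {y : α} (hab : a ≤ b)
    (h : ∀ u x, a < u → u ≤ b → At l u x → op.bucketOf x ≠ op.bucketOf y) :
    op.read (op.stateAfter l b) y = op.read (op.stateAfter l a) y := by
  have e : l.take b = l.take a ++ (l.take b).drop a := by
    conv_lhs => rw [← List.take_append_drop a (l.take b)]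
    rw [List.take_take, min_eq_left hab]
  rw [stateAfter, e, seqMany_append]
  refine op.read_seqMany_of_forall_ne ?_ _
  intro x hx
  obtain ⟨u, h1, h2, h3⟩ := mem_drop_take_at hx
  exact h u x h1 h2 h3

end Operator

/-! ## Producers -/

/-- The state of a producer between two additions. -/
inductive Mid (α : Type u) : Type u where
  | idle
  | numbered (t : ℕ) (x : α)
  | listed (p : ℕ)

namespace Feed

variable {α : Type u}

def mid : Feed α → Mid α
  | ready _ => .idle
  | numbered t x _ => .numbered t x
  | listed p _ => .listed p

/-- The tuples whose addition has not begun. -/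
def rest : Feed α → List α
  | ready xs => xs
  | numbered _ _ xs => xs
  | listed _ xs => xs

/-- The tuple whose addition begins with the next step. -/
def fresh : Feed α → List α
  | ready (x :: _) => [x]
  | _ => []

/-- The number of steps that remain, up to the number of stages of an addition. -/
def rank : Feed α → ℕ
  | ready xs => 3 * xs.length
  | numbered _ _ xs => 3 * xs.length + 2
  | listed _ xs => 3 * xs.length + 1

end Feed

namespace Mid

variable {α : Type u}

/-- The tuple that has a number but is not in a queue yet. -/
def tuple : Mid α → List (ℕ × α)
  | numbered t x => [(t, x)]
  | _ => []

/-- The entry of the master queue that is still to be made. -/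
def token {β : Type u} (op : Operator.{u, v} α β) : Mid α → List ℕ
  | numbered _ x => [op.bucketOf x]
  | listed p => [p]
  | idle => []

/-- The entry of the master queue that is still to be made for a tuple in a partition queue. -/
def listedToken : Mid α → List ℕ
  | listed p => [p]
  | _ => []

end Mid

/-- A tuple is logged with the first atomic step of its addition, when it joins the inbox or draws
its number; later steps of the same addition have no fresh tuple. Hence the log followed by `rest`
is unchanged by a producer. -/
theorem FeedStep.fresh_rest {α β : Type u} {op : Operator.{u, v} α β} {a a' : Feed α}
    {m m' : OpMem op} (h : FeedStep op a m a' m') : a.fresh ++ a'.rest = a.rest := by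
  cases h <;> rfl

theorem FeedStep.rank_lt {α β : Type u} {op : Operator.{u, v} α β} {a a' : Feed α}
    {m m' : OpMem op} (h : FeedStep op a m a' m') : a'.rank < a.rank := by
  cases h <;> (simp [Feed.rank]; try omega)

/-! ## Control states of workers -/

namespace Pc

variable {α β : Type u} {op : Operator.{u, v} α β}

/-- The job whose output is not in the buffer yet. -/
def held : Pc op → Option (Job α)
  | load b => some b
  | store b _ => some b
  | addLoad b _ => some b
  | addSet b _ => some b
  | testAndSet b (some _) => some b
  | exitNext b (some _) => some b
  | exitBuf b (some _) _ => some b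
  | exitSend b (some _) _ _ => some b
  | exitEmpty b (some _) _ => some b
  | exitIncr b (some _) => some b
  | exitClear b (some _) _ => some b
  | recheck b (some _) _ => some b
  | sent b (some _) => some b
  | _ => none

/-- The job with its output, as long as that output is not in the buffer. -/
def carried : Pc op → Option (Job α × List β)
  | addLoad b o => some (b, o)
  | addSet b o => some (b, o)
  | testAndSet b (some o) => some (b, o)
  | exitNext b (some o) => some (b, o)
  | exitBuf b (some o) _ => some (b, o)
  | exitSend b (some o) _ _ => some (b, o)
  | exitEmpty b (some o) _ => some (b, o)
  | exitIncr b (some o) => some (b, o)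
  | exitClear b (some o) _ => some (b, o)
  | recheck b (some o) _ => some (b, o)
  | sent b (some o) => some (b, o)
  | _ => none

/-- The job whose new state has not been written yet. -/
def computing : Pc op → Option (Job α)
  | load b => some b
  | store b _ => some b
  | _ => none

/-- The critical section that the flag protects. It ends with the clearing of the flag, so
`exitClear` belongs to it and `recheck` does not. -/
def InExit : Pc op → Prop
  | exitNext _ _ => True
  | exitBuf _ _ _ => True
  | exitSend _ _ _ _ => True
  | exitEmpty _ _ _ => True
  | exitIncr _ _ => True
  | exitClear _ _ _ => True
  | _ => False

/-- The value of `next` that was loaded in the exit section. -/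
def exitIdx : Pc op → Option ℕ
  | exitBuf _ _ n => some n
  | exitSend _ _ n _ => some n
  | exitEmpty _ _ n => some n
  | exitClear _ _ n => some n
  | _ => none

/-- The worker is between loading a full slot and setting it to EMPTY. -/
def sendIdx : Pc op → Option ℕ
  | exitSend _ _ n _ => some n
  | exitEmpty _ _ n => some n
  | _ => none

/-- Here the slot of `next` has been emptied but `next` has not been incremented yet; the number
`next` already counts as done. This is the only delay between the two. -/
def IsIncr : Pc op → Prop
  | exitIncr _ _ => True
  | _ => False

/-- The output that is being sent downstream. -/
def phase : Pc op → Option (Feed β)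
  | exitSend _ _ _ a => some a
  | exitEmpty _ _ _ => some (.ready [])
  | exitIncr _ _ => some (.ready [])
  | _ => none

/-- The worker may rely on the flag having been clear at a time when slot `next` was EMPTY. -/
def Awake (n : ℕ) : Pc op → Prop
  | testAndSet _ _ => True
  | recheck _ _ n' => n' = n
  | _ => False

/-- The partition that the worker owns and from which it has taken a tuple. -/
def taken : Pc op → Option ℕ
  | release p => some p
  | load b => some b.bucket
  | store b _ => some b.bucket
  | addLoad b _ => some b.bucket
  | addSet b _ => some b.bucket
  | testAndSet b _ => some b.bucket
  | exitNext b _ => some b.bucket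
  | exitBuf b _ _ => some b.bucket
  | exitSend b _ _ _ => some b.bucket
  | exitEmpty b _ _ => some b.bucket
  | exitIncr b _ => some b.bucket
  | exitClear b _ _ => some b.bucket
  | recheck b _ _ => some b.bucket
  | sent b _ => some b.bucket
  | _ => none

/-- The partition that the worker owns. -/
def owned : Pc op → Option ℕ
  | take p => some p
  | pc => pc.taken

/-- The partition that the worker is about to claim. -/
def claims : Pc op → Option ℕ
  | claim p => some p
  | _ => none

/-- The control states that occur at a stateless or partitioned operator. -/
def Numbered : Pc op → Prop
  | emit _ => False
  | claim _ => op.kind = .partitioned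
  | take _ => op.kind = .partitioned
  | release _ => op.kind = .partitioned
  | _ => True

end Pc

/-- Where the tuple with a given serial number is: waiting to be dequeued, held by a worker, its
output in the reordering buffer, or its output sent. -/
inductive Loc (ι : Type) where
  | queued
  | held (w : ι)
  | buffered
  | done

section

variable {α β : Type u} {op : Operator.{u, v} α β} {ι : Type} [DecidableEq ι]

/-! ## The flag -/

/-- The flag protects the exit section, and a full slot `next` does not go unnoticed. -/
structure FlagInv (s : ℕ) (m : OpMem op) (pcs : ι → Pc op) : Prop where
  unique : ∀ w w', (pcs w).InExit → (pcs w').InExit → w = w'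
  flag_of : ∀ w, (pcs w).InExit → m.flag = true
  of_flag : m.flag = true → ∃ w, (pcs w).InExit
  idx : ∀ w n, (pcs w).exitIdx = some n → n = m.next
  wake : ∀ o, m.buffer (m.next % s) = some o → m.flag = true ∨ ∃ w, (pcs w).Awake m.next

theorem Pc.inExit_of_exitIdx {pc : Pc op} {n : ℕ} (h : pc.exitIdx = some n) : pc.InExit := by
  cases pc <;> simp_all [Pc.exitIdx, Pc.InExit]

theorem Pc.exitIdx_of_sendIdx {pc : Pc op} {n : ℕ} (h : pc.sendIdx = some n) :
    pc.exitIdx = some n := by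
  cases pc <;> simp_all [Pc.exitIdx, Pc.sendIdx]

theorem Pc.inExit_of_isIncr {pc : Pc op} (h : pc.IsIncr) : pc.InExit := by
  cases pc <;> simp_all [Pc.IsIncr, Pc.InExit]

theorem Pc.inExit_of_phase {pc : Pc op} {a : Feed β} (h : pc.phase = some a) : pc.InExit := by
  cases pc <;> simp_all [Pc.phase, Pc.InExit]

theorem Pc.held_of_computing {pc : Pc op} {b : Job α} (h : pc.computing = some b) :
    pc.held = some b := by
  cases pc <;> simp_all [Pc.computing, Pc.held]

theorem Pc.taken_of_computing {pc : Pc op} {b : Job α} (h : pc.computing = some b) :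
    pc.taken = some b.bucket := by
  cases pc <;> simp_all [Pc.computing, Pc.taken]

theorem Pc.taken_of_held {pc : Pc op} {b : Job α} (h : pc.held = some b) :
    pc.taken = some b.bucket := by
  unfold Pc.held at h
  split at h <;> simp_all [Pc.taken]

theorem Pc.owned_of_taken {pc : Pc op} {p : ℕ} (h : pc.taken = some p) :
    pc.owned = some p := by
  cases pc <;> simp_all [Pc.taken, Pc.owned]

/-- A step of worker `w` that is of no relevance to the flag. -/
theorem FlagInv.quiet {s : ℕ} {m m' : OpMem op} {pcs : ι → Pc op} {pc' : Pc op}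
    (h : FlagInv s m pcs) (w : ι) (hf : m'.flag = m.flag) (hn : m'.next = m.next)
    (hE : pc'.InExit ↔ (pcs w).InExit) (hI : ∀ n, pc'.exitIdx = some n → n = m.next)
    (hB : ∀ o, m'.buffer (m.next % s) = some o →
      m.buffer (m.next % s) = some o ∨ m.flag = true ∨ pc'.Awake m.next)
    (hA : (pcs w).Awake m.next → pc'.Awake m.next ∨ m.flag = true ∨ m.buffer (m.next % s) = none) :
    FlagInv s m' (update pcs w pc') := by
  obtain ⟨h1, h2, h3, h4, h5⟩ := h
  refine ⟨?_, ?_, ?_, ?_, ?_⟩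
  · grind [Function.update_apply]
  · grind [Function.update_apply]
  · intro h
    rw [Function.exists_update_iff (p := fun _ (x : Pc op) => x.InExit)]
    grind
  · grind [Function.update_apply]
  · intro o ho
    rw [hn] at ho ⊢
    rw [hf, Function.exists_update_iff (p := fun _ (x : Pc op) => x.Awake m.next)]
    rcases hB o ho with h | h | h
    · rcases h5 o h with h' | ⟨w', h'⟩
      · exact Or.inl h'
      · by_cases e : w' = w
        · subst e
          rcases hA h' with h' | h' | h'
          · exact Or.inr (Or.inl h')
          · exact Or.inl h'
          · simp [h'] at h
        · exact Or.inr (Or.inr ⟨w', e, h'⟩)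
    · exact Or.inl h
    · exact Or.inr (Or.inl h)

theorem FlagInv.feed {s : ℕ} {m m' : OpMem op} {pcs : ι → Pc op} {a a' : Feed α}
    (h : FlagInv s m pcs) (hs : FeedStep op a m a' m') : FlagInv s m' pcs := by
  obtain ⟨h1, h2, h3, h4, h5⟩ := h
  cases hs <;> exact ⟨h1, h2, h3, h4, h5⟩

/-- For `wake`: a worker that has just filled a slot is at `testAndSet`; one that gives up there has
seen the flag set; one that gives up at `recheck` has seen the slot EMPTY. The three steps that
change the flag or `next` are treated separately. -/
theorem FlagInv.local {s : ℕ} {m m' : OpMem op} {pcs : ι → Pc op} {w : ι} {pc pc' : Pc op}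
    (h : FlagInv s m pcs) (hw : pcs w = pc) (hs : LocalStep op s pc m pc' m') :
    FlagInv s m' (update pcs w pc') := by
  have g1 := h.unique w
  have g2 := h.flag_of w
  have g3 := h.of_flag
  have g4 := h.idx w
  rw [hw] at g1 g2 g4
  cases hs
  case flagFree hf =>
    refine ⟨?_, ?_, ?_, ?_, ?_⟩
    · have := h.flag_of
      grind [Function.update_apply]
    · intros; rfl
    · intro _
      exact ⟨w, by simp [Pc.InExit]⟩
    · have := h.flag_of
      grind [Function.update_apply, Pc.inExit_of_exitIdx, Pc.exitIdx]
    · intros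
      exact Or.inl rfl
  -- With a new `next`, a worker at `recheck` with the old index no longer counts as awake, but the
  -- flag is set at this moment.
  case exitIncr =>
    have g := fun w' => g1 w' trivial
    refine ⟨?_, ?_, ?_, ?_, ?_⟩
    · grind [Function.update_apply]
    · intros
      exact g2 trivial
    · intro _
      exact ⟨w, by simp [Pc.InExit]⟩
    · grind [Function.update_apply, Pc.inExit_of_exitIdx, Pc.exitIdx]
    · intros
      exact Or.inl (g2 trivial)
  -- The worker that clears the flag is itself the new witness for `wake`: it is about to reload the
  -- slot of `n`, and `n` is the current `next`.
  case exitClear n =>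
    have g := fun w' => g1 w' trivial
    have hn : n = m.next := g4 n rfl
    refine ⟨?_, ?_, ?_, ?_, ?_⟩
    · grind [Function.update_apply, Pc.InExit]
    · grind [Function.update_apply, Pc.InExit]
    · simp
    · grind [Function.update_apply, Pc.inExit_of_exitIdx, Pc.exitIdx]
    · intros
      exact Or.inr ⟨w, by simp [Pc.Awake, hn]⟩
  all_goals
    refine h.quiet w rfl rfl ?_ ?_ ?_ ?_ <;> try simp only [hw]
    · simp [Pc.InExit]
    · simp only [Pc.exitIdx] at g4 ⊢; grind
    · simp only [Pc.InExit, Pc.Awake] at g2 ⊢; grind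
    · simp only [Pc.Awake]; grind

theorem FlagInv.send {s : ℕ} {m : OpMem op} {pcs : ι → Pc op} {w : ι} {b : Job α}
    {r : Option (List β)} {n : ℕ} {a : Feed β} (h : FlagInv s m pcs)
    (hw : pcs w = .exitSend b r n a) (a' : Feed β) :
    FlagInv s m (update pcs w (.exitSend b r n a')) := by
  have g4 := h.idx w
  rw [hw] at g4
  refine h.quiet w rfl rfl ?_ ?_ ?_ ?_ <;> try simp only [hw]
  · simp [Pc.InExit]
  · exact g4
  · simp +contextual
  · simp [Pc.Awake]

theorem FlagInv.leave {s : ℕ} {m : OpMem op} {pcs : ι → Pc op} {w : ι} (h : FlagInv s m pcs)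
    (hw : pcs w = .again) : FlagInv s m (update pcs w .start) := by
  refine h.quiet w rfl rfl ?_ ?_ ?_ ?_ <;>
    simp +contextual [hw, Pc.InExit, Pc.exitIdx, Pc.Awake]

theorem FlagInv.init (s : ℕ) : FlagInv s (OpMem.init op) (fun _ : ι => .start) := by
  constructor <;> simp [Pc.InExit, Pc.exitIdx, Pc.Awake, OpMem.init]

/-! ## The reordering buffer -/

/-- The position of every tuple: before it is dequeued, in the hands of a worker, in the
reordering buffer, and sent. The function `hq` gives the last tuple dequeued from a bucket. -/
structure LocInv (s : ℕ) (m : OpMem op) (pcs : ι → Pc op) (L : List α) (hq : ℕ → ℕ)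
    (loc : ℕ → Loc ι) : Prop where
  done_iff : ∀ t, loc t = .done ↔ t < m.next ∨ (t = m.next ∧ ∃ w, (pcs w).IsIncr)
  queued_iff : ∀ t, loc t = .queued ↔ 0 < t ∧ ∀ x, At L t x → hq (op.bucketOf x) < t
  held_loc : ∀ w b, (pcs w).held = some b → loc b.serial = .held w
  loc_held : ∀ w t, loc t = .held w → ∃ b, (pcs w).held = some b ∧ b.serial = t
  buf_range : ∀ t, loc t = .buffered → t < m.next + s
  buf_out : ∀ t, loc t = .buffered → ∃ o, m.buffer (t % s) = some o ∧ op.OutIs L t o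
  loc_buf : ∀ i o, m.buffer i = some o → ∃ t, loc t = .buffered ∧ t % s = i
  set_range : ∀ w b o, pcs w = .addSet b o → b.serial < m.next + s
  sending : ∀ w n, (pcs w).sendIdx = some n → loc n = .buffered
  job : ∀ w b, (pcs w).held = some b →
    At L b.serial b.tuple ∧ b.bucket = op.bucketOf b.tuple

theorem eq_of_mod_eq_of_range {a b n s : ℕ} (h : a % s = b % s) (ha : n ≤ a) (ha' : a < n + s)
    (hb : n ≤ b) (hb' : b < n + s) : a = b := by
  have h1 := Nat.div_add_mod a s
  have h2 := Nat.div_add_mod b s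
  rcases lt_trichotomy (a / s) (b / s) with hlt | heq | hgt
  · have := Nat.mul_le_mul_left s (Nat.succ_le_of_lt hlt)
    rw [Nat.mul_succ] at this
    omega
  · rw [heq] at h1
    omega
  · have := Nat.mul_le_mul_left s (Nat.succ_le_of_lt hgt)
    rw [Nat.mul_succ] at this
    omega

section

variable {s : ℕ} {m m' : OpMem op} {pcs : ι → Pc op} {L : List α} {hq : ℕ → ℕ}
  {loc : ℕ → Loc ι} {w : ι}

theorem LocInv.next_le (h : LocInv s m pcs L hq loc) {t : ℕ} (ht : loc t ≠ .done) :
    m.next ≤ t := by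
  by_contra hlt
  exact ht ((h.done_iff t).2 (Or.inl (by omega)))

/-- Numbers that have not been drawn count as queued, since the condition on their tuple is vacuous.
-/
theorem LocInv.le_length (h : LocInv s m pcs L hq loc) {t : ℕ} (ht : loc t ≠ .queued) :
    t ≤ L.length := by
  by_contra hlt
  refine ht ((h.queued_iff t).2 ⟨by omega, fun x hx => ?_⟩)
  have := hx.le
  omega

/-- Both numbers lie in a window of `s` consecutive integers starting at `next`: the lower bound
holds because they are not done, the upper one by `buf_range` and `hr`. -/
theorem LocInv.eq_of_slot (h : LocInv s m pcs L hq loc) {t t' : ℕ} (e : t % s = t' % s)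
    (ht : loc t = .buffered) (ht' : loc t' ≠ .done) (hr : t' < m.next + s) : t = t' :=
  eq_of_mod_eq_of_range e (h.next_le (by simp [ht])) (h.buf_range t ht) (h.next_le ht') hr

/-- The number whose output fills the slot lies in the same window as `next` and has the same
residue. While some worker is at `exitIncr` the number `next` is done, which is why that case is
excluded. -/
theorem LocInv.buffered_of_slot (h : LocInv s m pcs L hq loc) (hs : 0 < s) {o : List β}
    (hi : ¬ ∃ w, (pcs w).IsIncr) (ho : m.buffer (m.next % s) = some o) :
    loc m.next = .buffered := by
  obtain ⟨t, ht, e⟩ := h.loc_buf _ _ ho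
  have : loc m.next ≠ .done := by
    rw [Ne, h.done_iff]
    simpa using hi
  rwa [← h.eq_of_slot e ht this (by omega)]

theorem LocInv.quiet (h : LocInv s m pcs L hq loc) (w : ι) {pc' : Pc op}
    (hn : m'.next = m.next) (hb : m'.buffer = m.buffer) (hH : pc'.held = (pcs w).held)
    (hI : ¬ pc'.IsIncr) (hI' : ¬ (pcs w).IsIncr)
    (hA : ∀ b o, pc' = .addSet b o → b.serial < m.next + s)
    (hS : ∀ n, pc'.sendIdx = some n → loc n = .buffered) :
    LocInv s m' (update pcs w pc') L hq loc := by
  obtain ⟨h1, h2, h3, h4, h5, h6, h7, h8, h9, h10⟩ := h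
  refine ⟨?_, h2, ?_, ?_, ?_, ?_, ?_, ?_, ?_, ?_⟩
  · intro t
    rw [h1, hn, Function.exists_update_iff (p := fun _ (x : Pc op) => x.IsIncr)]
    grind
  · grind [Function.update_apply]
  · grind [Function.update_apply]
  · grind
  · grind
  · rwa [hb]
  · grind [Function.update_apply]
  · grind [Function.update_apply]
  · grind [Function.update_apply]

theorem LocInv.feed {a a' : Feed α} (h : LocInv s m pcs L hq loc)
    (hs : FeedStep op a m a' m') (hq_le : ∀ p, hq p ≤ L.length) :
    LocInv s m' pcs (L ++ a.fresh) hq loc := by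
  have hn : m'.next = m.next := by cases hs <;> rfl
  have hb : m'.buffer = m.buffer := by cases hs <;> rfl
  obtain ⟨h1, h2, h3, h4, h5, h6, h7, h8, h9, h10⟩ := h
  refine ⟨?_, ?_, h3, h4, ?_, ?_, ?_, ?_, h9, ?_⟩
  · rwa [hn]
  · intro t
    rw [h2]
    refine and_congr_right fun h0 => ⟨fun h x hx => ?_, fun h x hx => h x (hx.append _)⟩
    by_cases ht : t ≤ L.length
    · obtain ⟨y, hy⟩ := exists_at h0 ht
      rw [hx.unique (hy.append _)]
      exact h y hy
    -- Only a tuple that is just being logged has a position beyond `L`, and nothing beyond `L` has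
    -- been dequeued.
    · have := hq_le (op.bucketOf x)
      omega
  · rwa [hn]
  · intro t ht
    obtain ⟨o, ho, ho'⟩ := h6 t ht
    exact ⟨o, hb ▸ ho, ho'.append _⟩
  · rwa [hb]
  · rwa [hn]
  · exact fun w b hb => ⟨(h10 w b hb).1.append _, (h10 w b hb).2⟩

/-- A worker dequeues the tuple `x` with serial number `t`. -/
theorem LocInv.take {t : ℕ} {x : α} {hq' : ℕ → ℕ} (h : LocInv s m pcs L hq loc)
    (hw : (pcs w).held = none) (hI : ¬ (pcs w).IsIncr) (hn : m'.next = m.next)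
    (hb : m'.buffer = m.buffer) (hx : At L t x) (ht : hq (op.bucketOf x) < t)
    (hq_iff : ∀ u y, At L u y →
      (hq' (op.bucketOf y) < u ↔ hq (op.bucketOf y) < u ∧ u ≠ t)) :
    LocInv s m' (update pcs w (.load ⟨t, op.bucketOf x, x⟩)) L hq' (update loc t (.held w)) := by
  have hloc : loc t = .queued := (h.queued_iff t).2 ⟨hx.1, fun y hy => hx.unique hy ▸ ht⟩
  obtain ⟨h1, h2, h3, h4, h5, h6, h7, h8, h9, h10⟩ := h
  refine ⟨?_, ?_, ?_, ?_, ?_, ?_, ?_, ?_, ?_, ?_⟩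
  · intro u
    rw [hn, Function.exists_update_iff (p := fun _ (x : Pc op) => x.IsIncr)]
    have := h1 u
    grind [Function.update_apply, Pc.IsIncr]
  · intro u
    by_cases e : u = t
    · subst e
      simp only [Function.update_self, reduceCtorEq, false_iff, not_and, not_forall]
      exact fun _ => ⟨x, hx, by simp [hq_iff u x hx]⟩
    · rw [Function.update_of_ne e, h2]
      refine and_congr_right fun _ => forall₂_congr fun y hy => ?_
      simp [hq_iff u y hy, e]
  · grind [Function.update_apply, Pc.held]
  · intro w' u hu
    by_cases e : u = t
    · subst e
      simp only [Function.update_self, Loc.held.injEq] at hu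
      subst hu
      exact ⟨_, by rw [Function.update_self]; rfl, rfl⟩
    · rw [Function.update_of_ne e] at hu
      obtain ⟨b, hb, rfl⟩ := h4 w' u hu
      have e' : w' ≠ w := by
        rintro rfl
        simp [hw] at hb
      exact ⟨b, by rwa [Function.update_of_ne e'], rfl⟩
  · grind [Function.update_apply]
  · grind [Function.update_apply]
  · intro i o ho
    rw [hb] at ho
    obtain ⟨u, hu, e⟩ := h7 i o ho
    exact ⟨u, by grind [Function.update_apply], e⟩
  · grind [Function.update_apply]
  · grind [Function.update_apply, Pc.sendIdx]
  · grind [Function.update_apply, Pc.held]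

/-- The entry condition was tested earlier, but it is still valid: `next` only grows, which keeps
the upper bound, and `next` cannot pass a number that is still held. So any occupant of the slot
would be `b.serial` itself, which is held and not buffered; the slot is free. -/
theorem LocInv.addSet {b : Job α} {o : List β} (h : LocInv s m pcs L hq loc)
    (hw : pcs w = .addSet b o) (ho : op.OutIs L b.serial o) :
    LocInv s { m with buffer := update m.buffer (b.serial % s) (some o) }
      (update pcs w (.testAndSet b none)) L hq (update loc b.serial .buffered) := by
  have hh := h.held_loc w b (by simp [hw, Pc.held])
  have hr := h.set_range w b o hw
  have hslot := fun t (e : t % s = b.serial % s) ht => h.eq_of_slot e ht (by simp [hh]) hr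
  obtain ⟨h1, h2, h3, h4, h5, h6, h7, h8, h9, h10⟩ := h
  refine ⟨?_, ?_, ?_, ?_, ?_, ?_, ?_, ?_, ?_, ?_⟩
  · intro u
    rw [Function.exists_update_iff (p := fun _ (x : Pc op) => x.IsIncr)]
    have := h1 u
    grind [Function.update_apply, Pc.IsIncr]
  · grind [Function.update_apply]
  · grind [Function.update_apply, Pc.held]
  · grind [Function.update_apply, Pc.held]
  · grind [Function.update_apply]
  · grind [Function.update_apply]
  · intro i o' ho'
    by_cases e : i = b.serial % s
    · exact ⟨b.serial, by simp, e.symm⟩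
    · obtain ⟨u, hu, e'⟩ := h7 i o' (by simpa [e] using ho')
      exact ⟨u, by grind [Function.update_apply], e'⟩
  · grind [Function.update_apply]
  · grind [Function.update_apply, Pc.sendIdx]
  · grind [Function.update_apply, Pc.held]

/-- Emptying the slot removes the output of `n` only, as no other buffered number shares the slot.
The number `n = next` becomes done through the second alternative of `done_iff`, with `w` as the
witness. -/
theorem LocInv.exitEmpty {b : Job α} {r : Option (List β)} {n : ℕ}
    (h : LocInv s m pcs L hq loc) (hf : FlagInv s m pcs) (hw : pcs w = .exitEmpty b r n) :
    LocInv s { m with buffer := update m.buffer (n % s) none }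
      (update pcs w (.exitIncr b r)) L hq (update loc n .done) := by
  have hn : n = m.next := hf.idx w n (by simp [hw, Pc.exitIdx])
  have hl := h.sending w n (by simp [hw, Pc.sendIdx])
  have hu : ∀ w', (pcs w').InExit → w' = w := fun w' h' =>
    hf.unique w' w h' (by simp [hw, Pc.InExit])
  have hu1 : ∀ w', ¬ (pcs w').IsIncr := fun w' h' => by
    have := hu w' (Pc.inExit_of_isIncr h')
    subst this
    simp [hw, Pc.IsIncr] at h'
  have hslot := fun t (e : t % s = n % s) ht =>
    h.eq_of_slot e ht (by simp [hl]) (h.buf_range n hl)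
  obtain ⟨h1, h2, h3, h4, h5, h6, h7, h8, h9, h10⟩ := h
  refine ⟨?_, ?_, ?_, ?_, ?_, ?_, ?_, ?_, ?_, ?_⟩
  · intro u
    rw [Function.exists_update_iff (p := fun _ (x : Pc op) => x.IsIncr)]
    have := h1 u
    grind [Function.update_apply, Pc.IsIncr]
  · grind [Function.update_apply]
  · cases r <;> grind [Function.update_apply, Pc.held]
  · cases r <;> grind [Function.update_apply, Pc.held]
  · grind [Function.update_apply]
  · grind [Function.update_apply]
  · intro i o' ho'
    by_cases e : i = n % s
    · simp [e] at ho'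
    · obtain ⟨u, hu, e'⟩ := h7 i o' (by simpa [e] using ho')
      exact ⟨u, by grind [Function.update_apply], e'⟩
  · grind [Function.update_apply]
  · have := fun w' n' (h : (pcs w').sendIdx = some n') =>
      hu w' (Pc.inExit_of_exitIdx (Pc.exitIdx_of_sendIdx h))
    grind [Function.update_apply, Pc.sendIdx]
  · cases r <;> grind [Function.update_apply, Pc.held]

/-- No number changes its place: by the uniqueness of the worker in the exit section, the
exceptional alternative `t = next` of `done_iff` turns into `t < next + 1`. -/
theorem LocInv.exitIncr {b : Job α} {r : Option (List β)}
    (h : LocInv s m pcs L hq loc) (hf : FlagInv s m pcs) (hw : pcs w = .exitIncr b r) :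
    LocInv s { m with next := m.next + 1 } (update pcs w (.exitNext b r)) L hq loc := by
  have hu : ∀ w', (pcs w').InExit → w' = w := fun w' h' =>
    hf.unique w' w h' (by simp [hw, Pc.InExit])
  have hi : ∃ w, (pcs w).IsIncr := ⟨w, by simp [hw, Pc.IsIncr]⟩
  obtain ⟨h1, h2, h3, h4, h5, h6, h7, h8, h9, h10⟩ := h
  refine ⟨?_, h2, ?_, ?_, ?_, ?_, ?_, ?_, ?_, ?_⟩
  · intro u
    have h' : ¬ ∃ w', ((update pcs w (.exitNext b r)) w').IsIncr := by
      rw [Function.exists_update_iff (p := fun _ (x : Pc op) => x.IsIncr)]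
      have := fun w' (h : (pcs w').IsIncr) => hu w' (Pc.inExit_of_isIncr h)
      grind [Pc.IsIncr]
    rw [h1]
    simp only [hi, h', and_true, and_false, or_false]
    omega
  · cases r <;> grind [Function.update_apply, Pc.held]
  · cases r <;> grind [Function.update_apply, Pc.held]
  · grind
  · grind
  · grind
  · grind [Function.update_apply]
  · grind [Function.update_apply, Pc.sendIdx]
  · cases r <;> grind [Function.update_apply, Pc.held]

theorem LocInv.init : LocInv s (OpMem.init op) (fun _ : ι => .start) [] (fun _ => 0)
    (fun t => if t = 0 then .done else .queued) := by
  constructor <;> simp [Pc.IsIncr, Pc.held, Pc.sendIdx, OpMem.init, At]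
  all_goals grind

end

end

section

variable {α β : Type u} {op : Operator.{u, v} α β} {ι : Type} [DecidableEq ι]
  {s : ℕ} {m m' : OpMem op} {pcs : ι → Pc op} {L : List α} {hq hw : ℕ → ℕ}
  {loc : ℕ → Loc ι} {w : ι}

/-! ## The output -/

/-- The tuples sent so far are the outputs of the first inputs, in order. -/
structure OutInv (m : OpMem op) (pcs : ι → Pc op) (L : List α) (O : List β) (omid : Mid β) :
    Prop where
  send : ∀ w a, (pcs w).phase = some a →
    m.next ≤ L.length ∧ O ++ a.rest = op.outputsOf L m.next ∧ omid = a.mid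
  idle : (∀ w, (pcs w).phase = none) → O = op.outputsOf L (m.next - 1) ∧ omid = .idle
  le : m.next - 1 ≤ L.length

variable {O : List β} {omid : Mid β}

theorem OutInv.quiet (h : OutInv m pcs L O omid) (w : ι) {pc' : Pc op}
    (hn : m'.next = m.next) (hp : pc'.phase = (pcs w).phase) :
    OutInv m' (update pcs w pc') L O omid := by
  obtain ⟨h1, h2, h3⟩ := h
  have e : ∀ w', (update pcs w pc' w').phase = (pcs w').phase := by
    grind [Function.update_apply]
  exact ⟨by simpa only [e, hn] using h1, by simpa only [e, hn] using h2, by rwa [hn]⟩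

theorem OutInv.feed {a a' : Feed α} (h : OutInv m pcs L O omid)
    (hs : FeedStep op a m a' m') : OutInv m' pcs (L ++ a.fresh) O omid := by
  have hn : m'.next = m.next := by cases hs <;> rfl
  obtain ⟨h1, h2, h3⟩ := h
  refine ⟨fun w a hw => ?_, fun hw => ?_, ?_⟩
  · obtain ⟨h4, h5, h6⟩ := h1 w a hw
    rw [hn, op.outputsOf_append h4]
    exact ⟨by simp; omega, h5, h6⟩
  · rw [hn, op.outputsOf_append h3]
    exact h2 hw
  · simp only [hn, List.length_append]
    omega

/-- The worker found the slot of `next` full, so it is about to send the output of number `next`; as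
it is alone in the exit section, everything before that number has been sent and nothing else is in
progress. -/
theorem OutInv.exitFull {b : Job α} {r : Option (List β)} {n : ℕ} {o : List β}
    (h : OutInv m pcs L O omid) (hf : FlagInv s m pcs) (hl : LocInv s m pcs L hq loc)
    (hs : 0 < s) (hw : pcs w = .exitBuf b r n) (ho : m.buffer (n % s) = some o) :
    loc n = .buffered ∧ OutInv m (update pcs w (.exitSend b r n (.ready o))) L O omid := by
  have hn : n = m.next := hf.idx w n (by simp [hw, Pc.exitIdx])
  subst hn
  have hu : ∀ w', (pcs w').InExit → w' = w := fun w' h' =>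
    hf.unique w' w h' (by simp [hw, Pc.InExit])
  have hb : loc m.next = .buffered := by
    refine hl.buffered_of_slot hs ?_ ho
    rintro ⟨w', hw'⟩
    have := hu w' (Pc.inExit_of_isIncr hw')
    subst this
    simp [hw, Pc.IsIncr] at hw'
  have hp : ∀ w', (pcs w').phase = none := by
    intro w'
    by_contra hne
    obtain ⟨a, ha⟩ := Option.ne_none_iff_exists'.1 hne
    have := hu w' (Pc.inExit_of_phase ha)
    subst this
    simp [hw, Pc.phase] at ha
  obtain ⟨o', ho', hout⟩ := hl.buf_out _ hb
  obtain rfl : o' = o := by simpa [ho'] using ho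
  obtain ⟨h4, h5⟩ := h.idle hp
  have hle := hl.le_length (t := m.next) (by simp [hb])
  refine ⟨hb, ?_, ?_, h.le⟩
  · intro w' a ha
    by_cases e : w' = w
    · subst e
      simp only [Function.update_self, Pc.phase, Option.some.injEq] at ha
      subst ha
      exact ⟨hle, by rw [hout.outputsOf_eq, h4]; rfl, h5⟩
    · simp [e, hp] at ha
  · intro hp'
    simpa [Pc.phase] using hp' w

theorem OutInv.exitIncr {b : Job α} {r : Option (List β)} (h : OutInv m pcs L O omid)
    (hf : FlagInv s m pcs) (hw : pcs w = .exitIncr b r) :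
    OutInv { m with next := m.next + 1 } (update pcs w (.exitNext b r)) L O omid := by
  have hu : ∀ w', (pcs w').InExit → w' = w := fun w' h' =>
    hf.unique w' w h' (by simp [hw, Pc.InExit])
  obtain ⟨h1, h2, h3⟩ := h.send w (.ready []) (by simp [hw, Pc.phase])
  refine ⟨?_, fun _ => ?_, by simpa using h1⟩
  · intro w' a ha
    have e : w' = w := by
      by_contra e
      rw [Function.update_of_ne e] at ha
      exact e (hu w' (Pc.inExit_of_phase ha))
    subst e
    simp [Pc.phase] at ha
  · simpa [Feed.rest, Feed.mid] using And.intro h2 h3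

theorem OutInv.exitSend {b : Job α} {r : Option (List β)} {n : ℕ} {a a' : Feed β}
    (h : OutInv m pcs L O omid) (hf : FlagInv s m pcs) (hw : pcs w = .exitSend b r n a)
    (ha : a.fresh ++ a'.rest = a.rest) :
    OutInv m (update pcs w (.exitSend b r n a')) L (O ++ a.fresh) a'.mid := by
  have hu : ∀ w', (pcs w').InExit → w' = w := fun w' h' =>
    hf.unique w' w h' (by simp [hw, Pc.InExit])
  obtain ⟨h1, h2, h3⟩ := h.send w a (by simp [hw, Pc.phase])
  refine ⟨?_, fun hp => ?_, h.le⟩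
  · intro w' a'' ha''
    have e : w' = w := by
      by_contra e
      rw [Function.update_of_ne e] at ha''
      exact e (hu w' (Pc.inExit_of_phase ha''))
    subst e
    simp only [Function.update_self, Pc.phase, Option.some.injEq] at ha''
    subst ha''
    exact ⟨h1, by rw [List.append_assoc, ha, h2], rfl⟩
  · simpa [Pc.phase] using hp w

theorem OutInv.init : OutInv (OpMem.init op) (fun _ : ι => .start) [] [] .idle := by
  constructor <;> simp [Pc.phase, OpMem.init, Operator.outputsOf, Operator.seqMany]

/-! ## The values -/

/-- Every worker computes with the right state and has the right output. -/
structure ValueInv (pcs : ι → Pc op) (L : List α) : Prop where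
  cell : ∀ w b c, pcs w = .store b c → c = op.read (op.stateAfter L (b.serial - 1)) b.tuple
  out : ∀ w b o, (pcs w).carried = some (b, o) → op.OutIs L b.serial o

theorem ValueInv.update (h : ValueInv pcs L) (w : ι) {pc' : Pc op}
    (hc : ∀ b c, pc' = .store b c → c = op.read (op.stateAfter L (b.serial - 1)) b.tuple)
    (ho : ∀ b o, pc'.carried = some (b, o) → op.OutIs L b.serial o) :
    ValueInv (update pcs w pc') L := by
  obtain ⟨h1, h2⟩ := h
  constructor <;> grind [Function.update_apply]

theorem ValueInv.append (h : ValueInv pcs L) (hl : LocInv s m pcs L hq loc) (l : List α) :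
    ValueInv pcs (L ++ l) := by
  refine ⟨fun w b c hc => ?_, fun w b o ho => (h.out w b o ho).append l⟩
  have := (hl.job w b (by simp [hc, Pc.held])).1.le
  rw [op.stateAfter_append (by omega)]
  exact h.cell w b c hc

/-! ## The state of a partitioned operator -/

/-- The states of the keys of a bucket are those after the last tuple of the bucket whose new state
has been written; `hw` gives its serial number. -/
structure StoreInv (m : OpMem op) (pcs : ι → Pc op) (L : List α) (hq hw : ℕ → ℕ) : Prop where
  read_eq : ∀ x, op.read m.store x = op.read (op.stateAfter L (hw (op.bucketOf x))) x
  hw_le : ∀ p, hw p ≤ hq p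
  between : ∀ u x, At L u x → hw (op.bucketOf x) < u → u ≤ hq (op.bucketOf x) →
    ∃ w b, (pcs w).computing = some b ∧ b.serial = u
  lt_serial : ∀ w b, (pcs w).computing = some b → hw b.bucket < b.serial

theorem StoreInv.quiet (h : StoreInv m pcs L hq hw) (w : ι) {pc' : Pc op}
    (hs : m'.store = m.store) (hc : pc'.computing = (pcs w).computing) :
    StoreInv m' (update pcs w pc') L hq hw := by
  obtain ⟨h1, h2, h3, h4⟩ := h
  have e : ∀ w', (update pcs w pc' w').computing = (pcs w').computing := by
    grind [Function.update_apply]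
  exact ⟨by rwa [hs], h2, by simpa only [e] using h3, by simpa only [e] using h4⟩

theorem StoreInv.feed {a a' : Feed α} (h : StoreInv m pcs L hq hw)
    (hs : FeedStep op a m a' m') (hq_le : ∀ p, hq p ≤ L.length) :
    StoreInv m' pcs (L ++ a.fresh) hq hw := by
  have hst : m'.store = m.store := by cases hs <;> rfl
  obtain ⟨h1, h2, h3, h4⟩ := h
  refine ⟨fun x => ?_, h2, fun u x hu h5 h6 => ?_, h4⟩
  · rw [hst, op.stateAfter_append ((h2 _).trans (hq_le _))]
    exact h1 x
  · obtain ⟨y, hy⟩ := exists_at hu.1 (h6.trans (hq_le _))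
    obtain rfl := hu.unique (hy.append _)
    exact h3 u x hy h5 h6

theorem StoreInv.take {t p : ℕ} {x : α} {hq' : ℕ → ℕ} (h : StoreInv m pcs L hq hw)
    (hw' : (pcs w).computing = none) (hm : m'.store = m.store)
    (ht : hq p < t) (hle : ∀ p, hq p ≤ hq' p)
    (hq_iff : ∀ u y, At L u y →
      (hq' (op.bucketOf y) < u ↔ hq (op.bucketOf y) < u ∧ u ≠ t)) :
    StoreInv m' (update pcs w (.load ⟨t, p, x⟩)) L hq' hw := by
  obtain ⟨h1, h2, h3, h4⟩ := h
  refine ⟨by rwa [hm], fun p => (h2 p).trans (hle p), ?_, ?_⟩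
  · intro u y hu h5 h6
    by_cases e : u = t
    · exact ⟨w, _, by rw [Function.update_self]; rfl, e.symm⟩
    · obtain ⟨w', b, hb, hb'⟩ := h3 u y hu h5 (by have := hq_iff u y hu; grind)
      have : w' ≠ w := by
        rintro rfl
        simp [hw'] at hb
      exact ⟨w', b, by rwa [Function.update_of_ne this], hb'⟩
  · have := h2 p
    grind [Function.update_apply, Pc.computing]

/-- At most one worker owns a bucket. -/
def OwnInv (pcs : ι → Pc op) : Prop :=
  ∀ w w' p, (pcs w).owned = some p → (pcs w').owned = some p → w = w'

/-- Both workers own the bucket, so they are the same worker. -/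
theorem StoreInv.eq_of_computing (hl : LocInv s m pcs L hq loc)
    (ho : OwnInv pcs) {b b' : Job α} (hb : (pcs w).computing = some b) {w' : ι}
    (hb' : (pcs w').computing = some b') {y : α} (hy : At L b'.serial y)
    (e : op.bucketOf y = b.bucket) : w' = w ∧ b' = b := by
  have h1 := hl.job w' b' (Pc.held_of_computing hb')
  obtain rfl := hy.unique h1.1
  have h2 := Pc.owned_of_taken (Pc.taken_of_computing hb)
  have h3 := Pc.owned_of_taken (Pc.taken_of_computing hb')
  rw [h1.2, e] at h3
  have h4 := ho _ _ _ h3 h2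
  subst h4
  simpa [hb] using hb'.symm

/-- Otherwise the number would count as queued and could not be held. -/
theorem LocInv.serial_le (hl : LocInv s m pcs L hq loc) {b : Job α}
    (hb : (pcs w).held = some b) : b.serial ≤ hq b.bucket := by
  have h1 := hl.job w b hb
  have h2 := hl.held_loc w b hb
  by_contra hlt
  have : loc b.serial = .queued :=
    (hl.queued_iff _).2 ⟨h1.1.1, fun x hx => by
      rw [hx.unique h1.1, ← h1.2]
      omega⟩
  simp [this] at h2

/-- The store is that after tuple `hw` of the bucket. A tuple of the bucket strictly between `hw`
and `b.serial` would have to be in computation too, hence be `b` itself; so there is none, and the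
state up to `b.serial - 1` reads the same. -/
theorem StoreInv.read_of_computing (h : StoreInv m pcs L hq hw) (hl : LocInv s m pcs L hq loc)
    (ho : OwnInv pcs) {b : Job α} (hb : (pcs w).computing = some b) {y : α}
    (hy : op.bucketOf y = b.bucket) :
    op.read m.store y = op.read (op.stateAfter L (b.serial - 1)) y := by
  have h1 := h.lt_serial w b hb
  have h2 := hl.serial_le (Pc.held_of_computing hb)
  rw [h.read_eq y, hy]
  refine (op.read_stateAfter_congr (by omega) fun u x h3 h4 hx e => ?_).symm
  rw [hy] at e
  obtain ⟨w', b', hb', rfl⟩ := h.between u x hx (by rwa [e]) (by rw [e]; omega)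
  obtain ⟨-, rfl⟩ := eq_of_computing hl ho hb hb' hx e
  omega

/-- The cell `c` was loaded in an earlier step, and other buckets may have been written since. It is
still correct because the owner of the bucket is the only worker that writes there; `hw` of this
bucket advances to `b.serial`. -/
theorem StoreInv.store {b : Job α} {c : op.Cell} {pc' : Pc op} (h : StoreInv m pcs L hq hw)
    (hl : LocInv s m pcs L hq loc) (ho : OwnInv pcs) (hv : ValueInv pcs L)
    (hb : pcs w = .store b c) (hc : pc'.computing = none)
    (hm : m'.store = op.write m.store b.tuple (op.run c b.tuple).1) :
    StoreInv m' (update pcs w pc') L hq (update hw b.bucket b.serial) := by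
  have hb' : (pcs w).computing = some b := by simp [hb, Pc.computing]
  have hh := Pc.held_of_computing hb'
  obtain ⟨hj, hj'⟩ := hl.job w b hh
  have hle := hl.serial_le hh
  refine ⟨?_, ?_, ?_, ?_⟩
  · intro x
    rw [hm]
    by_cases e : op.bucketOf x = b.bucket
    · rw [e, Function.update_self, op.stateAfter_of_at hj, hv.cell w b c hb]
      exact op.read_write_congr (h.read_of_computing hl ho hb' e) _ _
    · rw [Function.update_of_ne e, op.read_write_of_ne (by rw [← hj']; exact fun h => e h.symm)]
      exact h.read_eq x
  · intro p
    have := h.hw_le p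
    grind [Function.update_apply]
  · intro u x hu h1 h2
    by_cases e : op.bucketOf x = b.bucket
    · rw [e, Function.update_self] at h1
      have h3 := h.lt_serial w b hb'
      obtain ⟨w', b', hb'', rfl⟩ := h.between u x hu (by rw [e]; omega) h2
      obtain ⟨-, rfl⟩ := eq_of_computing hl ho hb' hb'' hu e
      omega
    · rw [Function.update_of_ne e] at h1
      obtain ⟨w', b', hb'', rfl⟩ := h.between u x hu h1 h2
      have : w' ≠ w := by
        rintro rfl
        obtain rfl : b' = b := by simpa [hb'] using hb''.symm
        exact e (by rw [hj', hu.unique hj])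
      exact ⟨w', b', by rwa [Function.update_of_ne this], rfl⟩
  · intro w' b' hb''
    by_cases e : w' = w
    · subst e
      simp [hc] at hb''
    · rw [Function.update_of_ne e] at hb''
      have e' : b'.bucket ≠ b.bucket := by
        intro e'
        refine e (ho w' w b.bucket (e' ▸ ?_) ?_) <;>
          exact Pc.owned_of_taken (Pc.taken_of_computing ‹_›)
      rw [Function.update_of_ne e']
      exact h.lt_serial w' b' hb''

theorem StoreInv.init : StoreInv (OpMem.init op) (fun _ : ι => .start) [] (fun _ => 0)
    (fun _ => 0) := by
  constructor <;> simp [Pc.computing, OpMem.init, Operator.stateAfter, Operator.seqMany, At]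

/-! ## The queues -/

/-- The worklist of a stateless operator. -/
structure SharedInv (m : OpMem op) (L : List α) (mid : Mid α) (pop : ℕ) : Prop where
  queue : m.shared ++ mid.tuple = numberFrom (pop + 1) (L.drop pop)
  pop_le : pop ≤ L.length
  serial : m.serial = L.length + 1

/-- The queues and counters of a partitioned operator. -/
structure PartInv [Fintype ι] (m : OpMem op) (pcs : ι → Pc op) (L : List α) (mid : Mid α)
    (pop : ℕ) (hq : ℕ → ℕ) : Prop where
  part : ∀ p, m.part p ++ mid.tuple.filter (fun y => decide (op.bucketOf y.2 = p)) =
    (numberFrom (hq p + 1) (L.drop (hq p))).filter (fun y => decide (op.bucketOf y.2 = p))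
  master : m.master ++ mid.token op = (L.drop pop).map op.bucketOf
  pop_le : pop ≤ L.length
  hq_le : ∀ p, hq p ≤ pop
  serial : m.serial = L.length + 1
  own : OwnInv pcs
  count_pos : ∀ p, 0 < m.count p ↔ ∃ w, (pcs w).owned = some p
  tokens : ∀ p, m.master.count p + mid.listedToken.count p +
      (Finset.univ.filter fun w => (pcs w).claims = some p).card + m.count p =
    (m.part p).length + (Finset.univ.filter fun w => (pcs w).taken = some p).card

/-- Both sides carry an added indicator, so that the balance of `PartInv.tokens` can be checked by
linear arithmetic without truncated subtraction. -/
theorem card_filter_update [Fintype ι] {κ : Type*} (f : ι → κ) (i : ι) (a : κ) (Q : κ → Prop)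
    [DecidablePred Q] :
    (Finset.univ.filter fun j => Q (update f i a j)).card + (if Q (f i) then 1 else 0) =
      (Finset.univ.filter fun j => Q (f j)).card + (if Q a then 1 else 0) := by
  simp only [Finset.card_filter]
  rw [← Finset.add_sum_erase _ _ (Finset.mem_univ i), ← Finset.add_sum_erase (a := i) _
    (fun j => if Q (f j) then 1 else 0) (Finset.mem_univ i), Function.update_self]
  have : ∑ x ∈ Finset.univ.erase i, (if Q (update f i a x) then 1 else 0) =
      ∑ x ∈ Finset.univ.erase i, (if Q (f x) then 1 else 0) := by
    refine Finset.sum_congr rfl fun x hx => ?_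
    rw [Function.update_of_ne (Finset.ne_of_mem_erase hx)]
  rw [this]
  omega

end

section

variable {α β : Type u} {op : Operator.{u, v} α β} {ι : Type} [DecidableEq ι] [Fintype ι]
  {s : ℕ} {m m' : OpMem op} {pcs : ι → Pc op} {L : List α} {mid : Mid α} {pop : ℕ}
  {hq hw : ℕ → ℕ} {loc : ℕ → Loc ι} {w : ι}

theorem SharedInv.feed {a a' : Feed α} (h : SharedInv m L a.mid pop)
    (hk : op.kind = .stateless) (hs : FeedStep op a m a' m') :
    SharedInv m' (L ++ a.fresh) a'.mid pop := by
  obtain ⟨h1, h2, h3⟩ := h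
  cases hs with
  | inbox h => simp [hk] at h
  | part h => simp [hk] at h
  | master h => simp [hk] at h
  | @number x xs =>
    refine ⟨?_, by simp [Feed.fresh]; omega, by simp [Feed.fresh, h3]⟩
    simp only [Feed.mid, Mid.tuple, List.append_nil] at h1
    simp only [Feed.mid, Mid.tuple, Feed.fresh, h3]
    rw [h1, List.drop_append_of_le_length h2, numberFrom_append]
    simp only [numberFrom, List.length_drop]
    congr 3
    omega
  | shared => exact ⟨by simpa [Feed.mid, Mid.tuple, Feed.fresh] using h1,
      by simpa [Feed.fresh] using h2, by simpa [Feed.fresh] using h3⟩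

theorem SharedInv.dequeue {t : ℕ} {x : α} {q : List (ℕ × α)} (h : SharedInv m L mid pop)
    (hm : m.shared = (t, x) :: q) :
    t = pop + 1 ∧ At L t x ∧ SharedInv { m with shared := q } L mid (pop + 1) := by
  obtain ⟨h1, h2, h3⟩ := h
  rw [hm] at h1
  cases hd : L.drop pop with
  | nil => simp [hd, numberFrom] at h1
  | cons y l =>
    have hl : l = L.drop (pop + 1) := by
      rw [← List.tail_drop, hd]
      rfl
    rw [hd] at h1
    simp only [numberFrom, List.cons_append, List.cons.injEq, Prod.mk.injEq] at h1
    obtain ⟨⟨rfl, rfl⟩, h1⟩ := h1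
    have := at_append_of_drop (l₁ := []) (by simpa using hd)
    exact ⟨rfl, by simpa using this, ⟨by rw [← hl]; exact h1, by simpa using this.le, h3⟩⟩

theorem PartInv.quiet (h : PartInv m pcs L mid pop hq) (w : ι) {pc' : Pc op}
    (hp : m'.part = m.part) (hm : m'.master = m.master) (hc : m'.count = m.count)
    (hs : m'.serial = m.serial) (ho : pc'.owned = (pcs w).owned)
    (ht : pc'.taken = (pcs w).taken) (hcl : pc'.claims = (pcs w).claims) :
    PartInv m' (update pcs w pc') L mid pop hq := by
  obtain ⟨h1, h2, h3, h4, h5, h6, h7, h8⟩ := h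
  have e1 : ∀ w', (update pcs w pc' w').owned = (pcs w').owned := by
    grind [Function.update_apply]
  have e2 : ∀ w', (update pcs w pc' w').taken = (pcs w').taken := by
    grind [Function.update_apply]
  have e3 : ∀ w', (update pcs w pc' w').claims = (pcs w').claims := by
    grind [Function.update_apply]
  refine ⟨by rwa [hp], by rwa [hm], h3, h4, by rwa [hs], ?_, ?_, ?_⟩
  · simpa only [OwnInv, e1] using h6
  · simpa only [hc, e1] using h7
  · simpa only [hc, hm, hp, e2, e3] using h8

theorem PartInv.feed {a a' : Feed α} (h : PartInv m pcs L a.mid pop hq)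
    (hk : op.kind = .partitioned) (hs : FeedStep op a m a' m') :
    PartInv m' pcs (L ++ a.fresh) a'.mid pop hq := by
  obtain ⟨h1, h2, h3, h4, h5, h6, h7, h8⟩ := h
  cases hs with
  | inbox h => simp [hk] at h
  | shared h => simp [hk] at h
  | @number x xs =>
    refine ⟨fun p => ?_, ?_, by simp [Feed.fresh]; omega, h4, by simp [Feed.fresh, h5],
      h6, h7, ?_⟩
    · have h1 := h1 p
      simp only [Feed.mid, Mid.tuple, List.filter_nil, List.append_nil] at h1
      simp only [Feed.mid, Mid.tuple, Feed.fresh, h5]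
      have h3' := (h4 p).trans h3
      rw [h1, List.drop_append_of_le_length h3', numberFrom_append, List.filter_append]
      simp only [numberFrom, List.length_drop]
      congr 4
      omega
    · simp only [Feed.mid, Mid.token, List.append_nil] at h2
      simp only [Feed.mid, Mid.token, Feed.fresh]
      rw [h2, List.drop_append_of_le_length h3]
      simp
    · simpa only [Feed.mid, Mid.listedToken] using h8
  | @part t x xs =>
    refine ⟨fun p => ?_, by simpa [Feed.mid, Mid.token, Feed.fresh] using h2,
      by simpa [Feed.fresh] using h3, h4, by simpa [Feed.fresh] using h5, h6, h7, fun p => ?_⟩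
    · have h1 := h1 p
      simp only [Feed.mid, Mid.tuple, Feed.fresh, List.append_nil, List.filter_nil] at h1 ⊢
      rw [← h1]
      by_cases e : op.bucketOf x = p
      · subst e
        simp
      · rw [Function.update_of_ne (Ne.symm e)]
        simp [e]
    · have h8 := h8 p
      simp only [Feed.mid, Mid.listedToken, List.count_nil] at h8 ⊢
      by_cases e : op.bucketOf x = p
      · subst e
        simp only [Function.update_self, List.length_append, List.length_singleton,
          List.count_singleton_self]
        omega
      · rw [Function.update_of_ne (Ne.symm e)]
        simp only [List.count_singleton, beq_iff_eq, e, if_false]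
        omega
  | @master p xs =>
    refine ⟨by simpa [Feed.mid, Mid.tuple, Feed.fresh] using h1,
      by simpa [Feed.mid, Mid.token, Feed.fresh] using h2,
      by simpa [Feed.fresh] using h3, h4, by simpa [Feed.fresh] using h5, h6, h7, fun p' => ?_⟩
    have h8 := h8 p'
    simp only [Feed.mid, Mid.listedToken, List.count_nil, List.count_append] at h8 ⊢
    omega

/-- In `tokens`, one unit moves from the master queue to the claiming workers. -/
theorem PartInv.popMaster {p : ℕ} {q : List ℕ} (h : PartInv m pcs L mid pop hq)
    (hw : pcs w = .start) (hm : m.master = p :: q) :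
    PartInv { m with master := q } (update pcs w (.claim p)) L mid (pop + 1) hq := by
  obtain ⟨h1, h2, h3, h4, h5, h6, h7, h8⟩ := h
  have e1 : ∀ w', (update pcs w (.claim p) w').owned = (pcs w').owned := by
    grind [Function.update_apply, Pc.owned, Pc.taken]
  have e2 : ∀ w', (update pcs w (.claim p) w').taken = (pcs w').taken := by
    grind [Function.update_apply, Pc.taken]
  rw [hm] at h2
  have hlen := congrArg List.length h2
  simp only [List.cons_append, List.length_cons, List.length_append, List.length_map,
    List.length_drop] at hlen
  refine ⟨h1, ?_, by omega, fun p => (h4 p).trans (Nat.le_succ _), h5, ?_, ?_, fun p' => ?_⟩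
  · rw [← List.tail_drop, List.map_tail, ← h2]
    rfl
  · simpa only [OwnInv, e1] using h6
  · simpa only [e1] using h7
  · have h8 := h8 p'
    have h9 := card_filter_update pcs w (.claim p) (fun pc => pc.claims = some p')
    have e4 : (pcs w).claims = none := by rw [hw]; rfl
    have e5 : (Pc.claim p : Pc op).claims = some p := rfl
    simp only [e4, e5, reduceCtorEq, if_false, Option.some.injEq] at h9
    simp only [e2]
    simp only [hm, List.count_cons, beq_iff_eq] at h8
    omega

/-- In `tokens`, one unit moves from the claiming workers to the counter. A bucket has an owner
exactly when its counter is positive, so a worker that finds zero becomes the only owner, and one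
that finds more leaves its token to the present owner. -/
theorem PartInv.claim {p : ℕ} {pc' : Pc op} (h : PartInv m pcs L mid pop hq)
    (hw : pcs w = .claim p) (hc : m.count p = 0 ∧ pc' = .take p ∨ m.count p ≠ 0 ∧ pc' = .again) :
    PartInv { m with count := update m.count p (m.count p + 1) } (update pcs w pc') L mid
      pop hq := by
  obtain ⟨h1, h2, h3, h4, h5, h6, h7, h8⟩ := h
  have e2 : ∀ w', (update pcs w pc' w').taken = (pcs w').taken := by
    rcases hc with ⟨-, rfl⟩ | ⟨-, rfl⟩ <;> grind [Function.update_apply, Pc.taken]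
  have e3 : pc'.claims = none := by
    rcases hc with ⟨-, rfl⟩ | ⟨-, rfl⟩ <;> rfl
  have e4 : (pcs w).owned = none := by simp [hw, Pc.owned, Pc.taken]
  refine ⟨h1, h2, h3, h4, h5, ?_, fun p' => ?_, fun p' => ?_⟩
  · have h7 := h7 p
    intro w₁ w₂ p' hw₁ hw₂
    have := h6 w₁ w₂ p'
    rcases hc with ⟨hc, rfl⟩ | ⟨hc, rfl⟩ <;>
      grind [Function.update_apply, Pc.owned, Pc.taken]
  · rw [Function.exists_update_iff (p := fun _ (x : Pc op) => x.owned = some p')]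
    have h7 := h7 p'
    have : (∃ w', w' ≠ w ∧ (pcs w').owned = some p') ↔ 0 < m.count p' := by
      rw [h7]
      grind
    rw [this]
    rcases hc with ⟨hc, rfl⟩ | ⟨hc, rfl⟩ <;>
      grind [Function.update_apply, Pc.owned, Pc.taken]
  · have h8 := h8 p'
    have h9 := card_filter_update pcs w pc' (fun pc => pc.claims = some p')
    have e5 : (pcs w).claims = some p := by rw [hw]; rfl
    simp only [e3, e5, reduceCtorEq, if_false, Option.some.injEq] at h9
    simp only [e2]
    by_cases e : p' = p
    · subst e
      rw [if_pos rfl] at h9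
      rw [Function.update_self]
      omega
    · rw [if_neg (Ne.symm e)] at h9
      rw [Function.update_of_ne e]
      omega

/-- One unit of the counter is balanced against the tuple that has been taken. The counter drops to
zero exactly when the owner gives up the bucket. -/
theorem PartInv.release {p : ℕ} {pc' : Pc op} (h : PartInv m pcs L mid pop hq)
    (hw : pcs w = .release p)
    (hc : 1 < m.count p ∧ pc' = .take p ∨ ¬ 1 < m.count p ∧ pc' = .again) :
    PartInv { m with count := update m.count p (m.count p - 1) } (update pcs w pc') L mid
      pop hq := by
  obtain ⟨h1, h2, h3, h4, h5, h6, h7, h8⟩ := h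
  have e2 : pc'.taken = none := by
    rcases hc with ⟨-, rfl⟩ | ⟨-, rfl⟩ <;> rfl
  have e3 : ∀ w', (update pcs w pc' w').claims = (pcs w').claims := by
    rcases hc with ⟨-, rfl⟩ | ⟨-, rfl⟩ <;> grind [Function.update_apply, Pc.claims]
  have e4 : (pcs w).owned = some p := by simp [hw, Pc.owned, Pc.taken]
  have hpos : 0 < m.count p := (h7 p).2 ⟨w, e4⟩
  refine ⟨h1, h2, h3, h4, h5, ?_, fun p' => ?_, fun p' => ?_⟩
  · intro w₁ w₂ p' hw₁ hw₂
    have := h6 w₁ w₂ p'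
    rcases hc with ⟨hc, rfl⟩ | ⟨hc, rfl⟩ <;>
      grind [Function.update_apply, Pc.owned, Pc.taken]
  · rw [Function.exists_update_iff (p := fun _ (x : Pc op) => x.owned = some p')]
    have h7 := h7 p'
    have : (∃ w', w' ≠ w ∧ (pcs w').owned = some p') ↔ 0 < m.count p' ∧ p' ≠ p := by
      rw [h7]
      have := h6 w
      grind
    rw [this]
    rcases hc with ⟨hc, rfl⟩ | ⟨hc, rfl⟩ <;>
      grind [Function.update_apply, Pc.owned, Pc.taken]
  · have h8 := h8 p'
    have h9 := card_filter_update pcs w pc' (fun pc => pc.taken = some p')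
    have e5 : (pcs w).taken = some p := by rw [hw]; rfl
    simp only [e2, e5, reduceCtorEq, if_false, Option.some.injEq] at h9
    simp only [e3]
    by_cases e : p' = p
    · subst e
      rw [if_pos rfl] at h9
      rw [Function.update_self]
      omega
    · rw [if_neg (Ne.symm e)] at h9
      rw [Function.update_of_ne e]
      omega

theorem count_map_eq_length_filter (f : α → ℕ) (p : ℕ) (l : List α) :
    (l.map f).count p = (l.filter (fun x => decide (f x = p))).length := by
  induction l with
  | nil => rfl
  | cons x l ih =>
    simp only [List.map_cons, List.count_cons, List.filter_cons, ih, beq_iff_eq,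
      decide_eq_true_eq]
    split <;> simp

/-- The owner of a bucket that is about to dequeue finds a tuple. -/
theorem PartInv.part_ne_nil {p : ℕ} (h : PartInv m pcs L mid pop hq) (hw : pcs w = .take p) :
    m.master.count p + mid.listedToken.count p < (m.part p).length := by
  have h1 : 0 < m.count p := (h.count_pos p).2 ⟨w, by simp [hw, Pc.owned]⟩
  -- An owner at the head of its loop has taken nothing at the moment, and there is no second owner.
  -- With a positive counter, `tokens` then leaves strictly more tuples in the partition queue than
  -- master entries still to be dequeued.
  have h2 : (Finset.univ.filter fun w => (pcs w).taken = some p).card = 0 := by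
    rw [Finset.card_eq_zero, Finset.filter_eq_empty_iff]
    intro w' _ hw'
    have := h.own w' w p (Pc.owned_of_taken hw') (by simp [hw, Pc.owned])
    subst this
    simp [hw, Pc.taken] at hw'
  have := h.tokens p
  omega

theorem Mid.count_token (p : ℕ) :
    (mid.token op).count p = mid.listedToken.count p +
      (mid.tuple.filter (fun y => decide (op.bucketOf y.2 = p))).length := by
  cases mid with
  | idle => rfl
  | numbered t x =>
    by_cases e : op.bucketOf x = p <;> simp [token, listedToken, tuple, e]
  | listed q => simp [token, listedToken, tuple]

/-- Counts the tuples of bucket `p` whose master entry has not been dequeued; the last summand is a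
tuple that has a number but is in no queue yet. -/
theorem PartInv.count_waiting (h : PartInv m pcs L mid pop hq) (p : ℕ) :
    m.master.count p + mid.listedToken.count p +
        (mid.tuple.filter (fun y => decide (op.bucketOf y.2 = p))).length =
      ((L.drop pop).filter (fun x => decide (op.bucketOf x = p))).length := by
  rw [← count_map_eq_length_filter op.bucketOf, ← h.master, List.count_append,
    Mid.count_token, Nat.add_assoc]

theorem PartInv.take {p t : ℕ} {x : α} {q : List (ℕ × α)} (h : PartInv m pcs L mid pop hq)
    (hw : pcs w = .take p) (hm : m.part p = (t, x) :: q) :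
    At L t x ∧ op.bucketOf x = p ∧ hq p < t ∧
      (∀ u y, At L u y → (update hq p t (op.bucketOf y) < u ↔ hq (op.bucketOf y) < u ∧ u ≠ t)) ∧
      PartInv { m with part := update m.part p q } (update pcs w (.load ⟨t, p, x⟩)) L mid pop
        (update hq p t) := by
  have hne := h.part_ne_nil hw
  have hcw := h.count_waiting p
  obtain ⟨h1, h2, h3, h4, h5, h6, h7, h8⟩ := h
  have hp := h1 p
  rw [hm, List.cons_append] at hp
  obtain ⟨l₁, l₂, hd, rfl, hl₁, hx, hr⟩ :=
    filter_numberFrom_eq_cons (f := fun x => decide (op.bucketOf x = p)) hp.symm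
  have hx : op.bucketOf x = p := by simpa using hx
  have hAt := at_append_of_drop hd
  have hdrop := drop_of_drop_eq hd
  have hiff : ∀ u y, At L u y → (update hq p (hq p + 1 + l₁.length) (op.bucketOf y) < u ↔
      hq (op.bucketOf y) < u ∧ u ≠ hq p + 1 + l₁.length) := by
    intro u y hu
    by_cases e : op.bucketOf y = p
    · rw [e, Function.update_self]
      refine ⟨fun _ => by omega, fun ⟨h9, h10⟩ => ?_⟩
      by_contra hlt
      have := hl₁ y (at_of_mem_between hd hu h9 (by omega))
      simp [e] at this
    · rw [Function.update_of_ne e]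
      refine ⟨fun h9 => ⟨h9, ?_⟩, fun h9 => h9.1⟩
      rintro rfl
      exact e (by rw [hu.unique hAt, hx])
  -- If the tuple came after position `pop`, the entire partition queue would consist of tuples
  -- whose master entries are not yet dequeued, against the strict inequality `hne`. This bound
  -- preserves `hq_le`, on which the liveness argument relies.
  have hpop : hq p + 1 + l₁.length ≤ pop := by
    by_contra hlt
    have h9 : L.drop pop = l₁.drop (pop - hq p) ++ x :: l₂ := by
      have h10 := h4 p
      have : pop = hq p + (pop - hq p) := by omega
      rw [this, ← List.drop_drop, hd, List.drop_append_of_le_length (by omega)]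
      congr 2
      omega
    have h10 : (l₁.drop (pop - hq p)).filter (fun x => decide (op.bucketOf x = p)) = [] := by
      rw [List.filter_eq_nil_iff]
      intro y hy
      have := hl₁ y (List.mem_of_mem_drop hy)
      simpa using this
    have h11 := congrArg List.length hr
    rw [length_filter_numberFrom (fun x => decide (op.bucketOf x = p))] at h11
    rw [h9, List.filter_append, h10, List.nil_append, List.filter_cons_of_pos (by simpa using hx),
      List.length_cons, ← h11] at hcw
    rw [hm, List.length_cons] at hne
    rw [List.length_append] at hcw
    omega
  refine ⟨hAt, hx, by omega, hiff, ⟨fun p' => ?_, h2, h3, fun p' => ?_, h5, ?_, ?_, fun p' => ?_⟩⟩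
  · by_cases e : p' = p
    · subst e
      simp only [Function.update_self]
      rw [hr, hdrop]
    · simpa only [Function.update_of_ne e] using h1 p'
  · by_cases e : p' = p
    · subst e
      simpa using hpop
    · simpa only [Function.update_of_ne e] using h4 p'
  · intro w₁ w₂ p' hw₁ hw₂
    have := h6 w₁ w₂ p'
    grind [Function.update_apply, Pc.owned, Pc.taken]
  · intro p'
    rw [Function.exists_update_iff (p := fun _ (x : Pc op) => x.owned = some p'), h7 p']
    grind [Pc.owned, Pc.taken]
  · have h8 := h8 p'
    have h9 := card_filter_update pcs w (.load ⟨hq p + 1 + l₁.length, p, x⟩)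
      (fun pc => pc.taken = some p')
    have e3 : ∀ w', (update pcs w (.load ⟨hq p + 1 + l₁.length, p, x⟩) w').claims =
        (pcs w').claims := by
      grind [Function.update_apply, Pc.claims]
    have e4 : (pcs w).taken = none := by rw [hw]; rfl
    have e5 : (Pc.load ⟨hq p + 1 + l₁.length, p, x⟩ : Pc op).taken = some p := rfl
    simp only [e4, e5, reduceCtorEq, if_false, Option.some.injEq] at h9
    simp only [e3]
    by_cases e : p' = p
    · subst e
      simp only [hm, List.length_cons] at h8
      rw [if_pos rfl] at h9
      rw [Function.update_self]
      omega
    · rw [if_neg (Ne.symm e)] at h9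
      rw [Function.update_of_ne e]
      omega

theorem PartInv.init : PartInv (OpMem.init op) (fun _ : ι => .start) [] .idle 0 (fun _ => 0) := by
  constructor <;> simp [OwnInv, Pc.owned, Pc.taken, Pc.claims, OpMem.init, Mid.tuple, Mid.token,
    Mid.listedToken, numberFrom]

theorem SharedInv.init : SharedInv (OpMem.init op) [] .idle 0 := by
  constructor <;> simp [OpMem.init, Mid.tuple, numberFrom]

end

section

variable {α β : Type u} {op : Operator.{u, v} α β} {ι : Type} [DecidableEq ι] [Fintype ι]
  {s : ℕ} {m m' : OpMem op} {pcs : ι → Pc op} {L : List α} {mid : Mid α} {pop : ℕ}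
  {hq hw : ℕ → ℕ} {loc : ℕ → Loc ι} {w : ι} {O : List β} {omid : Mid β}

/-! ## Stateless and partitioned operators -/

/-- The invariant of a stateless or partitioned operator. -/
structure NumInv (s : ℕ) (m : OpMem op) (pcs : ι → Pc op) (L : List α) (mid : Mid α) (pop : ℕ)
    (O : List β) (omid : Mid β) (hq hw : ℕ → ℕ) (loc : ℕ → Loc ι) : Prop where
  flag : FlagInv s m pcs
  loc : LocInv s m pcs L hq loc
  out : OutInv m pcs L O omid
  value : ValueInv pcs L
  numbered : ∀ w, (pcs w).Numbered
  stateless : op.kind = .stateless → SharedInv m L mid pop ∧ ∀ p, hq p = pop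
  part : op.kind = .partitioned → PartInv m pcs L mid pop hq ∧ StoreInv m pcs L hq hw

/-- The number of items in the worklist. -/
def OpMem.waiting (m : OpMem op) : ℕ :=
  match op.kind with
  | .stateful => m.inbox.length
  | .stateless => m.shared.length
  | .partitioned => m.master.length

theorem OpMem.worklistEmpty_iff (m : OpMem op) : m.WorklistEmpty ↔ m.waiting = 0 := by
  unfold WorklistEmpty waiting
  cases op.kind <;> simp

theorem OpKind.stateless_or_partitioned {k : OpKind} (h : k ≠ .stateful) :
    k = .stateless ∨ k = .partitioned := by
  cases k <;> simp_all

theorem NumInv.hq_le (hk : op.kind ≠ .stateful) (h : NumInv s m pcs L mid pop O omid hq hw loc)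
    (p : ℕ) : hq p ≤ pop := by
  rcases OpKind.stateless_or_partitioned hk with e | e
  · exact ((h.stateless e).2 p).le
  · exact (h.part e).1.hq_le p

theorem NumInv.pop_le (hk : op.kind ≠ .stateful)
    (h : NumInv s m pcs L mid pop O omid hq hw loc) : pop ≤ L.length := by
  rcases OpKind.stateless_or_partitioned hk with e | e
  · exact (h.stateless e).1.pop_le
  · exact (h.part e).1.pop_le

theorem NumInv.feed {a a' : Feed α} (hk : op.kind ≠ .stateful)
    (h : NumInv s m pcs L a.mid pop O omid hq hw loc) (hs : FeedStep op a m a' m') :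
    NumInv s m' pcs (L ++ a.fresh) a'.mid pop O omid hq hw loc := by
  have hle : ∀ p, hq p ≤ L.length := fun p => (h.hq_le hk p).trans (h.pop_le hk)
  exact ⟨h.flag.feed hs, h.loc.feed hs hle, h.out.feed hs, h.value.append h.loc _, h.numbered,
    fun e => ⟨(h.stateless e).1.feed e hs, (h.stateless e).2⟩,
    fun e => ⟨(h.part e).1.feed e hs, (h.part e).2.feed hs hle⟩⟩

theorem NumInv.quiet (h : NumInv s m pcs L mid pop O omid hq hw loc) {pc' : Pc op}
    (hf : FlagInv s m' (update pcs w pc'))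
    (hnext : m'.next = m.next) (hbuf : m'.buffer = m.buffer) (hshared : m'.shared = m.shared)
    (hpart : m'.part = m.part) (hmaster : m'.master = m.master) (hcount : m'.count = m.count)
    (hserial : m'.serial = m.serial) (hstore : m'.store = m.store)
    (hheld : pc'.held = (pcs w).held) (hcomp : pc'.computing = (pcs w).computing)
    (hphase : pc'.phase = (pcs w).phase) (hincr : ¬ pc'.IsIncr) (hincr' : ¬ (pcs w).IsIncr)
    (hset : ∀ b o, pc' = .addSet b o → b.serial < m.next + s)
    (hsend : ∀ n, pc'.sendIdx = some n → loc n = .buffered)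
    (hcell : ∀ b c, pc' = .store b c → c = op.read (op.stateAfter L (b.serial - 1)) b.tuple)
    (hout : ∀ b o, pc'.carried = some (b, o) → op.OutIs L b.serial o)
    (hnum : pc'.Numbered)
    (howned : op.kind = .partitioned → pc'.owned = (pcs w).owned ∧ pc'.taken = (pcs w).taken ∧
      pc'.claims = (pcs w).claims) :
    NumInv s m' (update pcs w pc') L mid pop O omid hq hw loc := by
  refine ⟨hf, h.loc.quiet w hnext hbuf hheld hincr hincr' hset hsend, h.out.quiet w hnext hphase,
    h.value.update w hcell hout, ?_, fun e => ?_, fun e => ?_⟩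
  · have := h.numbered
    grind [Function.update_apply]
  · obtain ⟨⟨h1, h2, h3⟩, h4⟩ := h.stateless e
    exact ⟨⟨by rwa [hshared], h2, by rwa [hserial]⟩, h4⟩
  · obtain ⟨h1, h2, h3⟩ := howned e
    exact ⟨(h.part e).1.quiet w hpart hmaster hcount hserial h1 h2 h3,
      (h.part e).2.quiet w hstore hcomp⟩

theorem NumInv.numbered_update (h : NumInv s m pcs L mid pop O omid hq hw loc) {pc' : Pc op}
    (w : ι) (hp : pc'.Numbered) : ∀ w', (update pcs w pc' w').Numbered := by
  have := h.numbered
  grind [Function.update_apply]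

theorem NumInv.popShared {t : ℕ} {x : α} {q : List (ℕ × α)}
    (h : NumInv s m pcs L mid pop O omid hq hw loc) (hw' : pcs w = .start)
    (hf : FlagInv s { m with shared := q } (update pcs w (.load ⟨t, 0, x⟩)))
    (hk : op.kind = .stateless) (hm : m.shared = (t, x) :: q) :
    NumInv s { m with shared := q } (update pcs w (.load ⟨t, 0, x⟩)) L mid (pop + 1) O omid
      (fun _ => pop + 1) hw (update loc t (.held w)) := by
  obtain ⟨h1, h2⟩ := h.stateless hk
  obtain ⟨rfl, hx, h3⟩ := h1.dequeue hm
  have e : op.bucketOf x = 0 := op.bucketOf_eq_zero hk x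
  refine ⟨hf, ?_, ?_, h.value.update w (by simp) (by simp [Pc.carried]),
    h.numbered_update w trivial, fun _ => ⟨h3, fun _ => rfl⟩, fun e => ?_⟩
  · have := h.loc.take (w := w) (m' := { m with shared := q }) (t := pop + 1) (x := x)
      (hq' := fun _ => pop + 1) (by simp [hw', Pc.held]) (by simp [hw', Pc.IsIncr]) rfl rfl hx
      (by rw [h2]; omega) (fun u y hu => by rw [h2]; omega)
    rwa [e] at this
  · exact h.out.quiet w rfl (by simp [hw', Pc.phase])
  · rw [hk] at e
    cases e

theorem NumInv.take {p t : ℕ} {x : α} {q : List (ℕ × α)}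
    (h : NumInv s m pcs L mid pop O omid hq hw loc) (hw' : pcs w = .take p)
    (hf : FlagInv s { m with part := update m.part p q } (update pcs w (.load ⟨t, p, x⟩)))
    (hm : m.part p = (t, x) :: q) :
    NumInv s { m with part := update m.part p q } (update pcs w (.load ⟨t, p, x⟩)) L mid pop O
      omid (update hq p t) hw (update loc t (.held w)) := by
  have hk : op.kind = .partitioned := by simpa [hw', Pc.Numbered] using h.numbered w
  obtain ⟨h1, h2⟩ := h.part hk
  obtain ⟨hx, rfl, hlt, hiff, h3⟩ := h1.take hw' hm
  refine ⟨hf, ?_, ?_, h.value.update w (by simp) (by simp [Pc.carried]),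
    h.numbered_update w trivial, fun e => ?_, fun _ => ⟨h3, ?_⟩⟩
  · exact h.loc.take (by simp [hw', Pc.held]) (by simp [hw', Pc.IsIncr]) rfl rfl hx hlt hiff
  · exact h.out.quiet w rfl (by simp [hw', Pc.phase])
  · rw [hk] at e
    cases e
  · refine h2.take (w := w) (by simp [hw', Pc.computing]) rfl hlt (fun p' => ?_) hiff
    grind [Function.update_apply]

theorem NumInv.storeOther {b : Job α} {c : op.Cell}
    (h : NumInv s m pcs L mid pop O omid hq hw loc) (hw' : pcs w = .store b c)
    (hf : FlagInv s { m with store := op.write m.store b.tuple (op.run c b.tuple).1 }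
      (update pcs w (.addLoad b (op.run c b.tuple).2))) :
    NumInv s { m with store := op.write m.store b.tuple (op.run c b.tuple).1 }
      (update pcs w (.addLoad b (op.run c b.tuple).2)) L mid pop O
      omid hq (update hw b.bucket b.serial) loc := by
  have hj := (h.loc.job w b (by simp [hw', Pc.held])).1
  refine ⟨hf, ?_, ?_, h.value.update w (by simp) ?_,
    h.numbered_update w trivial, fun e => ?_, fun e => ⟨?_, ?_⟩⟩
  · exact h.loc.quiet w rfl rfl (by simp [hw', Pc.held]) (by simp [Pc.IsIncr])
      (by simp [hw', Pc.IsIncr]) (by simp) (by simp [Pc.sendIdx])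
  · exact h.out.quiet w rfl (by simp [hw', Pc.phase])
  · simp only [Pc.carried, Option.some.injEq, Prod.mk.injEq]
    rintro _ _ ⟨rfl, rfl⟩
    exact ⟨b.tuple, hj, by rw [← h.value.cell w b c hw']⟩
  · obtain ⟨⟨h1, h2, h3⟩, h4⟩ := h.stateless e
    exact ⟨⟨h1, h2, h3⟩, h4⟩
  · exact (h.part e).1.quiet w rfl rfl rfl rfl (by simp [hw', Pc.owned, Pc.taken])
      (by simp [hw', Pc.taken]) (by simp [hw', Pc.claims])
  · exact (h.part e).2.store h.loc (h.part e).1.own h.value hw' (by simp [Pc.computing]) rfl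

/-- A step that changes neither the state nor the worklists. -/
theorem NumInv.buffer_step (h : NumInv s m pcs L mid pop O omid hq hw loc) {pc' : Pc op}
    {loc' : ℕ → Loc ι} (hf : FlagInv s m' (update pcs w pc'))
    (hl : LocInv s m' (update pcs w pc') L hq loc') (ho : OutInv m' (update pcs w pc') L O omid)
    (hshared : m'.shared = m.shared)
    (hpart : m'.part = m.part) (hmaster : m'.master = m.master) (hcount : m'.count = m.count)
    (hserial : m'.serial = m.serial) (hstore : m'.store = m.store)
    (hcomp : pc'.computing = (pcs w).computing)
    (hcell : ∀ b c, pc' = .store b c → c = op.read (op.stateAfter L (b.serial - 1)) b.tuple)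
    (hout : ∀ b o, pc'.carried = some (b, o) → op.OutIs L b.serial o)
    (hnum : pc'.Numbered)
    (howned : pc'.owned = (pcs w).owned) (htaken : pc'.taken = (pcs w).taken)
    (hclaims : pc'.claims = (pcs w).claims) :
    NumInv s m' (update pcs w pc') L mid pop O omid hq hw loc' := by
  refine ⟨hf, hl, ho, h.value.update w hcell hout, h.numbered_update w hnum, fun e => ?_,
    fun e => ?_⟩
  · obtain ⟨⟨h1, h2, h3⟩, h4⟩ := h.stateless e
    exact ⟨⟨by rwa [hshared], h2, by rwa [hserial]⟩, h4⟩
  · exact ⟨(h.part e).1.quiet w hpart hmaster hcount hserial howned htaken hclaims,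
      (h.part e).2.quiet w hstore hcomp⟩

theorem NumInv.part_step (h : NumInv s m pcs L mid pop O omid hq hw loc) {pc' : Pc op} {pop' : ℕ}
    (hk : op.kind = .partitioned) (hf : FlagInv s m' (update pcs w pc'))
    (hp : PartInv m' (update pcs w pc') L mid pop' hq)
    (hnext : m'.next = m.next) (hbuf : m'.buffer = m.buffer) (hstore : m'.store = m.store)
    (hheld : pc'.held = (pcs w).held) (hcomp : pc'.computing = (pcs w).computing)
    (hphase : pc'.phase = (pcs w).phase) (hincr : ¬ pc'.IsIncr) (hincr' : ¬ (pcs w).IsIncr)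
    (hset : ∀ b o, pc' ≠ .addSet b o) (hsend : pc'.sendIdx = none)
    (hcell : ∀ b c, pc' ≠ .store b c) (hout : pc'.carried = none) (hnum : pc'.Numbered) :
    NumInv s m' (update pcs w pc') L mid pop' O omid hq hw loc := by
  refine ⟨hf, h.loc.quiet w hnext hbuf hheld hincr hincr' (fun b o e => absurd e (hset b o))
    (by simp [hsend]), h.out.quiet w hnext hphase,
    h.value.update w (fun b c e => absurd e (hcell b c)) (by simp [hout]),
    h.numbered_update w hnum, fun e => ?_, fun e => ⟨hp, (h.part e).2.quiet w hstore hcomp⟩⟩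
  rw [hk] at e
  cases e

/-- For a partitioned operator `pop` counts entries of the master queue, not of the partition
queues. A worker's local step keeps the sum of `pop` and the length of the worklist. -/
theorem NumInv.local {pc pc' : Pc op} (hk : op.kind ≠ .stateful) (hs : 0 < s)
    (h : NumInv s m pcs L mid pop O omid hq hw loc) (hw' : pcs w = pc)
    (hstep : LocalStep op s pc m pc' m') :
    ∃ pop' hq' hw' loc', NumInv s m' (update pcs w pc') L mid pop' O omid hq' hw' loc' ∧
      pop ≤ pop' ∧ pop' + m'.waiting = pop + m.waiting := by
  have hf := h.flag.local hw' hstep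
  have hout := fun b o => h.value.out w b o
  rw [hw'] at hout
  cases hstep
  · refine ⟨_, _, _, _, h.quiet hf rfl rfl rfl rfl rfl rfl rfl rfl ?_ ?_ ?_ ?_ ?_ ?_ ?_ ?_ ?_
      trivial (fun _ => ⟨?_, ?_, ?_⟩), le_rfl, rfl⟩ <;>
    simp [hw', Pc.held, Pc.computing, Pc.phase, Pc.owned, Pc.taken, Pc.claims, Pc.IsIncr,
      Pc.sendIdx, Pc.carried]
  case popInbox e _ => exact absurd e hk
  case storeStateful e => exact absurd e hk
  case emitDone => simpa [hw', Pc.Numbered] using h.numbered w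
  case popShared e hm =>
    refine ⟨_, _, _, _, h.popShared hw' hf e hm, Nat.le_succ _, ?_⟩
    simp only [OpMem.waiting, e, hm, List.length_cons]
    omega
  case popMaster p q e hm =>
    refine ⟨pop + 1, hq, hw, loc, h.part_step e hf ((h.part e).1.popMaster hw' hm) rfl rfl rfl
      ?_ ?_ ?_ ?_ ?_ ?_ ?_ ?_ ?_ e, Nat.le_succ _, ?_⟩
    · simp [hw', Pc.held]
    · simp [hw', Pc.computing]
    · simp [hw', Pc.phase]
    · simp [Pc.IsIncr]
    · simp [hw', Pc.IsIncr]
    · simp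
    · simp [Pc.sendIdx]
    · simp
    · simp [Pc.carried]
    · simp only [OpMem.waiting, e, hm, List.length_cons]
      omega
  case take hm => exact ⟨_, _, _, _, h.take hw' hf hm, le_rfl, rfl⟩
  -- This branch is unreachable, since an owner always finds a tuple.
  case takeNone p hm =>
    have e : op.kind = .partitioned := by simpa [hw', Pc.Numbered] using h.numbered w
    have := (h.part e).1.part_ne_nil hw'
    simp [hm] at this
  case storeOther b c _ => exact ⟨_, _, _, _, h.storeOther hw' hf, le_rfl, rfl⟩
  case addSet b o =>
    refine ⟨_, _, _, _, h.buffer_step (w := w) hf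
      (h.loc.addSet hw' (h.value.out w b o (by simp [hw', Pc.carried])))
      (h.out.quiet w rfl (by simp [hw', Pc.phase])) rfl rfl rfl rfl rfl rfl
      ?_ ?_ ?_ trivial ?_ ?_ ?_, le_rfl, rfl⟩ <;>
      simp [hw', Pc.computing, Pc.carried, Pc.owned, Pc.taken, Pc.claims]
  case exitFull b r n o hm =>
    obtain ⟨h1, h2⟩ := h.out.exitFull h.flag h.loc hs hw' hm
    refine ⟨_, _, _, _, h.buffer_step (w := w) hf
      (h.loc.quiet w rfl rfl ?_ ?_ ?_ ?_ ?_) h2 rfl rfl rfl rfl rfl rfl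
      ?_ ?_ ?_ trivial ?_ ?_ ?_, le_rfl, rfl⟩
    case refine_7 => simp
    case refine_8 =>
      cases r
      · simp [Pc.carried]
      · exact hout
    case refine_1 => cases r <;> simp [hw', Pc.held]
    all_goals simp [hw', Pc.computing, Pc.owned, Pc.taken, Pc.claims, Pc.IsIncr, Pc.sendIdx, h1]
  case exitEmpty b r n =>
    refine ⟨_, _, _, _, h.buffer_step (w := w) hf
      (h.loc.exitEmpty h.flag hw')
      (h.out.quiet w rfl (by simp [hw', Pc.phase])) rfl rfl rfl rfl rfl rfl
      ?_ ?_ ?_ trivial ?_ ?_ ?_, le_rfl, rfl⟩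
    case refine_3 =>
      cases r
      · simp [Pc.carried]
      · exact hout
    all_goals simp [hw', Pc.computing, Pc.owned, Pc.taken, Pc.claims]
  case exitIncr b r =>
    refine ⟨_, _, _, _, h.buffer_step (w := w) hf
      (h.loc.exitIncr h.flag hw')
      (h.out.exitIncr h.flag hw') rfl rfl rfl rfl rfl rfl
      ?_ ?_ ?_ trivial ?_ ?_ ?_, le_rfl, rfl⟩
    case refine_3 =>
      cases r
      · simp [Pc.carried]
      · exact hout
    all_goals simp [hw', Pc.computing, Pc.owned, Pc.taken, Pc.claims]
  case load b =>
    refine ⟨_, _, _, _, h.quiet hf rfl rfl rfl rfl rfl rfl rfl rfl ?_ ?_ ?_ ?_ ?_ ?_ ?_ ?_ ?_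
      trivial (fun _ => ⟨?_, ?_, ?_⟩), le_rfl, rfl⟩
    case refine_8 =>
      simp only [Pc.store.injEq, and_imp]
      rintro _ _ rfl rfl
      -- The value just read is the sequential one: without state there is nothing to compare, and
      -- otherwise the bucket is owned by the reading worker.
      rcases OpKind.stateless_or_partitioned hk with e | e
      · exact op.cell_eq_of_stateless e _ _
      · obtain ⟨h1, h2⟩ := h.part e
        exact h2.read_of_computing h.loc h1.own (w := w) (b := b) (by simp [hw', Pc.computing])
          (h.loc.job w b (by simp [hw', Pc.held])).2.symm
    all_goals simp [hw', Pc.held, Pc.computing, Pc.phase, Pc.owned, Pc.taken, Pc.claims, Pc.IsIncr,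
      Pc.sendIdx, Pc.carried]
  case claimFree p hc =>
    have e : op.kind = .partitioned := by simpa [hw', Pc.Numbered] using h.numbered w
    refine ⟨pop, hq, hw, loc, h.part_step e hf ((h.part e).1.claim hw' (Or.inl ⟨hc, rfl⟩))
      rfl rfl rfl ?_ ?_ ?_ ?_ ?_ ?_ ?_ ?_ ?_ e, le_rfl, rfl⟩ <;>
    simp [hw', Pc.held, Pc.computing, Pc.phase, Pc.IsIncr, Pc.sendIdx, Pc.carried]
  case claimBusy p hc =>
    have e : op.kind = .partitioned := by simpa [hw', Pc.Numbered] using h.numbered w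
    refine ⟨pop, hq, hw, loc, h.part_step e hf ((h.part e).1.claim hw' (Or.inr ⟨hc, rfl⟩))
      rfl rfl rfl ?_ ?_ ?_ ?_ ?_ ?_ ?_ ?_ ?_ trivial, le_rfl, rfl⟩ <;>
    simp [hw', Pc.held, Pc.computing, Pc.phase, Pc.IsIncr, Pc.sendIdx, Pc.carried]
  case releaseMore p hc =>
    have e : op.kind = .partitioned := by simpa [hw', Pc.Numbered] using h.numbered w
    refine ⟨pop, hq, hw, loc, h.part_step e hf ((h.part e).1.release hw' (Or.inl ⟨hc, rfl⟩))
      rfl rfl rfl ?_ ?_ ?_ ?_ ?_ ?_ ?_ ?_ ?_ e, le_rfl, rfl⟩ <;>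
    simp [hw', Pc.held, Pc.computing, Pc.phase, Pc.IsIncr, Pc.sendIdx, Pc.carried]
  case releaseLast p hc =>
    have e : op.kind = .partitioned := by simpa [hw', Pc.Numbered] using h.numbered w
    refine ⟨pop, hq, hw, loc, h.part_step e hf ((h.part e).1.release hw' (Or.inr ⟨hc, rfl⟩))
      rfl rfl rfl ?_ ?_ ?_ ?_ ?_ ?_ ?_ ?_ ?_ trivial, le_rfl, rfl⟩ <;>
    simp [hw', Pc.held, Pc.computing, Pc.phase, Pc.IsIncr, Pc.sendIdx, Pc.carried]
  case sentStateless b e =>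
    refine ⟨_, _, _, _, h.quiet hf rfl rfl rfl rfl rfl rfl rfl rfl ?_ ?_ ?_ ?_ ?_ ?_ ?_ ?_ ?_
      trivial (fun e' => absurd (e.symm.trans e') (by simp)), le_rfl, rfl⟩ <;>
    simp [hw', Pc.held, Pc.computing, Pc.phase, Pc.IsIncr, Pc.sendIdx, Pc.carried]
  case sentPartitioned b e =>
    refine ⟨_, _, _, _, h.quiet hf rfl rfl rfl rfl rfl rfl rfl rfl ?_ ?_ ?_ ?_ ?_ ?_ ?_ ?_ ?_
      e (fun _ => ⟨?_, ?_, ?_⟩), le_rfl, rfl⟩ <;>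
    simp [hw', Pc.held, Pc.computing, Pc.phase, Pc.owned, Pc.taken, Pc.claims, Pc.IsIncr,
      Pc.sendIdx, Pc.carried]
  case addOk b o ho =>
    refine ⟨_, _, _, _, h.quiet hf rfl rfl rfl rfl rfl rfl rfl rfl ?_ ?_ ?_ ?_ ?_ ?_ ?_ ?_ ?_
      trivial (fun _ => ⟨?_, ?_, ?_⟩), le_rfl, rfl⟩
    case refine_9 => exact hout
    case refine_6 =>
      simp only [Pc.addSet.injEq, and_imp]
      rintro _ _ rfl rfl
      exact ho.2
    all_goals simp [hw', Pc.held, Pc.computing, Pc.phase, Pc.owned, Pc.taken, Pc.claims,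
      Pc.IsIncr, Pc.sendIdx]
  case exitSent b r n =>
    have hl := h.loc.sending w n (by simp [hw', Pc.sendIdx])
    refine ⟨_, _, _, _, h.quiet hf rfl rfl rfl rfl rfl rfl rfl rfl ?_ ?_ ?_ ?_ ?_ ?_ ?_ ?_ ?_
      trivial (fun _ => ⟨?_, ?_, ?_⟩), le_rfl, rfl⟩
    case refine_9 =>
      cases r
      · simp [Pc.carried]
      · exact hout
    case refine_1 => cases r <;> simp [hw', Pc.held]
    all_goals simp [hw', Pc.computing, Pc.phase, Pc.owned, Pc.taken, Pc.claims,
      Pc.IsIncr, Pc.sendIdx, hl]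
  case addFail b o _ =>
    refine ⟨_, _, _, _, h.quiet hf rfl rfl rfl rfl rfl rfl rfl rfl ?_ ?_ ?_ ?_ ?_ ?_ ?_ ?_ ?_
      trivial (fun _ => ⟨?_, ?_, ?_⟩), le_rfl, rfl⟩
    case refine_9 => exact hout
    all_goals simp [hw', Pc.held, Pc.computing, Pc.phase, Pc.owned, Pc.taken, Pc.claims,
      Pc.IsIncr, Pc.sendIdx]
  case retry b o =>
    refine ⟨_, _, _, _, h.quiet hf rfl rfl rfl rfl rfl rfl rfl rfl ?_ ?_ ?_ ?_ ?_ ?_ ?_ ?_ ?_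
      trivial (fun _ => ⟨?_, ?_, ?_⟩), le_rfl, rfl⟩
    case refine_9 => exact hout
    all_goals simp [hw', Pc.held, Pc.computing, Pc.phase, Pc.owned, Pc.taken, Pc.claims,
      Pc.IsIncr, Pc.sendIdx]
  all_goals
    refine ⟨_, _, _, _, h.quiet hf rfl rfl rfl rfl rfl rfl rfl rfl ?_ ?_ ?_ ?_ ?_ ?_ ?_ ?_ ?_
      trivial (fun _ => ⟨?_, ?_, ?_⟩), le_rfl, rfl⟩
    case refine_9 =>
      cases ‹Option (List β)›
      · simp [Pc.carried]
      · exact hout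
    case refine_1 => cases ‹Option (List β)› <;> simp [hw', Pc.held]
    all_goals simp [hw', Pc.computing, Pc.phase, Pc.owned, Pc.taken, Pc.claims,
      Pc.IsIncr, Pc.sendIdx]

theorem NumInv.exitSend {b : Job α} {r : Option (List β)} {n : ℕ} {a a' : Feed β}
    (h : NumInv s m pcs L mid pop O omid hq hw loc) (hw' : pcs w = .exitSend b r n a)
    (ha : a.fresh ++ a'.rest = a.rest) :
    omid = a.mid ∧ NumInv s m (update pcs w (.exitSend b r n a')) L mid pop (O ++ a.fresh) a'.mid
      hq hw loc := by
  have hout := fun b o => h.value.out w b o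
  rw [hw'] at hout
  have hl := h.loc.sending w n (by simp [hw', Pc.sendIdx])
  refine ⟨(h.out.send w a (by simp [hw', Pc.phase])).2.2, h.flag.send hw' a', ?_,
    h.out.exitSend h.flag hw' ha, h.value.update w (by simp) ?_, h.numbered_update w trivial,
    h.stateless, fun e => ⟨(h.part e).1.quiet w rfl rfl rfl rfl ?_ ?_ ?_,
      (h.part e).2.quiet w rfl ?_⟩⟩
  · refine h.loc.quiet w rfl rfl ?_ ?_ ?_ ?_ ?_
    · cases r <;> simp [hw', Pc.held]
    all_goals simp [hw', Pc.IsIncr, Pc.sendIdx, hl]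
  · cases r
    · simp [Pc.carried]
    · exact hout
  all_goals simp [hw', Pc.owned, Pc.taken, Pc.claims, Pc.computing]

theorem NumInv.leave (h : NumInv s m pcs L mid pop O omid hq hw loc) (hw' : pcs w = .again) :
    NumInv s m (update pcs w .start) L mid pop O omid hq hw loc := by
  refine h.quiet (h.flag.leave hw') rfl rfl rfl rfl rfl rfl rfl rfl ?_ ?_ ?_ ?_ ?_ ?_ ?_ ?_ ?_
      trivial (fun _ => ⟨?_, ?_, ?_⟩) <;>
    simp [hw', Pc.held, Pc.computing, Pc.phase, Pc.owned, Pc.taken, Pc.claims, Pc.IsIncr,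
      Pc.sendIdx, Pc.carried]

theorem NumInv.init : NumInv s (OpMem.init op) (fun _ : ι => .start) [] .idle 0 [] .idle
    (fun _ => 0) (fun _ => 0) (fun t => if t = 0 then .done else .queued) :=
  ⟨.init s, .init, .init, ⟨by simp, by simp [Pc.carried]⟩, fun _ => trivial,
    fun _ => ⟨.init, fun _ => rfl⟩, fun _ => ⟨.init, .init⟩⟩

/-! ## Stateful operators -/

/-- The situation of a stateful operator, depending on the control state of its worker. -/
def StatefulAt (m : OpMem op) (L : List α) (pop : ℕ) (O : List β) (omid : Mid β) : Pc op → Prop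
  | .load b => At L pop b.tuple ∧ m.store = op.stateAfter L (pop - 1) ∧
      O = op.outputsOf L (pop - 1) ∧ omid = .idle
  | .store b c => At L pop b.tuple ∧ m.store = op.stateAfter L (pop - 1) ∧
      O = op.outputsOf L (pop - 1) ∧ omid = .idle ∧ c = op.read m.store b.tuple
  | .emit a => m.store = op.stateAfter L pop ∧ O ++ a.rest = op.outputsOf L pop ∧ omid = a.mid
  | .start => m.store = op.stateAfter L pop ∧ O = op.outputsOf L pop ∧ omid = .idle
  | .again => m.store = op.stateAfter L pop ∧ O = op.outputsOf L pop ∧ omid = .idle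
  | _ => False

/-- The invariant of a stateful operator. -/
structure StatefulInv (m : OpMem op) (pcs : ι → Pc op) (L : List α) (mid : Mid α) (pop : ℕ)
    (O : List β) (omid : Mid β) : Prop where
  inbox : m.inbox = L.drop pop
  pop_le : pop ≤ L.length
  mid_idle : mid = .idle
  active : ∀ w, pcs w ≠ .start → StatefulAt m L pop O omid (pcs w)
  inactive : (∀ w, pcs w = .start) → StatefulAt m L pop O omid .start

/-- Workers that are not allotted count as being at `start`, so the situation is determined by the
one worker that may be elsewhere. -/
theorem StatefulInv.at (h : StatefulInv m pcs L mid pop O omid) (hex : ∀ w', w' ≠ w → pcs w' = .start) :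
    StatefulAt m L pop O omid (pcs w) := by
  by_cases e : pcs w = .start
  · rw [e]
    refine h.inactive fun w' => ?_
    by_cases e' : w' = w
    · rwa [e']
    · exact hex w' e'
  · exact h.active w e

theorem StatefulInv.mk' {pc' : Pc op} (hex : ∀ w', w' ≠ w → pcs w' = .start) (hi : m.inbox = L.drop pop)
    (hp : pop ≤ L.length) (hm : mid = .idle) (h : StatefulAt m L pop O omid pc') :
    StatefulInv m (update pcs w pc') L mid pop O omid := by
  refine ⟨hi, hp, hm, fun w' hw' => ?_, fun hw' => ?_⟩
  · have : w' = w := by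
      by_contra e
      rw [Function.update_of_ne e] at hw'
      exact hw' (hex w' e)
    subst this
    simpa using h
  · have := hw' w
    rw [Function.update_self] at this
    rwa [this] at h

theorem StatefulAt.append {pc : Pc op} (h : StatefulAt m L pop O omid pc) (hp : pop ≤ L.length)
    (hm : m'.store = m.store) (l : List α) : StatefulAt m' (L ++ l) pop O omid pc := by
  have h1 := op.stateAfter_append (l' := l) hp
  have h2 := op.outputsOf_append (l' := l) hp
  have h3 := op.stateAfter_append (l' := l) ((Nat.sub_le pop 1).trans hp)
  have h4 := op.outputsOf_append (l' := l) ((Nat.sub_le pop 1).trans hp)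
  cases pc <;> simp only [StatefulAt, h1, h2, h3, h4, hm] at h ⊢ <;> try exact h
  · exact ⟨h.1.append l, h.2⟩
  · exact ⟨h.1.append l, h.2⟩

theorem StatefulInv.feed {a a' : Feed α} (hk : op.kind = .stateful)
    (h : StatefulInv m pcs L a.mid pop O omid) (hs : FeedStep op a m a' m') :
    StatefulInv m' pcs (L ++ a.fresh) a'.mid pop O omid := by
  obtain ⟨h1, h2, h3, h4, h5⟩ := h
  cases hs with
  | inbox =>
    exact ⟨by simp [h1, Feed.fresh, List.drop_append_of_le_length h2],
      by simp; omega, rfl, fun w hw => (h4 w hw).append h2 rfl _,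
      fun hw => (h5 hw).append h2 rfl _⟩
  | number h => exact absurd hk h
  | shared h => simp [hk] at h
  | part h => simp [hk] at h
  | master h => simp [hk] at h

theorem StatefulInv.local {pc pc' : Pc op} (hk : op.kind = .stateful)
    (h : StatefulInv m pcs L mid pop O omid) (hex : ∀ w', w' ≠ w → pcs w' = .start)
    (hw' : pcs w = pc) (hstep : LocalStep op s pc m pc' m') :
    ∃ pop', StatefulInv m' (update pcs w pc') L mid pop' O omid ∧
      pop ≤ pop' ∧ pop' + m'.waiting = pop + m.waiting := by
  have hat := h.at hex
  rw [hw'] at hat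
  have h1 := h.inbox
  have h2 := h.pop_le
  cases hstep <;> simp only [StatefulAt] at hat
  case popShared h _ => simp [hk] at h
  case popMaster h _ => simp [hk] at h
  case storeOther h => exact absurd hk h
  case emitDone =>
    exact ⟨pop, .mk' hex h1 h2 h.mid_idle (by simpa [StatefulAt, Feed.rest, Feed.mid] using hat), le_rfl, rfl⟩
  case popInbox x q _ hm =>
    have hd : L.drop pop = [] ++ x :: q := by rw [← h1, hm]; rfl
    have hx := at_append_of_drop hd
    have hd' := drop_of_drop_eq hd
    refine ⟨pop + 1, .mk' hex hd'.symm hx.le h.mid_idle ⟨hx, by simpa using hat⟩,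
      Nat.le_succ _, ?_⟩
    simp only [OpMem.waiting, hk, hm, List.length_cons]
    omega
  case load b => exact ⟨pop, .mk' hex h1 h2 h.mid_idle ⟨hat.1, hat.2.1, hat.2.2.1, hat.2.2.2, rfl⟩, le_rfl, rfl⟩
  case storeStateful b c _ =>
    obtain ⟨h3, h4, h5, h6, h7⟩ := hat
    refine ⟨pop, .mk' hex h1 h2 h.mid_idle ⟨?_, ?_, h6⟩, le_rfl, rfl⟩
    · rw [op.stateAfter_of_at h3, ← h4, ← h7]
    · have : op.OutIs L pop (op.run c b.tuple).2 := ⟨b.tuple, h3, by rw [← h4, ← h7]⟩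
      rw [this.outputsOf_eq, ← h5]
      rfl
  · exact ⟨pop, .mk' hex h1 h2 h.mid_idle hat, le_rfl, rfl⟩

theorem StatefulInv.emit {a a' : Feed β}
    (h : StatefulInv m pcs L mid pop O omid) (hex : ∀ w', w' ≠ w → pcs w' = .start)
    (hw' : pcs w = .emit a) (ha : a.fresh ++ a'.rest = a.rest) :
    omid = a.mid ∧
      StatefulInv m (update pcs w (.emit a')) L mid pop (O ++ a.fresh) a'.mid := by
  have hat := h.at hex
  rw [hw'] at hat
  obtain ⟨h3, h4, h5⟩ := hat
  exact ⟨h5, .mk' hex h.inbox h.pop_le h.mid_idle ⟨h3, by rw [List.append_assoc, ha, h4], rfl⟩⟩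

theorem StatefulInv.leave (h : StatefulInv m pcs L mid pop O omid)
    (hex : ∀ w', w' ≠ w → pcs w' = .start) (hw' : pcs w = .again) :
    StatefulInv m (update pcs w .start) L mid pop O omid := by
  have hat := h.at hex
  rw [hw'] at hat
  exact .mk' hex h.inbox h.pop_le h.mid_idle hat

theorem StatefulInv.init :
    StatefulInv (OpMem.init op) (fun _ : ι => .start) [] .idle 0 [] .idle :=
  ⟨rfl, le_rfl, rfl, fun _ h => absurd rfl h, fun _ => ⟨rfl, rfl, rfl⟩⟩

end

/-! ## The invariant of an operator -/

section

variable {α β : Type u} {op : Operator.{u, v} α β} {ι : Type} [DecidableEq ι] [Fintype ι]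
  {s : ℕ} {m m' : OpMem op} {pcs : ι → Pc op} {L : List α} {mid : Mid α} {pop : ℕ}
  {w : ι} {O : List β} {omid : Mid β}

/-- The invariant of an operator: `L` is the sequence of tuples added to it, `pop` the number of
items dequeued from its worklist, and `O` the sequence of tuples added downstream. -/
structure OpInv (s : ℕ) (m : OpMem op) (pcs : ι → Pc op) (L : List α) (mid : Mid α) (pop : ℕ)
    (O : List β) (omid : Mid β) : Prop where
  stateful : op.kind = .stateful → StatefulInv m pcs L mid pop O omid
  numbered : op.kind ≠ .stateful → ∃ hq hw loc, NumInv s m pcs L mid pop O omid hq hw loc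

/-- A worker sends outputs downstream one by one. -/
inductive SendStep : Pc op → Feed β → Feed β → Pc op → Prop where
  | emit {a a'} : SendStep (.emit a) a a' (.emit a')
  | exitSend {b r n a a'} : SendStep (.exitSend b r n a) a a' (.exitSend b r n a')

theorem OpInv.feed {a a' : Feed α} (h : OpInv s m pcs L a.mid pop O omid)
    (hs : FeedStep op a m a' m') : OpInv s m' pcs (L ++ a.fresh) a'.mid pop O omid := by
  refine ⟨fun e => (h.stateful e).feed e hs, fun e => ?_⟩
  obtain ⟨hq, hw, loc, h⟩ := h.numbered e
  exact ⟨hq, hw, loc, h.feed e hs⟩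

theorem OpInv.local {pc pc' : Pc op} (hs : 0 < s) (h : OpInv s m pcs L mid pop O omid)
    (hex : op.kind = .stateful → ∀ w', w' ≠ w → pcs w' = .start) (hw : pcs w = pc)
    (hstep : LocalStep op s pc m pc' m') :
    ∃ pop', OpInv s m' (update pcs w pc') L mid pop' O omid ∧
      pop ≤ pop' ∧ pop' + m'.waiting = pop + m.waiting := by
  by_cases e : op.kind = .stateful
  · obtain ⟨pop', h1, h2⟩ := (h.stateful e).local e (hex e) hw hstep
    exact ⟨pop', ⟨fun _ => h1, fun e' => absurd e e'⟩, h2⟩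
  · obtain ⟨hq, hw', loc, h1⟩ := h.numbered e
    obtain ⟨pop', hq', hw'', loc', h1, h2⟩ := h1.local e hs hw hstep
    exact ⟨pop', ⟨fun e' => absurd e' e, fun _ => ⟨hq', hw'', loc', h1⟩⟩, h2⟩

theorem OpInv.send {pc pc' : Pc op} {a a' : Feed β} (h : OpInv s m pcs L mid pop O omid)
    (hex : op.kind = .stateful → ∀ w', w' ≠ w → pcs w' = .start) (hw : pcs w = pc)
    (hstep : SendStep pc a a' pc') (ha : a.fresh ++ a'.rest = a.rest) :
    omid = a.mid ∧ OpInv s m (update pcs w pc') L mid pop (O ++ a.fresh) a'.mid := by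
  by_cases e : op.kind = .stateful
  · cases hstep with
    | emit =>
      obtain ⟨h1, h2⟩ := (h.stateful e).emit (hex e) hw ha
      exact ⟨h1, fun _ => h2, fun e' => absurd e e'⟩
    | exitSend =>
      have := (h.stateful e).at (hex e)
      simp [hw, StatefulAt] at this
  · obtain ⟨hq, hw', loc, h1⟩ := h.numbered e
    cases hstep with
    | emit => simpa [hw, Pc.Numbered] using h1.numbered w
    | exitSend =>
      obtain ⟨h1, h2⟩ := h1.exitSend hw ha
      exact ⟨h1, fun e' => absurd e' e, fun _ => ⟨hq, hw', loc, h2⟩⟩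

theorem OpInv.leave (h : OpInv s m pcs L mid pop O omid)
    (hex : op.kind = .stateful → ∀ w', w' ≠ w → pcs w' = .start) (hw : pcs w = .again) :
    OpInv s m (update pcs w .start) L mid pop O omid := by
  refine ⟨fun e => (h.stateful e).leave (hex e) hw, fun e => ?_⟩
  obtain ⟨hq, hw', loc, h1⟩ := h.numbered e
  exact ⟨hq, hw', loc, h1.leave hw⟩

theorem OpInv.init : OpInv s (OpMem.init op) (fun _ : ι => .start) [] .idle 0 [] .idle :=
  ⟨fun _ => .init, fun _ => ⟨_, _, _, .init⟩⟩

theorem FeedStep.waiting_le {a a' : Feed α} (hs : FeedStep op a m a' m') :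
    m.waiting ≤ m'.waiting := by
  unfold OpMem.waiting
  cases hs <;> cases op.kind <;> simp

theorem OpInv.pop_le (h : OpInv s m pcs L mid pop O omid) : pop ≤ L.length := by
  by_cases e : op.kind = .stateful
  · exact (h.stateful e).pop_le
  · obtain ⟨hq, hw, loc, h⟩ := h.numbered e
    exact h.pop_le e

/-- All tuples are in the worklist or dequeued when no addition is in progress. -/
theorem OpInv.pop_add_waiting (h : OpInv s m pcs L mid pop O omid) (hm : mid = .idle) :
    pop + m.waiting = L.length := by
  have hp := h.pop_le
  unfold OpMem.waiting
  subst hm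
  cases e : op.kind with
  | stateful =>
    simp only [(h.stateful e).inbox, List.length_drop]
    omega
  | stateless =>
    obtain ⟨hq, hw, loc, h⟩ := h.numbered (by simp [e])
    have := congrArg List.length (h.stateless e).1.queue
    simp only [Mid.tuple, List.append_nil, length_numberFrom, List.length_drop] at this
    simp only [this]
    omega
  | partitioned =>
    obtain ⟨hq, hw, loc, h⟩ := h.numbered (by simp [e])
    have := congrArg List.length (h.part e).1.master
    simp only [Mid.token, List.append_nil, List.length_map, List.length_drop] at this
    simp only [this]
    omega

/-- The tuples sent are a prefix of the outputs of the operator. -/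
theorem OpInv.prefix (h : OpInv s m pcs L mid pop O omid) :
    O <+: (op.seqMany op.initStore L).2 := by
  have hpre : ∀ i ≤ L.length, op.outputsOf L i <+: (op.seqMany op.initStore L).2 := by
    intro i hi
    conv_rhs => rw [← List.take_append_drop i L, op.seqMany_append]
    exact List.prefix_append _ _
  by_cases e : op.kind = .stateful
  · have h := h.stateful e
    have hp := h.pop_le
    by_cases hst : ∀ w, pcs w = .start
    · rw [(h.inactive hst).2.1]
      exact hpre _ h.pop_le
    · push Not at hst
      obtain ⟨w, hw⟩ := hst
      have := h.active w hw
      cases hpc : pcs w <;> rw [hpc] at this <;> simp only [StatefulAt] at this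
      · rw [this.2.1]
        exact hpre _ hp
      · rw [this.2.1]
        exact hpre _ hp
      · rw [this.2.2.1]
        exact hpre _ (by omega)
      · rw [this.2.2.1]
        exact hpre _ (by omega)
      · refine List.IsPrefix.trans ?_ (hpre _ hp)
        rw [← this.2.1]
        exact List.prefix_append _ _
  · obtain ⟨hq, hw, loc, h⟩ := h.numbered e
    by_cases hst : ∀ w, (pcs w).phase = none
    · rw [(h.out.idle hst).1]
      exact hpre _ h.out.le
    · push Not at hst
      obtain ⟨w, hw⟩ := hst
      obtain ⟨a, ha⟩ := Option.ne_none_iff_exists'.1 hw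
      obtain ⟨h1, h2, -⟩ := h.out.send w a ha
      refine List.IsPrefix.trans ?_ (hpre _ h1)
      rw [← h2]
      exact List.prefix_append _ _

end

/-! ## The global invariant -/

section

variable {P : Pipeline.{u, v}} {N : ℕ}

open Classical in
/-- The control state with respect to operator `j` of a worker in the state `o`; a worker that is
not allotted to `j` counts as being at the start. -/
noncomputable def pcAt (o : Option ((j : Fin P.len) × Pc (P.op j))) (j : Fin P.len) :
    Pc (P.op j) :=
  if h : ∃ pc, o = some ⟨j, pc⟩ then h.choose else .start

/-- The control states of all workers with respect to operator `j`. -/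
noncomputable def pcOf (wk : Fin N → Option ((j : Fin P.len) × Pc (P.op j))) (j : Fin P.len)
    (w : Fin N) : Pc (P.op j) :=
  pcAt (wk w) j

variable {wk : Fin N → Option ((j : Fin P.len) × Pc (P.op j))} {w : Fin N} {j j' : Fin P.len}

theorem pcOf_eq {pc : Pc (P.op j)} (h : wk w = some ⟨j, pc⟩) : pcOf wk j w = pc := by
  have hex : ∃ pc, wk w = some ⟨j, pc⟩ := ⟨pc, h⟩
  rw [pcOf, pcAt, dif_pos hex]
  simpa using hex.choose_spec.symm.trans h

theorem pcOf_eq_start (h : ∀ pc, wk w ≠ some ⟨j, pc⟩) : pcOf wk j w = .start := by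
  rw [pcOf, pcAt, dif_neg]
  rintro ⟨pc, hpc⟩
  exact h pc hpc

theorem pcOf_congr {wk' : Fin N → Option ((j : Fin P.len) × Pc (P.op j))} {w' : Fin N}
    (h : wk w = wk' w') : pcOf wk j w = pcOf wk' j w' :=
  congrArg (fun o => pcAt o j) h

theorem pcOf_update (pc' : Pc (P.op j)) :
    pcOf (update wk w (some ⟨j, pc'⟩)) j = update (pcOf wk j) w pc' := by
  funext w'
  by_cases e : w' = w
  · subst e
    rw [Function.update_self]
    exact pcOf_eq (by simp)
  · rw [Function.update_of_ne e]
    exact pcOf_congr (by simp [e])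

theorem pcOf_update_none : pcOf (update wk w none) j = update (pcOf wk j) w .start := by
  funext w'
  by_cases e : w' = w
  · subst e
    rw [Function.update_self]
    exact pcOf_eq_start (by simp)
  · rw [Function.update_of_ne e]
    exact pcOf_congr (by simp [e])

theorem pcOf_update_of_ne {pc : Pc (P.op j)} {o : Option ((j : Fin P.len) × Pc (P.op j))}
    (hne : j' ≠ j) (hw : wk w = none ∨ wk w = some ⟨j, pc⟩)
    (ho : o = none ∨ ∃ pc, o = some ⟨j, pc⟩) : pcOf (update wk w o) j' = pcOf wk j' := by
  funext w'
  by_cases e : w' = w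
  · subst e
    rw [pcOf_eq_start, pcOf_eq_start]
    · rintro pc h
      rcases hw with hw | hw <;> rw [hw] at h
      · cases h
      · simp only [Option.some.injEq, Sigma.mk.injEq] at h
        exact hne h.1.symm
    · rintro pc h
      rw [Function.update_self] at h
      rcases ho with rfl | ⟨pc', rfl⟩
      · cases h
      · simp only [Option.some.injEq, Sigma.mk.injEq] at h
        exact hne h.1.symm
  · exact pcOf_congr (by simp [e])

variable (P) in
/-- The history that is relevant for the invariant: the tuples added to every stage, the state
of the producer of every stage, and the numbers of items dequeued from the worklists. -/
structure Ghost where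
  log : (k : ℕ) → List (P.Ty k)
  mid : (k : ℕ) → Mid (P.Ty k)
  pop : ℕ → ℕ

/-- The history after one step of the producer at stage `k`. -/
def Ghost.deliver (g : Ghost P) (k : ℕ) (a a' : Feed (P.Ty k)) : Ghost P where
  log := update g.log k (g.log k ++ a.fresh)
  mid := update g.mid k a'.mid
  pop := g.pop

/-- The invariant of the system. -/
structure GlobalInv (input : Stream'.Seq (P.Ty 0)) (S : State P N) (g : Ghost P) : Prop where
  source : g.log 0 ++ S.source.rest = input.take S.arrived
  source_mid : g.mid 0 = S.source.mid
  op : ∀ j : Fin P.len, OpInv (P.bufSize j) (S.mem j) (pcOf S.worker j) (g.log j) (g.mid j)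
    (g.pop j) (g.log (j + 1)) (g.mid (j + 1))
  out : g.log P.len = S.out
  out_mid : g.mid P.len = .idle
  excl : ∀ j w w', (P.op j).kind = .stateful → S.AllottedTo w j → S.AllottedTo w' j → w = w'

/-- The histories of two successive states. -/
structure Ghost.Le (S : State P N) (g : Ghost P) (S' : State P N) (g' : Ghost P) : Prop where
  log : ∀ k, g.log k <+: g'.log k
  pop : ∀ j : Fin P.len, g.pop j ≤ g'.pop j
  waiting : ∀ j : Fin P.len,
    g.pop j + (S.mem j).waiting ≤ g'.pop j + (S'.mem j).waiting

theorem GlobalInv.init (input : Stream'.Seq (P.Ty 0)) :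
    GlobalInv input (State.init P N) ⟨fun _ => [], fun _ => .idle, fun _ => 0⟩ := by
  refine ⟨by simp [State.init, Feed.rest], rfl, fun j => ?_, rfl, rfl, ?_⟩
  · have : pcOf (State.init P N).worker j = fun _ => .start := by
      funext w
      exact pcOf_eq_start (by simp [State.init])
    rw [this]
    exact .init
  · rintro j w w' - ⟨pc, h⟩
    simp [State.init] at h

/-- Collects what a producer at stage `k` does, for the ingress thread and for workers alike. The
hypothesis `hmid`, that the recorded producer state is that of this very producer, expresses that no
other addition at the stage is in progress. -/
theorem Deliver.effect {k : ℕ} {a a' : Feed (P.Ty k)} {S S' : State P N}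
    (hd : Deliver k a S a' S') {g : Ghost P} (hmid : g.mid k = a.mid)
    (hout : g.log P.len = S.out) (hom : g.mid P.len = .idle) :
    S'.worker = S.worker ∧ S'.source = S.source ∧ S'.arrived = S.arrived ∧
    a.fresh ++ a'.rest = a.rest ∧ a'.rank < a.rank ∧
    (g.deliver k a a').log P.len = S'.out ∧ (g.deliver k a a').mid P.len = .idle ∧
    (∀ j : Fin P.len, j.val ≠ k → S'.mem j = S.mem j) ∧
    (∀ j : Fin P.len, (S.mem j).waiting ≤ (S'.mem j).waiting) ∧
    (∀ (j : Fin P.len) (pcs : Fin N → Pc (P.op j)) (s pop : ℕ) (O : List (P.Ty (j + 1)))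
      (omid : Mid (P.Ty (j + 1))), j.val = k →
      OpInv s (S.mem j) pcs (g.log j) (g.mid j) pop O omid →
      OpInv s (S'.mem j) pcs ((g.deliver k a a').log j) ((g.deliver k a a').mid j) pop O
        omid) := by
  rcases hd with ⟨h, hs⟩ | ⟨h⟩
  · have hne : P.len ≠ k := by omega
    refine ⟨rfl, rfl, rfl, hs.fresh_rest, hs.rank_lt, ?_, ?_, fun j hj => ?_, fun j => ?_, ?_⟩
    · simpa [Ghost.deliver, hne] using hout
    · simpa [Ghost.deliver, hne] using hom
    · exact Function.update_of_ne (fun e => hj (by rw [e])) _ _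
    · by_cases e : j = ⟨k, h⟩
      · subst e
        simpa using hs.waiting_le
      · simp [Function.update_of_ne e]
    · rintro j pcs s pop O omid rfl hi
      simp only [Ghost.deliver, Function.update_self]
      rw [hmid] at hi
      exact hi.feed hs
  · subst h
    refine ⟨rfl, rfl, rfl, rfl, ?_, ?_, ?_, fun _ _ => rfl, fun _ => le_rfl, ?_⟩
    · simp [Feed.rank]
    · simp [Ghost.deliver, hout, Feed.fresh]
    · simp [Ghost.deliver, Feed.mid]
    · intro j pcs s pop O omid hj
      have := j.2
      omega

theorem Ghost.log_le_deliver (g : Ghost P) (k : ℕ) (a a' : Feed (P.Ty k)) (i : ℕ) :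
    g.log i <+: (g.deliver k a a').log i := by
  by_cases e : i = k
  · subst e
    simp [deliver]
  · simp [deliver, e]

theorem GlobalInv.hex {input : Stream'.Seq (P.Ty 0)} {S : State P N} {g : Ghost P}
    (h : GlobalInv input S g) {pc : Pc (P.op j)} (hw : S.worker w = some ⟨j, pc⟩)
    (hk : (P.op j).kind = .stateful) (w' : Fin N) (hne : w' ≠ w) : pcOf S.worker j w' = .start :=
  pcOf_eq_start fun pc' hw' => hne (h.excl j w' w hk ⟨pc', hw'⟩ ⟨pc, hw⟩)

theorem GlobalInv.send {input : Stream'.Seq (P.Ty 0)} {S S' : State P N} {g : Ghost P}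
    (h : GlobalInv input S g) {pc pc' : Pc (P.op j)} {a a' : Feed (P.Ty (j.val + 1))}
    (hw : S.worker w = some ⟨j, pc⟩) (hs : SendStep pc a a' pc')
    (hd : Deliver (j.val + 1) a S a' S') :
    GlobalInv input { S' with worker := update S'.worker w (some ⟨j, pc'⟩) }
      (g.deliver (j.val + 1) a a') ∧
    g.Le S { S' with worker := update S'.worker w (some ⟨j, pc'⟩) } (g.deliver (j.val + 1) a a')
      := by
  have ha : a.fresh ++ a'.rest = a.rest := by
    cases hd with
    | worklist _ hs => exact hs.fresh_rest
    | egress => rfl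
  obtain ⟨hmid, hj⟩ := (h.op j).send (h.hex hw) (pcOf_eq hw) hs ha
  obtain ⟨h1, h2, h3, -, -, h5, h6, h7, h8, h9⟩ := hd.effect hmid h.out h.out_mid
  refine ⟨⟨?_, ?_, fun j' => ?_, h5, h6, ?_⟩, ⟨g.log_le_deliver _ _ _, fun _ => le_rfl, ?_⟩⟩
  · simpa [Ghost.deliver, h2, h3] using h.source
  · simpa [Ghost.deliver, h2] using h.source_mid
  · rw [h1]
    by_cases e : j' = j
    · subst e
      rw [pcOf_update]
      have e : j'.val ≠ j'.val + 1 := by omega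
      simp only [h7 j' e]
      simpa [Ghost.deliver, e] using hj
    · rw [pcOf_update_of_ne e (Or.inr hw) (Or.inr ⟨pc', rfl⟩)]
      have e' : j'.val + 1 ≠ j.val + 1 := fun h => e (Fin.ext (by omega))
      have e2 : (g.deliver (j.val + 1) a a').log (j' + 1) = g.log (j' + 1) := by
        exact Function.update_of_ne e' _ _
      have e3 : (g.deliver (j.val + 1) a a').mid (j' + 1) = g.mid (j' + 1) := by
        exact Function.update_of_ne e' _ _
      rw [e2, e3]
      -- A send concerns two operators: `j` as the producer, treated above, and the operator at
      -- stage `j + 1`, if there is one, as the consumer.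
      by_cases e'' : j'.val = j.val + 1
      · exact h9 j' _ _ _ _ _ e'' (h.op j')
      · simpa [Ghost.deliver, e'', h7 j' e''] using h.op j'
  · intro i w₁ w₂ hk ⟨pc₁, hw₁⟩ ⟨pc₂, hw₂⟩
    have key : ∀ w₃ pc₃, update S'.worker w (some ⟨j, pc'⟩) w₃ = some ⟨i, pc₃⟩ →
        S.AllottedTo w₃ i := by
      intro w₃ pc₃ h₃
      by_cases e : w₃ = w
      · subst e
        simp only [Function.update_self, Option.some.injEq, Sigma.mk.injEq] at h₃
        obtain ⟨rfl, -⟩ := h₃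
        exact ⟨pc, hw⟩
      · rw [Function.update_of_ne e, h1] at h₃
        exact ⟨pc₃, h₃⟩
    exact h.excl i w₁ w₂ hk (key _ _ hw₁) (key _ _ hw₂)
  · exact fun i => Nat.add_le_add_left (h8 i) _

theorem Seq_take_succ {α : Type*} (s : Stream'.Seq α) (n : ℕ) :
    s.take (n + 1) = s.take n ++ (s.get? n).toList := by
  induction n generalizing s with
  | zero => cases s <;> simp
  | succ n ih =>
    cases s with
    | nil => simp
    | cons x s => rw [Stream'.Seq.take_succ_cons, ih, Stream'.Seq.take_succ_cons]; simp

theorem GlobalInv.step {input : Stream'.Seq (P.Ty 0)} {S S' : State P N} {g : Ghost P}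
    {ag : Agent N} (h : GlobalInv input S g) (hs : Step input ag S S') :
    ∃ g', GlobalInv input S' g' ∧ g.Le S S' g' := by
  cases hs with
  | @arrive _ x h1 h2 =>
    refine ⟨g, ⟨?_, ?_, h.op, h.out, h.out_mid, h.excl⟩, ⟨fun _ => List.prefix_rfl,
      fun _ => le_rfl, fun _ => le_rfl⟩⟩
    · have := h.source
      rw [h1] at this
      simp only [Feed.rest, List.append_nil] at this
      rw [Seq_take_succ, h2, ← this]
      rfl
    · rw [h.source_mid, h1]
      rfl
  | @ingress _ S'' a' hd =>
    obtain ⟨h1, h2, h3, h4, -, h5, h6, h7, h8, h9⟩ := hd.effect h.source_mid h.out h.out_mid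
    refine ⟨g.deliver 0 S.source a', ⟨?_, ?_, fun j => ?_, h5, h6, ?_⟩,
      ⟨g.log_le_deliver _ _ _, fun _ => le_rfl, fun i => Nat.add_le_add_left (h8 i) _⟩⟩
    · simp only [Ghost.deliver, Function.update_self, List.append_assoc, h4, h3]
      exact h.source
    · simp [Ghost.deliver]
    · simp only [h1]
      have e2 : (g.deliver 0 S.source a').log (j + 1) = g.log (j + 1) := by
        simp [Ghost.deliver]
      have e3 : (g.deliver 0 S.source a').mid (j + 1) = g.mid (j + 1) := by
        simp [Ghost.deliver]
      rw [e2, e3]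
      by_cases e : j.val = 0
      · exact h9 j _ _ _ _ _ e (h.op j)
      · simpa [Ghost.deliver, e, h7 j e] using h.op j
    · simpa only [State.AllottedTo, h1] using h.excl
  -- Allotting a worker is invisible to the operator invariants, because an idle worker already
  -- counts as being at `start`.
  | @allot _ w j hw hk =>
    refine ⟨g, ⟨h.source, h.source_mid, fun j' => ?_, h.out, h.out_mid, ?_⟩,
      ⟨fun _ => List.prefix_rfl, fun _ => le_rfl, fun _ => le_rfl⟩⟩
    · by_cases e : j' = j
      · subst e
        have : pcOf S.worker j' w = .start := pcOf_eq_start (by simp [hw])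
        rw [pcOf_update, ← this, Function.update_eq_self]
        exact h.op j'
      · rw [pcOf_update_of_ne e (pc := .start) (Or.inl hw) (Or.inr ⟨_, rfl⟩)]
        exact h.op j'
    · intro i w₁ w₂ hi ⟨pc₁, hw₁⟩ ⟨pc₂, hw₂⟩
      have hex := h.excl i w₁ w₂ hi
      by_cases e₁ : w₁ = w <;> by_cases e₂ : w₂ = w
      · rw [e₁, e₂]
      · subst e₁
        simp only [Function.update_self, Option.some.injEq, Sigma.mk.injEq] at hw₁
        obtain ⟨rfl, -⟩ := hw₁
        exact absurd ⟨pc₂, by simpa [e₂] using hw₂⟩ (hk hi w₂)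
      · subst e₂
        simp only [Function.update_self, Option.some.injEq, Sigma.mk.injEq] at hw₂
        obtain ⟨rfl, -⟩ := hw₂
        exact absurd ⟨pc₁, by simpa [e₁] using hw₁⟩ (hk hi w₁)
      · exact hex ⟨pc₁, by simpa [e₁] using hw₁⟩ ⟨pc₂, by simpa [e₂] using hw₂⟩
  | @leaveEmpty _ w j hw _ =>
    refine ⟨g, ⟨h.source, h.source_mid, fun j' => ?_, h.out, h.out_mid, ?_⟩,
      ⟨fun _ => List.prefix_rfl, fun _ => le_rfl, fun _ => le_rfl⟩⟩
    · by_cases e : j' = j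
      · subst e
        have : pcOf S.worker j' w = .start := pcOf_eq hw
        rw [pcOf_update_none, ← this, Function.update_eq_self]
        exact h.op j'
      · rw [pcOf_update_of_ne e (Or.inr hw) (Or.inl rfl)]
        exact h.op j'
    · intro i w₁ w₂ hi ⟨pc₁, hw₁⟩ ⟨pc₂, hw₂⟩
      exact h.excl i w₁ w₂ hi ⟨pc₁, by grind [Function.update_apply]⟩
        ⟨pc₂, by grind [Function.update_apply]⟩
  | @leave _ w j hw =>
    refine ⟨g, ⟨h.source, h.source_mid, fun j' => ?_, h.out, h.out_mid, ?_⟩,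
      ⟨fun _ => List.prefix_rfl, fun _ => le_rfl, fun _ => le_rfl⟩⟩
    · by_cases e : j' = j
      · subst e
        rw [pcOf_update_none]
        exact (h.op j').leave (h.hex hw) (pcOf_eq hw)
      · rw [pcOf_update_of_ne e (Or.inr hw) (Or.inl rfl)]
        exact h.op j'
    · intro i w₁ w₂ hi ⟨pc₁, hw₁⟩ ⟨pc₂, hw₂⟩
      exact h.excl i w₁ w₂ hi ⟨pc₁, by grind [Function.update_apply]⟩
        ⟨pc₂, by grind [Function.update_apply]⟩
  | emit hw hd => exact ⟨_, h.send hw .emit hd⟩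
  | exitSend hw hd => exact ⟨_, h.send hw .exitSend hd⟩
  | _ =>
    rename_i w j pc pc' m' hw hl
    obtain ⟨pop', h1, h2, h3⟩ :=
      (h.op j).local (P.bufSize_pos j) (h.hex hw) (pcOf_eq hw) hl
    have hne : ∀ j' : Fin P.len, j' ≠ j → j'.val ≠ j.val := fun j' e e' => e (Fin.ext e')
    refine ⟨{ g with pop := update g.pop j.val pop' }, ⟨h.source, h.source_mid, fun j' => ?_,
      h.out, h.out_mid, ?_⟩, ⟨fun _ => List.prefix_rfl, fun j' => ?_, fun j' => ?_⟩⟩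
    · by_cases e : j' = j
      · subst e
        simp only [pcOf_update, Function.update_self]
        exact h1
      · simp only [pcOf_update_of_ne e (Or.inr hw) (Or.inr ⟨pc', rfl⟩), Function.update_of_ne e,
          Function.update_of_ne (hne j' e)]
        exact h.op j'
    · intro i w₁ w₂ hk ⟨pc₁, hw₁⟩ ⟨pc₂, hw₂⟩
      have key : ∀ w₃ pc₃, update S.worker w (some ⟨j, pc'⟩) w₃ = some ⟨i, pc₃⟩ →
          S.AllottedTo w₃ i := by
        intro w₃ pc₃ h₃
        by_cases e : w₃ = w
        · subst e
          simp only [Function.update_self, Option.some.injEq, Sigma.mk.injEq] at h₃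
          obtain ⟨rfl, -⟩ := h₃
          exact ⟨pc, hw⟩
        · rw [Function.update_of_ne e] at h₃
          exact ⟨pc₃, h₃⟩
      exact h.excl i w₁ w₂ hk (key _ _ hw₁) (key _ _ hw₂)
    · by_cases e : j' = j
      · subst e
        simpa using h2
      · simp [Function.update_of_ne (hne j' e)]
    · by_cases e : j' = j
      · subst e
        simpa using h3.ge
      · simp [Function.update_of_ne (hne j' e), Function.update_of_ne e]

end

/-! ## The stages of the sequential execution -/

theorem Operator.seqMany_prefix {α β : Type u} (op : Operator.{u, v} α β) (s : op.Store)
    {l l' : List α} (h : l <+: l') : (op.seqMany s l).2 <+: (op.seqMany s l').2 := by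
  obtain ⟨r, rfl⟩ := h
  rw [op.seqMany_append]
  exact List.prefix_append _ _

namespace Pipeline

variable (P : Pipeline.{u, v})

/-- The tuples that reach stage `k` when the inputs `xs` are processed stage by stage. -/
noncomputable def stageFrom (S : P.Stores) (xs : List (P.Ty 0)) : (k : ℕ) → List (P.Ty k)
  | 0 => xs
  | k + 1 =>
    if h : k < P.len then ((P.op ⟨k, h⟩).seqMany (S ⟨k, h⟩) (stageFrom S xs k)).2 else []

/-- The tuples that reach stage `k` in the sequential execution on `xs`. -/
noncomputable def stage (xs : List (P.Ty 0)) (k : ℕ) : List (P.Ty k) :=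
  P.stageFrom (fun j => (P.op j).initStore) xs k

variable {P}

theorem stageFrom_nil (S : P.Stores) (k : ℕ) : P.stageFrom S [] k = [] := by
  induction k with
  | zero => rfl
  | succ k ih =>
    rw [stageFrom]
    split
    · rw [ih]; rfl
    · rfl

/-- At each operator the tuples that stem from `x` precede those that stem from `xs`, and processing
them leaves the operator in its state in `seqNext S x`. So one may split off the first input at
every stage. -/
theorem stageFrom_cons (S : P.Stores) (x : P.Ty 0) (xs : List (P.Ty 0)) (k : ℕ) :
    P.stageFrom S (x :: xs) k = P.wave S x k ++ P.stageFrom (P.seqNext S x) xs k := by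
  induction k with
  | zero => rfl
  | succ k ih =>
    rw [stageFrom, wave, stageFrom]
    split
    · rw [ih, Operator.seqMany_append]
      rfl
    · rfl

theorem seqFrom_eq_stageFrom (S : P.Stores) (xs : List (P.Ty 0)) :
    P.seqFrom S xs = P.stageFrom S xs P.len := by
  induction xs generalizing S with
  | nil => rw [stageFrom_nil]; rfl
  | cons x xs ih => rw [seqFrom, ih, stageFrom_cons]

/-- The sequential execution may as well be carried out stage by stage. -/
theorem seqOutput_eq_stage (xs : List (P.Ty 0)) : P.seqOutput xs = P.stage xs P.len :=
  seqFrom_eq_stageFrom _ _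

theorem stage_succ (xs : List (P.Ty 0)) (j : Fin P.len) :
    P.stage xs (j.val + 1) = ((P.op j).seqMany (P.op j).initStore (P.stage xs j.val)).2 := by
  rw [stage, stageFrom, dif_pos j.2]
  rfl

end Pipeline

/-! ## Safety -/

section

variable {P : Pipeline.{u, v}} {N : ℕ} {input : Stream'.Seq (P.Ty 0)}

theorem Ghost.Le.refl (S : State P N) (g : Ghost P) : g.Le S S g :=
  ⟨fun _ => List.prefix_rfl, fun _ => le_rfl, fun _ => le_rfl⟩

theorem Execution.exists_ghost (E : Execution P N input) :
    ∃ g : ℕ → Ghost P, (∀ n, GlobalInv input (E.state n) (g n)) ∧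
      ∀ n, (g n).Le (E.state n) (E.state (n + 1)) (g (n + 1)) := by
  -- The implication is moved inside the existential so that a successor history can be chosen for
  -- every `g`; the invariant is then recovered along the recursion.
  have next : ∀ n g, ∃ g', GlobalInv input (E.state n) g →
      GlobalInv input (E.state (n + 1)) g' ∧ g.Le (E.state n) (E.state (n + 1)) g' := by
    intro n g
    by_cases h : GlobalInv input (E.state n) g
    · cases ha : E.act n with
      | none =>
        rw [E.stay n ha]
        exact ⟨g, fun _ => ⟨h, .refl _ _⟩⟩
      | some a =>
        obtain ⟨g', h'⟩ := h.step (E.step n a ha)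
        exact ⟨g', fun _ => h'⟩
    · exact ⟨g, fun h' => absurd h' h⟩
  choose f hf using next
  let g : ℕ → Ghost P := fun n =>
    Nat.rec ⟨fun _ => [], fun _ => .idle, fun _ => 0⟩ (fun n g => f n g) n
  have h : ∀ n, GlobalInv input (E.state n) (g n) := by
    intro n
    induction n with
    | zero =>
      rw [E.state_zero]
      exact .init input
    | succ n ih => exact (hf n (g n) ih).1
  exact ⟨g, h, fun n => (hf n (g n) (h n)).2⟩

theorem GlobalInv.log_prefix {S : State P N} {g : Ghost P} (h : GlobalInv input S g) (k : ℕ)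
    (hk : k ≤ P.len) : g.log k <+: P.stage (input.take S.arrived) k := by
  induction k with
  | zero =>
    change _ <+: input.take S.arrived
    rw [← h.source]
    exact List.prefix_append _ _
  | succ k ih =>
    rw [Pipeline.stage_succ _ ⟨k, hk⟩]
    exact (h.op ⟨k, hk⟩).prefix.trans (Operator.seqMany_prefix _ _ (ih (by omega)))

theorem GlobalInv.out_prefix {S : State P N} {g : Ghost P} (h : GlobalInv input S g) :
    S.out <+: P.seqOutput (input.take S.arrived) := by
  rw [Pipeline.seqOutput_eq_stage, ← h.out]
  exact h.log_prefix _ le_rfl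

end

/-! ## Runs of one operator -/

section

variable {α β : Type u} {op : Operator.{u, v} α β} {ι : Type} [DecidableEq ι] [Fintype ι] {s : ℕ}

/-- The steps of a worker that is allotted to the operator, where `none` stands for its return to
the scheduler. -/
inductive WorkerStep (op : Operator.{u, v} α β) (s : ℕ) :
    OpMem op → Pc op → OpMem op → Option (Pc op) → Prop where
  | leaveEmpty {m} : m.WorklistEmpty → WorkerStep op s m .start m none
  | leave {m} : WorkerStep op s m .again m none
  | local {m pc m' pc'} : LocalStep op s pc m pc' m' → WorkerStep op s m pc m' (some pc')
  | send {m pc pc' a a'} : SendStep pc a a' pc' → a'.rank < a.rank →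
      WorkerStep op s m pc m (some pc')

variable (op ι s) in
/-- An execution as it is seen by one operator: `worker n w` is the control state of worker `w` at
time `n` if it is allotted to the operator, and `act n` is the worker that performs a step at the
operator at time `n`. -/
structure OpRun where
  mem : ℕ → OpMem op
  worker : ℕ → ι → Option (Pc op)
  act : ℕ → Option ι
  log : ℕ → List α
  mid : ℕ → Mid α
  pop : ℕ → ℕ
  out : ℕ → List β
  outMid : ℕ → Mid β
  inv : ∀ n, OpInv s (mem n) (fun w => (worker n w).getD .start) (log n) (mid n) (pop n) (out n)
    (outMid n)
  step : ∀ n,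
    (act n = none ∧ worker (n + 1) = worker n ∧
      (mem (n + 1) = mem n ∨ ∃ a a', FeedStep op a (mem n) a' (mem (n + 1)))) ∨
    (act n = none ∧ mem (n + 1) = mem n ∧
      ∃ w, worker n w = none ∧ worker (n + 1) = update (worker n) w (some .start)) ∨
    (∃ w pc o, act n = some w ∧ worker n w = some pc ∧ worker (n + 1) = update (worker n) w o ∧
      WorkerStep op s (mem n) pc (mem (n + 1)) o)
  log_prefix : ∀ n, log n <+: log (n + 1)
  pop_le : ∀ n, pop n ≤ pop (n + 1)
  waiting_le : ∀ n, pop n + (mem n).waiting ≤ pop (n + 1) + (mem (n + 1)).waiting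
  fair_worker : ∀ n w, worker n w ≠ none → ∃ k, n ≤ k ∧ act k = some w
  fair_scheduler : ∀ n, ∃ k, n ≤ k ∧ ((mem k).WorklistEmpty ∨ ∃ w, worker k w ≠ none)
  fair_mid : ∀ n, ∃ k, n ≤ k ∧ mid k = .idle

namespace OpRun

variable {R : OpRun op ι s} {n k t : ℕ} {w : ι} {pc : Pc op}

/-- The control state of a worker; a worker that is not allotted counts as being at the start. -/
def ctl (R : OpRun op ι s) (n : ℕ) (w : ι) : Pc op :=
  (R.worker n w).getD .start

theorem ctl_eq (h : R.worker n w = some pc) : R.ctl n w = pc := by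
  simp [OpRun.ctl, h]

theorem worker_eq (h : R.ctl n w = pc) (hne : pc ≠ .start) : R.worker n w = some pc := by
  unfold OpRun.ctl at h
  cases e : R.worker n w <;> simp_all

theorem log_mono (h : n ≤ k) : R.log n <+: R.log k := by
  induction k, h using Nat.le_induction with
  | base => exact List.prefix_rfl
  | succ k _ ih => exact ih.trans (R.log_prefix k)

theorem pop_mono (h : n ≤ k) : R.pop n ≤ R.pop k :=
  monotone_nat_of_le_succ R.pop_le h

theorem waiting_mono (h : n ≤ k) :
    R.pop n + (R.mem n).waiting ≤ R.pop k + (R.mem k).waiting :=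
  monotone_nat_of_le_succ R.waiting_le h

/-- A worker remains in its control state until it performs its next step. -/
theorem follow (h : R.worker n w = some pc) :
    ∃ k, n ≤ k ∧ R.worker k w = some pc ∧ ∃ m o, R.mem (k + 1) = m ∧
      R.worker (k + 1) = update (R.worker k) w o ∧ WorkerStep op s (R.mem k) pc m o := by
  classical
  have hex := R.fair_worker n w (by simp [h])
  obtain ⟨hk, hact⟩ := Nat.find_spec hex
  have hmin := fun i => Nat.find_min (H := hex) (m := i)
  set k := Nat.find hex
  have key : ∀ i, n ≤ i → i ≤ k → R.worker i w = some pc := by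
    intro i hi
    induction i, hi using Nat.le_induction with
    | base => exact fun _ => h
    | succ i hni ih =>
      intro hik
      have hi := ih (by omega)
      rcases R.step i with ⟨-, e, -⟩ | ⟨-, -, w', h1, e⟩ | ⟨w', pc', o, h1, -, e, -⟩
      · rw [e, hi]
      · have : w ≠ w' := by
          rintro rfl
          simp [hi] at h1
        rw [e, Function.update_of_ne this, hi]
      · have : w ≠ w' := by
          rintro rfl
          exact hmin i (by omega) ⟨hni, h1⟩
        rw [e, Function.update_of_ne this, hi]
  have hw := key k hk le_rfl
  -- The new memory is given through a separate variable so that case analysis on the worker's step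
  -- can substitute for it.
  refine ⟨k, hk, hw, R.mem (k + 1), ?_⟩
  rcases R.step k with ⟨h1, -⟩ | ⟨h1, -⟩ | ⟨w', pc', o, h1, h2, h3, h4⟩
  · simp [h1] at hact
  · simp [h1] at hact
  · obtain rfl : w' = w := by simpa [h1] using hact
    obtain rfl : pc' = pc := by simpa [h2] using hw
    exact ⟨o, rfl, h3, h4⟩

theorem exists_numInv (hk : op.kind ≠ .stateful) (n : ℕ) :
    ∃ hq hw loc, NumInv s (R.mem n) (R.ctl n) (R.log n) (R.mid n) (R.pop n) (R.out n) (R.outMid n)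
      hq hw loc :=
  (R.inv n).numbered hk

/-! ### The reordering buffer does not get stuck -/

/-- From time `n₀` on nothing is sent, `t` being the next serial number. -/
structure Stuck (R : OpRun op ι s) (n₀ t : ℕ) : Prop where
  numbered : op.kind ≠ .stateful
  pos : 0 < s
  next : ∀ n, n₀ ≤ n → (R.mem n).next = t

namespace Stuck

variable {n₀ : ℕ} {b : Job α} {r : Option (List β)} {i : ℕ}

theorem mono (h : R.Stuck n₀ t) (hn : n₀ ≤ n) : R.Stuck n t :=
  ⟨h.numbered, h.pos, fun k hk => h.next k (hn.trans hk)⟩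

/-- Such a worker would eventually increment `next`. The following lemmas go backwards from here
through the states that inevitably lead to it. -/
theorem ne_exitIncr (h : R.Stuck n t) : R.worker n w ≠ some (.exitIncr b r) := by
  intro hw
  obtain ⟨k, hk, -, m, o, hm, -, hs⟩ := R.follow hw
  have h1 := h.next k hk
  have h2 := h.next (k + 1) (by omega)
  rw [hm] at h2
  rcases hs with _ | _ | ⟨⟨⟩⟩ | ⟨⟨⟩⟩
  simp at h2
  omega

theorem ne_exitEmpty (h : R.Stuck n t) : R.worker n w ≠ some (.exitEmpty b r i) := by
  intro hw
  obtain ⟨k, hk, -, m, o, -, ho, hs⟩ := R.follow hw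
  rcases hs with _ | _ | ⟨⟨⟩⟩ | ⟨⟨⟩⟩
  exact (h.mono (by omega)).ne_exitIncr (n := k + 1) (w := w) (by rw [ho, Function.update_self])

theorem ne_exitSend {a : Feed β} (h : R.Stuck n t) :
    R.worker n w ≠ some (.exitSend b r i a) := by
  intro hw
  induction hr : a.rank using Nat.strong_induction_on generalizing n a with
  | _ c ih =>
    obtain ⟨k, hk, -, m, o, -, ho, hs⟩ := R.follow hw
    have h' := h.mono (n := k + 1) (by omega)
    have ho := congrFun ho w
    rw [Function.update_self] at ho
    rcases hs with _ | _ | ⟨⟨⟩⟩ | ⟨⟨⟩, hlt⟩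
    · exact h'.ne_exitEmpty ho
    · exact ih _ (by omega) h' ho rfl

theorem eq_of_exitIdx (h : R.Stuck n t) (hw : R.worker n w = some pc) (hi : pc.exitIdx = some i) :
    i = t := by
  obtain ⟨_, _, _, hinv⟩ := R.exists_numInv h.numbered n
  rw [hinv.flag.idx w i (by rw [ctl_eq hw, hi]), h.next n le_rfl]

/-- The slot of the next output is full. -/
def Full (R : OpRun op ι s) (n t : ℕ) : Prop :=
  (R.mem n).buffer (t % s) ≠ none

/-- Only `exitEmpty` empties a slot, and this state does not occur any more; `addSet` can only fill
it. -/
theorem full_mono (h : R.Stuck n t) (hf : Full R n t) (hk : n ≤ k) : Full R k t := by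
  induction k, hk using Nat.le_induction with
  | base => exact hf
  | succ k hk ih =>
    unfold Full at ih ⊢
    rcases R.step k with ⟨-, -, e | ⟨a, a', e⟩⟩ | ⟨-, e, -⟩ | ⟨w, pc, o, -, hw, -, hs⟩
    · rwa [e]
    · have : (R.mem (k + 1)).buffer = (R.mem k).buffer := by
        generalize R.mem (k + 1) = m at e ⊢
        cases e <;> rfl
      rwa [this]
    · rwa [e]
    · generalize R.mem (k + 1) = m at hs ⊢
      rcases hs with _ | _ | hl | _
      · exact ih
      · exact ih
      · cases hl
        case exitEmpty => exact absurd hw (h.mono hk).ne_exitEmpty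
        case addSet =>
          simp only [Function.update_apply]
          split <;> simp_all
        all_goals exact ih
      · exact ih

theorem ne_exitBuf (h : R.Stuck n t) (hf : Full R n t) : R.worker n w ≠ some (.exitBuf b r i) := by
  intro hw
  obtain ⟨k, hk, -, m, o, -, ho, hs⟩ := R.follow hw
  have ho := congrFun ho w
  rw [Function.update_self] at ho
  have hi := h.eq_of_exitIdx hw rfl
  subst hi
  rcases hs with _ | _ | ⟨_ | _⟩ | ⟨⟨⟩⟩
  · exact (h.mono (by omega)).ne_exitSend ho
  · exact h.full_mono hf hk ‹_›

theorem ne_exitNext (h : R.Stuck n t) (hf : Full R n t) : R.worker n w ≠ some (.exitNext b r) := by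
  intro hw
  obtain ⟨k, hk, -, m, o, -, ho, hs⟩ := R.follow hw
  have ho := congrFun ho w
  rw [Function.update_self] at ho
  rcases hs with _ | _ | ⟨⟨⟩⟩ | ⟨⟨⟩⟩
  exact (h.mono (by omega)).ne_exitBuf (h.full_mono hf (by omega)) ho

/-- A successful `test_and_set` would lead to reading a full slot and to sending, so the flag must
be found set. -/
theorem sent_of_testAndSet_of_full (h : R.Stuck n t) (hf : Full R n t)
    (hw : R.worker n w = some (.testAndSet b r)) :
    ∃ k, n ≤ k ∧ (R.mem k).flag = true ∧ R.worker (k + 1) w = some (.sent b r) := by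
  obtain ⟨k, hk, -, m, o, -, ho, hs⟩ := R.follow hw
  have ho := congrFun ho w
  rw [Function.update_self] at ho
  rcases hs with _ | _ | ⟨_ | _⟩ | ⟨⟨⟩⟩
  · exact ⟨k, hk, ‹_›, ho⟩
  · exact absurd ho ((h.mono (by omega)).ne_exitNext (h.full_mono hf (by omega)))

/-- This breaks the circle from `testAndSet` through the exit section and `recheck` back to
`testAndSet`: once slot `t` has been seen full it remains full, and then the next `test_and_set`
fails. -/
theorem sent_of_recheck (h : R.Stuck n t) (hw : R.worker n w = some (.recheck b r t)) :
    ∃ k, n ≤ k ∧ R.worker k w = some (.sent b r) := by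
  obtain ⟨k, hk, -, m, o, hm, ho, hs⟩ := R.follow hw
  have ho := congrFun ho w
  rw [Function.update_self] at ho
  rcases hs with _ | _ | ⟨_ | _⟩ | ⟨⟨⟩⟩
  · have hf : Full R (k + 1) t := by
      rw [Full, hm]
      simp_all
    obtain ⟨k', hk', -, h'⟩ := (h.mono (by omega)).sent_of_testAndSet_of_full hf ho
    exact ⟨k' + 1, by omega, h'⟩
  · exact ⟨k + 1, by omega, ho⟩

theorem sent_of_exitClear (h : R.Stuck n t) (hw : R.worker n w = some (.exitClear b r i)) :
    ∃ k, n ≤ k ∧ R.worker k w = some (.sent b r) := by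
  have hi := h.eq_of_exitIdx hw rfl
  subst hi
  obtain ⟨k, hk, -, m, o, -, ho, hs⟩ := R.follow hw
  have ho := congrFun ho w
  rw [Function.update_self] at ho
  rcases hs with _ | _ | ⟨⟨⟩⟩ | ⟨⟨⟩⟩
  obtain ⟨k', hk', h'⟩ := (h.mono (by omega)).sent_of_recheck ho
  exact ⟨k', by omega, h'⟩

theorem sent_of_exitBuf (h : R.Stuck n t) (hw : R.worker n w = some (.exitBuf b r i)) :
    ∃ k, n ≤ k ∧ R.worker k w = some (.sent b r) := by
  obtain ⟨k, hk, -, m, o, -, ho, hs⟩ := R.follow hw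
  have ho := congrFun ho w
  rw [Function.update_self] at ho
  rcases hs with _ | _ | ⟨_ | _⟩ | ⟨⟨⟩⟩
  · exact absurd ho (h.mono (by omega)).ne_exitSend
  · obtain ⟨k', hk', h'⟩ := (h.mono (by omega)).sent_of_exitClear ho
    exact ⟨k', by omega, h'⟩

theorem sent_of_exitNext (h : R.Stuck n t) (hw : R.worker n w = some (.exitNext b r)) :
    ∃ k, n ≤ k ∧ R.worker k w = some (.sent b r) := by
  obtain ⟨k, hk, -, m, o, -, ho, hs⟩ := R.follow hw
  have ho := congrFun ho w
  rw [Function.update_self] at ho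
  rcases hs with _ | _ | ⟨⟨⟩⟩ | ⟨⟨⟩⟩
  obtain ⟨k', hk', h'⟩ := (h.mono (by omega)).sent_of_exitBuf ho
  exact ⟨k', by omega, h'⟩

theorem sent_of_testAndSet (h : R.Stuck n t) (hw : R.worker n w = some (.testAndSet b r)) :
    ∃ k, n ≤ k ∧ R.worker k w = some (.sent b r) := by
  obtain ⟨k, hk, -, m, o, -, ho, hs⟩ := R.follow hw
  have ho := congrFun ho w
  rw [Function.update_self] at ho
  rcases hs with _ | _ | ⟨_ | _⟩ | ⟨⟨⟩⟩
  · exact ⟨k + 1, by omega, ho⟩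
  · obtain ⟨k', hk', h'⟩ := (h.mono (by omega)).sent_of_exitNext ho
    exact ⟨k', by omega, h'⟩

end Stuck

end OpRun

end

/-! ### Nothing is sent: the slot of the next output stays empty and every `send` returns -/

section

variable {α β : Type u} {op : Operator.{u, v} α β} {ι : Type} [DecidableEq ι] [Fintype ι] {s : ℕ}

namespace OpRun

variable {R : OpRun op ι s} {n k t : ℕ} {w : ι} {pc : Pc op}

namespace Stuck

variable {n₀ : ℕ} {b : Job α} {r : Option (List β)} {i : ℕ}

theorem exitClear_of_inExit (h : R.Stuck n t) (hf : Full R n t) (hi : (R.ctl n w).InExit) :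
    ∃ b r i, R.worker n w = some (.exitClear b r i) := by
  cases hpc : R.ctl n w <;> rw [hpc] at hi <;> simp only [Pc.InExit] at hi <;>
    have hw := worker_eq hpc (by simp)
  · exact absurd hw (h.ne_exitNext hf)
  · exact absurd hw (h.ne_exitBuf hf)
  · exact absurd hw h.ne_exitSend
  · exact absurd hw h.ne_exitEmpty
  · exact absurd hw h.ne_exitIncr
  · exact ⟨_, _, _, hw⟩

/-- A worker arrives at `exitClear` only by finding the slot of `next` EMPTY. -/
theorem ne_exitClear_mono (h : R.Stuck n t) (hf : Full R n t)
    (hc : ∀ w b r i, R.worker n w ≠ some (.exitClear b r i)) (hk : n ≤ k) :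
    ∀ w b r i, R.worker k w ≠ some (.exitClear b r i) := by
  induction k, hk using Nat.le_induction with
  | base => exact hc
  | succ k hk ih =>
    intro w b r i
    rcases R.step k with ⟨-, e, -⟩ | ⟨-, -, w', -, e⟩ | ⟨w', pc, o, -, hw, e, hs⟩
    · rw [e]
      exact ih w b r i
    · rw [e, Function.update_apply]
      split
      · simp
      · exact ih w b r i
    · rw [e, Function.update_apply]
      split
      · rintro rfl
        generalize R.mem (k + 1) = m at hs
        rcases hs with _ | _ | ⟨_ | _⟩ | ⟨⟨⟩⟩
        have hi := (h.mono hk).eq_of_exitIdx hw rfl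
        subst hi
        exact h.full_mono hf hk ‹_›
      · exact ih w b r i

/-- If the slot of the next output is full, then this output is sent. -/
theorem not_full_of_ne_exitClear (h : R.Stuck n t) (hf : Full R n t)
    (hc : ∀ w b r i, R.worker n w ≠ some (.exitClear b r i)) : False := by
  have hflag : ∀ k, n ≤ k → (R.mem k).flag ≠ true := by
    intro k hk hfl
    obtain ⟨_, _, _, hinv⟩ := R.exists_numInv h.numbered k
    obtain ⟨w, hw⟩ := hinv.flag.of_flag hfl
    obtain ⟨b, r, i, hw⟩ := (h.mono hk).exitClear_of_inExit (h.full_mono hf hk) hw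
    exact h.ne_exitClear_mono hf hc hk w b r i hw
  have htas : ∀ k w b r, n ≤ k → R.worker k w ≠ some (.testAndSet b r) := by
    intro k w b r hk hw
    obtain ⟨k', hk', hfl, -⟩ := (h.mono hk).sent_of_testAndSet_of_full (h.full_mono hf hk) hw
    exact hflag k' (by omega) hfl
  obtain ⟨_, _, _, hinv⟩ := R.exists_numInv h.numbered n
  obtain ⟨o, ho⟩ := Option.ne_none_iff_exists'.1 hf
  -- The flag stays clear from now on, so the worker supplied by `wake` is bound to pass a
  -- successful `test_and_set`, possibly after a `recheck` that finds the slot full.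
  rcases hinv.flag.wake o (by rw [h.next n le_rfl, ho]) with hfl | ⟨w, hw⟩
  · exact hflag n le_rfl hfl
  · rw [h.next n le_rfl] at hw
    cases hpc : R.ctl n w <;> rw [hpc] at hw <;> simp only [Pc.Awake] at hw <;>
      have hw' := worker_eq hpc (by simp)
    · exact htas _ _ _ _ le_rfl hw'
    · subst hw
      obtain ⟨k, hk, -, m, o, -, ho, hs⟩ := R.follow hw'
      have ho := congrFun ho w
      rw [Function.update_self] at ho
      rcases hs with _ | _ | ⟨_ | _⟩ | ⟨⟨⟩⟩
      · exact htas _ _ _ _ (by omega) ho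
      · exact h.full_mono hf hk ‹_›

/-- At most one worker can be at `exitClear`; after its step nobody is there, and nobody comes back
as long as the slot is full. -/
theorem not_full (h : R.Stuck n t) : ¬ Full R n t := by
  intro hf
  by_cases hc : ∀ w b r i, R.worker n w ≠ some (.exitClear b r i)
  · exact h.not_full_of_ne_exitClear hf hc
  · push Not at hc
    obtain ⟨w, b, r, i, hw⟩ := hc
    obtain ⟨k, hk, hwk, m, o, -, ho, hs⟩ := R.follow hw
    refine (h.mono (n := k + 1) (by omega)).not_full_of_ne_exitClear
      (h.full_mono hf (by omega)) ?_
    intro w' b' r' i' hw'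
    rw [ho, Function.update_apply] at hw'
    split at hw'
    · subst hw'
      rcases hs with _ | _ | ⟨⟨⟩⟩ | ⟨⟨⟩⟩
    · obtain ⟨_, _, _, hinv⟩ := R.exists_numInv h.numbered k
      have := hinv.flag.unique w w' (by simp [ctl_eq hwk, Pc.InExit])
        (by simp [ctl_eq hw', Pc.InExit])
      exact absurd this.symm ‹_›

theorem ne_addSet (h : R.Stuck n t) {o : List β} (hb : b.serial = t) :
    R.worker n w ≠ some (.addSet b o) := by
  intro hw
  obtain ⟨k, hk, -, m, o, hm, -, hs⟩ := R.follow hw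
  rcases hs with _ | _ | ⟨⟨⟩⟩ | ⟨⟨⟩⟩
  refine (h.mono (n := k + 1) (by omega)).not_full ?_
  rw [Full, hm, hb]
  simp

/-- The number `t = next` passes the entry condition because `s` is positive, and filling its slot
is impossible. -/
theorem ne_addLoad (h : R.Stuck n t) {o : List β} (hb : b.serial = t) :
    R.worker n w ≠ some (.addLoad b o) := by
  intro hw
  obtain ⟨k, hk, -, m, o, -, ho, hs⟩ := R.follow hw
  have ho := congrFun ho w
  rw [Function.update_self] at ho
  have hn := h.next k hk
  have hp := h.pos
  rcases hs with _ | _ | ⟨_ | _⟩ | ⟨⟨⟩⟩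
  · exact absurd ho ((h.mono (by omega)).ne_addSet hb)
  · rename_i h' _
    exact h' ⟨by omega, by omega⟩

theorem ne_sent (h : R.Stuck n t) {o : List β} (hb : b.serial = t) :
    R.worker n w ≠ some (.sent b (some o)) := by
  intro hw
  obtain ⟨k, hk, -, m, o, -, ho, hs⟩ := R.follow hw
  have ho := congrFun ho w
  rw [Function.update_self] at ho
  rcases hs with _ | _ | ⟨⟨⟩⟩ | ⟨⟨⟩⟩
  exact absurd ho ((h.mono (by omega)).ne_addLoad hb)

theorem ne_store (h : R.Stuck n t) {c : op.Cell} (hb : b.serial = t) :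
    R.worker n w ≠ some (.store b c) := by
  intro hw
  obtain ⟨k, hk, -, m, o, -, ho, hs⟩ := R.follow hw
  have ho := congrFun ho w
  rw [Function.update_self] at ho
  rcases hs with _ | _ | ⟨_ | _⟩ | ⟨⟨⟩⟩
  · exact h.numbered ‹_›
  · exact absurd ho ((h.mono (by omega)).ne_addLoad hb)

theorem ne_load (h : R.Stuck n t) (hb : b.serial = t) : R.worker n w ≠ some (.load b) := by
  intro hw
  obtain ⟨k, hk, -, m, o, -, ho, hs⟩ := R.follow hw
  have ho := congrFun ho w
  rw [Function.update_self] at ho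
  rcases hs with _ | _ | ⟨⟨⟩⟩ | ⟨⟨⟩⟩
  exact absurd ho ((h.mono (by omega)).ne_store hb)

/-- The index `i` may be an outdated value of `next`, so the slot may hold another output; then the
worker is at `testAndSet` again, which is covered by now. -/
theorem sent_of_recheck' (h : R.Stuck n t) (hw : R.worker n w = some (.recheck b r i)) :
    ∃ k, n ≤ k ∧ R.worker k w = some (.sent b r) := by
  obtain ⟨k, hk, -, m, o, -, ho, hs⟩ := R.follow hw
  have ho := congrFun ho w
  rw [Function.update_self] at ho
  rcases hs with _ | _ | ⟨_ | _⟩ | ⟨⟨⟩⟩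
  · obtain ⟨k', hk', h'⟩ := (h.mono (by omega)).sent_of_testAndSet ho
    exact ⟨k', by omega, h'⟩
  · exact ⟨k + 1, by omega, ho⟩

/-- The procedure `send` returns. -/
theorem exists_sent (h : R.Stuck n t) {p : ℕ} (hx : (R.ctl n w).taken = some p)
    (hh : (R.ctl n w).held = none) :
    ∃ k, n ≤ k ∧ (R.worker k w = some (.release p) ∨
      ∃ b, b.bucket = p ∧ R.worker k w = some (.sent b none)) := by
  have key : ∀ b : Job α, b.bucket = p → (∃ k, n ≤ k ∧ R.worker k w = some (.sent b none)) →
      ∃ k, n ≤ k ∧ (R.worker k w = some (.release p) ∨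
        ∃ b, b.bucket = p ∧ R.worker k w = some (.sent b none)) := by
    rintro b hb ⟨k, hk, hw⟩
    exact ⟨k, hk, Or.inr ⟨b, hb, hw⟩⟩
  generalize hpc : R.ctl n w = pc at hx hh
  unfold Pc.taken at hx
  split at hx <;> simp only [Option.some.injEq, reduceCtorEq] at hx <;> subst hx <;>
    have hw := worker_eq hpc (by simp)
  · exact ⟨n, le_rfl, Or.inl hw⟩
  · simp [Pc.held] at hh
  · simp [Pc.held] at hh
  · simp [Pc.held] at hh
  · simp [Pc.held] at hh
  · rename_i b r
    cases r with
    | none => exact key b rfl (h.sent_of_testAndSet hw)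
    | some o => simp [Pc.held] at hh
  · rename_i b r
    cases r with
    | none => exact key b rfl (h.sent_of_exitNext hw)
    | some o => simp [Pc.held] at hh
  · rename_i b r i
    cases r with
    | none => exact key b rfl (h.sent_of_exitBuf hw)
    | some o => simp [Pc.held] at hh
  · exact absurd hw h.ne_exitSend
  · exact absurd hw h.ne_exitEmpty
  · exact absurd hw h.ne_exitIncr
  · rename_i b r i
    cases r with
    | none => exact key b rfl (h.sent_of_exitClear hw)
    | some o => simp [Pc.held] at hh
  · rename_i b r i
    cases r with
    | none => exact key b rfl (h.sent_of_recheck' hw)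
    | some o => simp [Pc.held] at hh
  · rename_i b r
    cases r with
    | none => exact key b rfl ⟨n, le_rfl, hw⟩
    | some o => simp [Pc.held] at hh

/-- A worker holding `t` would finish its computation or its failed `send`, retry, and put the
output into the slot of `t`, which never becomes full. -/
theorem serial_ne (h : R.Stuck n t) (hb : (R.ctl n w).held = some b) : b.serial ≠ t := by
  intro hs
  have key : ∀ o, ¬ ∃ k, n ≤ k ∧ R.worker k w = some (.sent b (some o)) := by
    rintro o ⟨k, hk, hw⟩
    exact (h.mono hk).ne_sent hs hw
  generalize hpc : R.ctl n w = pc at hb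
  unfold Pc.held at hb
  split at hb <;> simp only [Option.some.injEq, reduceCtorEq] at hb <;> subst hb <;>
    have hw := worker_eq hpc (by simp)
  · exact h.ne_load hs hw
  · exact h.ne_store hs hw
  · exact h.ne_addLoad hs hw
  · exact h.ne_addSet hs hw
  · exact key _ (h.sent_of_testAndSet hw)
  · exact key _ (h.sent_of_exitNext hw)
  · exact key _ (h.sent_of_exitBuf hw)
  · exact h.ne_exitSend hw
  · exact h.ne_exitEmpty hw
  · exact h.ne_exitIncr hw
  · exact key _ (h.sent_of_exitClear hw)
  · exact key _ (h.sent_of_recheck' hw)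
  · exact h.ne_sent hs hw

end Stuck

end OpRun

end

section

variable {α β : Type u} {op : Operator.{u, v} α β} {ι : Type} [DecidableEq ι] [Fintype ι] {s : ℕ}

/-! ### The worklist does not get stuck -/

theorem LocalStep.waiting_lt {m m' : OpMem op} {pc' : Pc op}
    (h : LocalStep op s .start m pc' m') : m'.waiting < m.waiting := by
  unfold OpMem.waiting
  cases h <;> rename_i h1 h2 <;> simp [h1, h2]

/-- If the tuple `x` is waiting in a partition queue although its token has been dequeued, then
some worker has dequeued a token of that partition without having claimed it, unless the partition
has an owner. -/
theorem PartInv.exists_claims {m : OpMem op} {pcs : ι → Pc op} {L : List α} {mid : Mid α} {pop : ℕ}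
    {hq : ℕ → ℕ} (h : PartInv m pcs L mid pop hq) {t : ℕ} {x : α} (hx : At L t x)
    (ht : hq (op.bucketOf x) < t) (hp : t ≤ pop) (hc : m.count (op.bucketOf x) = 0) :
    ∃ w, (pcs w).claims = some (op.bucketOf x) := by
  by_contra! hno
  set p := op.bucketOf x with hpx
  have h1 : (Finset.univ.filter fun w => (pcs w).taken = some p).card = 0 := by
    rw [Finset.card_eq_zero, Finset.filter_eq_empty_iff]
    intro w _ hw
    have := (h.count_pos p).2 ⟨w, Pc.owned_of_taken hw⟩
    omega
  have h2 : (Finset.univ.filter fun w => (pcs w).claims = some p).card = 0 := by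
    rw [Finset.card_eq_zero, Finset.filter_eq_empty_iff]
    exact fun w _ => hno w
  have h3 := h.tokens p
  have h4 := h.count_waiting p
  have h5 := congrArg List.length (h.part p)
  rw [length_filter_numberFrom (fun x => decide (op.bucketOf x = p)), List.length_append] at h5
  have hple := h.pop_le
  have e : L.drop (hq p) = (L.drop (hq p)).take (pop - hq p) ++ L.drop pop := by
    conv_lhs => rw [← List.take_append_drop (pop - hq p) (L.drop (hq p))]
    rw [List.drop_drop]
    congr 2
    omega
  -- The tuple `x` lies between positions `hq p` and `pop`: it is still in the partition queue
  -- though its master entry is gone. Without claims, counter and taken tuples there would be one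
  -- token for each queued tuple, so this is one tuple too many.
  have h6 := at_of_mem_between e hx ht (by simp; omega)
  have h7 : 0 < (((L.drop (hq p)).take (pop - hq p)).filter
      (fun x => decide (op.bucketOf x = p))).length :=
    List.length_pos_of_mem (List.mem_filter.2 ⟨h6, by simp [hpx]⟩)
  rw [e, List.filter_append, List.length_append] at h5
  omega

namespace OpRun

variable {R : OpRun op ι s} {n k t : ℕ} {w : ι} {pc : Pc op}

/-- If nothing were dequeued, the worklist would stay non-empty and no worker could be at `start`,
where it would dequeue. So every worker returns to the scheduler and none is allotted again, against
the fairness of the scheduler. -/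
theorem exists_lt_pop (hw : t ≤ R.pop n + (R.mem n).waiting) (ht : R.pop n < t)
    (H : ∀ k, n ≤ k → (∀ i, k ≤ i → R.pop i = R.pop k) → R.pop k < t → ∀ w pc,
      R.worker k w = some pc → pc ≠ .start → ∃ i, k ≤ i ∧ R.worker i w = some .again) :
    ∃ k, n ≤ k ∧ R.pop n < R.pop k := by
  by_contra! hno
  have hpop : ∀ k, n ≤ k → R.pop k = R.pop n := fun k hk => le_antisymm (hno k hk) (pop_mono hk)
  have hpos : ∀ k, n ≤ k → 0 < (R.mem k).waiting := by
    intro k hk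
    have := R.waiting_mono hk
    have := hpop k hk
    omega
  have hstart : ∀ k w, n ≤ k → R.worker k w ≠ some .start := by
    intro k w hk hw
    obtain ⟨k', hk', -, m, o, hm, -, hs⟩ := R.follow hw
    rcases hs with h | _ | hl | ⟨⟨⟩⟩
    · rw [OpMem.worklistEmpty_iff] at h
      have := hpos k' (by omega)
      omega
    · have := hl.waiting_lt
      have := R.waiting_le k'
      have := hpop k' (by omega)
      have := hpop (k' + 1) (by omega)
      rw [hm] at *
      omega
  have hnone : ∀ k i w, n ≤ k → k ≤ i → R.worker k w = none → R.worker i w = none := by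
    intro k i w hn hi hw
    induction i, hi using Nat.le_induction with
    | base => exact hw
    | succ i hi ih =>
      rcases R.step i with ⟨-, e, -⟩ | ⟨-, -, w', -, e⟩ | ⟨w', pc, o, -, h1, e, -⟩
      · rw [e, ih]
      · exact absurd (by rw [e, Function.update_self]) (hstart (i + 1) w' (by omega))
      · have : w ≠ w' := by
          rintro rfl
          simp [ih] at h1
        rw [e, Function.update_of_ne this, ih]
  have hleave : ∀ w, ∃ k, n ≤ k ∧ R.worker k w = none := by
    intro w
    cases hpc : R.worker n w with
    | none => exact ⟨n, le_rfl, hpc⟩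
    | some pc =>
      obtain ⟨i, hi, hw⟩ := H n le_rfl hpop ht w pc hpc
        (fun e => hstart n w le_rfl (by rw [hpc, e]))
      obtain ⟨k, hk, -, m, o, -, ho, hs⟩ := R.follow hw
      have ho := congrFun ho w
      rw [Function.update_self] at ho
      rcases hs with _ | _ | ⟨⟨⟩⟩ | ⟨⟨⟩⟩
      · exact ⟨k + 1, by omega, ho⟩
      · exact absurd ho (hstart (k + 1) w (by omega))
  -- After the largest of these finitely many times, no worker is at the operator.
  choose f hf hf' using hleave
  obtain ⟨k, hk, h | ⟨w, hw⟩⟩ := R.fair_scheduler (n + Finset.univ.sup f)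
  · rw [OpMem.worklistEmpty_iff] at h
    have := hpos k (by omega)
    omega
  · have : f w ≤ Finset.univ.sup f := Finset.le_sup (Finset.mem_univ w)
    exact hw (hnone (f w) k w (hf w) (by omega) (hf' w))

/-- Every tuple in the worklist is dequeued if no worker is held up for ever. -/
theorem exists_le_pop (hw : t ≤ R.pop n + (R.mem n).waiting)
    (H : ∀ k, n ≤ k → (∀ i, k ≤ i → R.pop i = R.pop k) → R.pop k < t → ∀ w pc,
      R.worker k w = some pc → pc ≠ .start → ∃ i, k ≤ i ∧ R.worker i w = some .again) :
    ∃ k, n ≤ k ∧ t ≤ R.pop k := by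
  induction hd : t - R.pop n using Nat.strong_induction_on generalizing n with
  | _ d ih =>
    by_cases ht : R.pop n < t
    · obtain ⟨k, hk, hlt⟩ := exists_lt_pop hw ht H
      obtain ⟨k', hk', h⟩ := ih (t - R.pop k) (by omega) (hw.trans (waiting_mono hk))
        (fun i hi => H i (by omega)) rfl
      exact ⟨k', by omega, h⟩
    · exact ⟨n, le_rfl, by omega⟩

/-- All tuples get into the worklist. -/
theorem exists_le_waiting (ht : t ≤ (R.log n).length) :
    ∃ k, n ≤ k ∧ t ≤ R.pop k + (R.mem k).waiting := by
  obtain ⟨k, hk, hm⟩ := R.fair_mid n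
  refine ⟨k, hk, ?_⟩
  rw [(R.inv k).pop_add_waiting hm]
  exact ht.trans (R.log_mono hk).length_le

theorem exists_again_of_release {p : ℕ}
    (ht : ∀ k, n ≤ k → R.worker k w ≠ some (.take p)) (hw : R.worker n w = some (.release p)) :
    ∃ k, n ≤ k ∧ R.worker (k + 1) w = some .again ∧ (R.mem (k + 1)).count p = 0 := by
  obtain ⟨k, hk, hwk, m, o, hm, ho, hs⟩ := R.follow hw
  have ho := congrFun ho w
  rw [Function.update_self] at ho
  rcases hs with _ | _ | ⟨_ | _⟩ | ⟨⟨⟩⟩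
  · exact absurd ho (ht _ (by omega))
  · refine ⟨k, hk, ho, ?_⟩
    rw [hm]
    simp only [Function.update_self]
    omega

theorem again_or_release_of_sent {b : Job α} (hw : R.worker n w = some (.sent b none)) :
    ∃ k, n ≤ k ∧ (R.worker k w = some (.release b.bucket) ∨
      op.kind = .stateless ∧ R.worker k w = some .again) := by
  obtain ⟨k, hk, hwk, m, o, hm, ho, hs⟩ := R.follow hw
  have ho := congrFun ho w
  rw [Function.update_self] at ho
  rcases hs with _ | _ | ⟨_ | _⟩ | ⟨⟨⟩⟩
  · exact ⟨k + 1, by omega, Or.inr ⟨‹_›, ho⟩⟩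
  · exact ⟨k + 1, by omega, Or.inl ho⟩

/-- A counter leaves zero only by a successful claim, whose next control state is `take p`. -/
theorem count_eq_zero_mono {p : ℕ}
    (ht : ∀ k w, n ≤ k → R.worker k w ≠ some (.take p)) (hc : (R.mem n).count p = 0)
    (hn : n ≤ k) : (R.mem k).count p = 0 := by
  induction k, hn using Nat.le_induction with
  | base => exact hc
  | succ k hn ih =>
    rcases R.step k with ⟨-, -, e | ⟨a, a', e⟩⟩ | ⟨-, e, -⟩ | ⟨w, pc, o, -, hw, e, hs⟩
    · rwa [e]
    · have : (R.mem (k + 1)).count = (R.mem k).count := by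
        generalize R.mem (k + 1) = m at e ⊢
        cases e <;> rfl
      rwa [this]
    · rwa [e]
    · have e := congrFun e w
      rw [Function.update_self] at e
      have htk := ht (k + 1) w (by omega)
      generalize R.mem (k + 1) = m at hs ⊢
      rcases hs with _ | _ | hl | _
      · exact ih
      · exact ih
      · cases hl
        case claimFree q _ _ =>
          have : p ≠ q := by
            rintro rfl
            exact htk e
          simpa [Function.update_of_ne this] using ih
        all_goals
          first
          | exact ih
          | simp only [Function.update_apply]; split <;> simp_all
      · exact ih

namespace Stuck

variable {b : Job α} {p : ℕ} {hq hw : ℕ → ℕ} {loc : ℕ → Loc ι}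

/-- The other three places have been excluded: no worker holds `t`, its slot is not full, and it is
not done because nobody is at `exitIncr`. -/
theorem loc_eq_queued (h : R.Stuck n t) (hinv : NumInv s (R.mem n) (R.ctl n) (R.log n) (R.mid n)
    (R.pop n) (R.out n) (R.outMid n) hq hw loc) : loc t = .queued := by
  cases e : loc t with
  | queued => rfl
  | held w =>
    obtain ⟨b, hb, rfl⟩ := hinv.loc.loc_held w t e
    exact absurd rfl (h.serial_ne hb)
  | buffered =>
    obtain ⟨o, ho, -⟩ := hinv.loc.buf_out t e
    exact absurd (by simp [Full, ho]) h.not_full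
  | done =>
    rw [hinv.loc.done_iff, h.next n le_rfl] at e
    rcases e with e | ⟨-, w, hw⟩
    · omega
    · cases hpc : R.ctl n w <;> rw [hpc] at hw <;> simp only [Pc.IsIncr] at hw
      exact absurd (worker_eq hpc (by simp)) h.ne_exitIncr

theorem lt_of_held (h : R.Stuck n t) (hinv : NumInv s (R.mem n) (R.ctl n) (R.log n) (R.mid n)
    (R.pop n) (R.out n) (R.outMid n) hq hw loc) (hb : (R.ctl n w).held = some b) :
    t < hq b.bucket := by
  have h1 := hinv.loc.serial_le hb
  have h2 := hinv.loc.next_le (t := b.serial) (by simp [hinv.loc.held_loc w b hb])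
  rw [h.next n le_rfl] at h2
  have h3 := h.serial_ne hb
  omega

theorem partitioned_of_take (h : R.Stuck n t) (hw : R.worker n w = some (.take p)) :
    op.kind = .partitioned := by
  obtain ⟨_, _, _, hinv⟩ := R.exists_numInv h.numbered n
  simpa [ctl_eq hw, Pc.Numbered] using hinv.numbered w

theorem exists_load_of_take (h : R.Stuck n t) (hw : R.worker n w = some (.take p)) :
    ∃ k b, n ≤ k ∧ b.bucket = p ∧ R.worker k w = some (.load b) := by
  obtain ⟨k, hk, hwk, m, o, -, ho, hs⟩ := R.follow hw
  have ho := congrFun ho w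
  rw [Function.update_self] at ho
  rcases hs with _ | _ | ⟨_ | hm⟩ | ⟨⟨⟩⟩
  · exact ⟨k + 1, _, by omega, rfl, ho⟩
  · obtain ⟨_, _, _, hinv⟩ := R.exists_numInv h.numbered k
    have := (hinv.part (h.partitioned_of_take hw)).1.part_ne_nil (ctl_eq hwk)
    simp_all

theorem release_of_taken (h : R.Stuck n t) (hx : (R.ctl n w).taken = some p)
    (hh : (R.ctl n w).held = none) :
    ∃ k, n ≤ k ∧ (R.worker k w = some (.release p) ∨
      op.kind = .stateless ∧ R.worker k w = some .again) := by
  obtain ⟨k, hk, hw | ⟨b, rfl, hw⟩⟩ := h.exists_sent hx hh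
  · exact ⟨k, hk, Or.inl hw⟩
  · obtain ⟨k', hk', h'⟩ := again_or_release_of_sent hw
    exact ⟨k', by omega, h'⟩

/-- As long as tuple `t` is in the worklist, no worker is held up for ever. -/
theorem exists_again (h : R.Stuck n t) (hp : ∀ i, n ≤ i → R.pop i = R.pop n) (ht : R.pop n < t)
    (hw : R.worker n w = some pc) (hpc : pc ≠ .start) :
    ∃ k, n ≤ k ∧ R.worker k w = some .again := by
  -- A held number is not done and differs from `t`, so it exceeds `t`; but it has been dequeued, so
  -- it is at most `pop`, which is below `t`.
  have hheld : ∀ k w b, n ≤ k → (R.ctl k w).held ≠ some b := by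
    intro k w b hk hb
    obtain ⟨hq, _, _, hinv⟩ := R.exists_numInv h.numbered k
    have h1 := (h.mono hk).lt_of_held hinv hb
    have h2 := hinv.hq_le h.numbered b.bucket
    have h3 := hp k hk
    omega
  have htake : ∀ k w p, n ≤ k → R.worker k w ≠ some (.take p) := by
    intro k w p hk hw
    obtain ⟨k', b, hk', -, h'⟩ := (h.mono hk).exists_load_of_take hw
    exact hheld k' w b (by omega) (by simp [ctl_eq h', Pc.held])
  have hnum : pc.Numbered := by
    obtain ⟨_, _, _, hinv⟩ := R.exists_numInv h.numbered n
    simpa [ctl_eq hw] using hinv.numbered w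
  have htaken : ∀ p, pc.taken = some p → ∃ k, n ≤ k ∧ R.worker k w = some .again := by
    intro p hx
    have hh : (R.ctl n w).held = none :=
      Option.eq_none_iff_forall_ne_some.2 fun b => hheld n w b le_rfl
    obtain ⟨k, hk, h' | ⟨-, h'⟩⟩ := h.release_of_taken (by rwa [ctl_eq hw]) hh
    · obtain ⟨k', hk', h'', -⟩ := exists_again_of_release
        (fun i hi => htake i w p (by omega)) h'
      exact ⟨k' + 1, by omega, h''⟩
    · exact ⟨k, hk, h'⟩
  cases pc with
  | start => exact absurd rfl hpc
  | again => exact ⟨n, le_rfl, hw⟩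
  | take p => exact absurd hw (htake n w p le_rfl)
  | emit a => exact hnum.elim
  | claim p =>
    obtain ⟨k, hk, hwk, m, o, hm, ho, hs⟩ := R.follow hw
    have ho := congrFun ho w
    rw [Function.update_self] at ho
    rcases hs with _ | _ | ⟨_ | _⟩ | ⟨⟨⟩⟩
    · exact absurd ho (htake _ w p (by omega))
    · exact ⟨k + 1, by omega, ho⟩
  | _ => exact htaken _ rfl

/-- The tuple is still queued. For a stateless operator this contradicts `hq = pop`. For a
partitioned one it waits in its partition queue without a master entry, and its bucket would need an
owner that never takes another tuple and never releases the bucket; but every owner gets to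
`release`. -/
theorem not_le_pop (h : R.Stuck n t) (ht : t ≤ (R.log n).length) : ¬ t ≤ R.pop n := by
  intro hp
  have hpos : 0 < t := by
    obtain ⟨_, _, _, hinv⟩ := R.exists_numInv h.numbered n
    exact ((hinv.loc.queued_iff t).1 (h.loc_eq_queued hinv)).1
  obtain ⟨x, hx⟩ := exists_at hpos ht
  have hx : ∀ k, n ≤ k → At (R.log k) t x := by
    intro k hk
    obtain ⟨r, hr⟩ := R.log_mono hk
    rw [← hr]
    exact hx.append r
  have hhq : ∀ k hq hw loc, n ≤ k → NumInv s (R.mem k) (R.ctl k) (R.log k) (R.mid k) (R.pop k)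
      (R.out k) (R.outMid k) hq hw loc → hq (op.bucketOf x) < t := by
    intro k hq hw loc hk hinv
    exact ((hinv.loc.queued_iff t).1 ((h.mono hk).loc_eq_queued hinv)).2 x (hx k hk)
  rcases OpKind.stateless_or_partitioned h.numbered with hkind | hkind
  · obtain ⟨hq, hw, loc, hinv⟩ := R.exists_numInv h.numbered n
    have h1 := hhq n hq hw loc le_rfl hinv
    rw [(hinv.stateless hkind).2] at h1
    omega
  · set p := op.bucketOf x with hpx
    -- Tuples of a bucket are dequeued in serial order, so nothing after `t` has left this partition
    -- queue, and nothing before `t` is held.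
    have hheld : ∀ k w b, n ≤ k → (R.ctl k w).held = some b → b.bucket ≠ p := by
      rintro k w b hk hb e
      obtain ⟨hq, _, _, hinv⟩ := R.exists_numInv h.numbered k
      have h1 := (h.mono hk).lt_of_held hinv hb
      have h2 := hhq k _ _ _ hk hinv
      rw [e] at h1
      omega
    have htake : ∀ k w, n ≤ k → R.worker k w ≠ some (.take p) := by
      intro k w hk hw
      obtain ⟨k', b, hk', hb, h'⟩ := (h.mono hk).exists_load_of_take hw
      exact hheld k' w b (by omega) (by simp [ctl_eq h', Pc.held]) hb
    -- With a zero counter some worker has a pending claim on `p`; the counter stays zero until that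
    -- claim, which therefore succeeds and leads to the excluded state `take p`.
    have hzero : ∀ k, n ≤ k → (R.mem k).count p ≠ 0 := by
      intro k hk hc
      obtain ⟨hq, _, _, hinv⟩ := R.exists_numInv h.numbered k
      obtain ⟨w, hw⟩ := (hinv.part hkind).1.exists_claims (hx k hk) (hhq k _ _ _ hk hinv)
        (hp.trans (pop_mono hk)) hc
      cases hpc : R.ctl k w <;> rw [hpc] at hw <;>
        simp only [Pc.claims, Option.some.injEq, reduceCtorEq] at hw
      subst hw
      obtain ⟨k', hk', hwk, m, o, hm, ho, hs⟩ := R.follow (worker_eq hpc (by simp))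
      have ho := congrFun ho w
      rw [Function.update_self] at ho
      have hc' := count_eq_zero_mono (fun i w hi => htake i w (by omega)) hc hk'
      rcases hs with _ | _ | ⟨_ | _⟩ | ⟨⟨⟩⟩
      · exact htake _ w (by omega) ho
      · exact absurd hc' ‹_›
    -- A release either continues with `take p` or leaves the counter at zero.
    have hrel : ∀ k w, n ≤ k → R.worker k w ≠ some (.release p) := by
      intro k w hk hw
      obtain ⟨k', hk', -, h'⟩ := exists_again_of_release
        (fun i hi => htake i w (by omega)) hw
      exact hzero (k' + 1) (by omega) h'
    obtain ⟨hq, _, _, hinv⟩ := R.exists_numInv h.numbered n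
    obtain ⟨w, hw⟩ := ((hinv.part hkind).1.count_pos p).1 (Nat.pos_of_ne_zero (hzero n le_rfl))
    have htaken : (R.ctl n w).taken = some p := by
      cases hpc : R.ctl n w <;> rw [hpc] at hw <;>
        simp only [Pc.owned, Option.some.injEq] at hw
      case take q =>
        subst hw
        exact absurd (worker_eq hpc (by simp)) (htake n w le_rfl)
      all_goals exact hw
    have hh : (R.ctl n w).held = none := by
      refine Option.eq_none_iff_forall_ne_some.2 fun b hb => hheld n w b le_rfl hb ?_
      simpa [htaken] using (Pc.taken_of_held hb).symm
    obtain ⟨k, hk, h' | ⟨h', -⟩⟩ := h.release_of_taken htaken hh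
    · exact hrel k w hk h'
    · simp [hkind] at h'

theorem length_lt (h : R.Stuck n t) : (R.log n).length < t := by
  by_contra! ht
  obtain ⟨k, hk, h'⟩ := R.exists_le_waiting ht
  obtain ⟨k', hk', h''⟩ := exists_le_pop h' fun i hi hp hlt w pc hw hpc =>
    (h.mono (hk.trans hi)).exists_again hp hlt hw hpc
  exact (h.mono (n := k') (by omega)).not_le_pop
    (ht.trans (R.log_mono (by omega)).length_le) h''

end Stuck

end OpRun

end

section

variable {α β : Type u} {op : Operator.{u, v} α β} {ι : Type} [DecidableEq ι] [Fintype ι] {s : ℕ}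

/-! ### All outputs are sent -/

theorem Operator.outputsOf_mono (op : Operator.{u, v} α β) (l : List α) {i k : ℕ} (h : i ≤ k) :
    op.outputsOf l i <+: op.outputsOf l k := by
  unfold outputsOf
  have e : l.take i <+: l.take k := List.take_prefix_take_left h
  obtain ⟨r, hr⟩ := e
  rw [← hr, op.seqMany_append]
  exact List.prefix_append _ _

namespace OpRun

variable {R : OpRun op ι s} {n k t : ℕ} {w : ι} {pc : Pc op}

theorem next_le_succ (n : ℕ) : (R.mem n).next ≤ (R.mem (n + 1)).next := by
  rcases R.step n with ⟨-, -, e | ⟨a, a', e⟩⟩ | ⟨-, e, -⟩ | ⟨w, pc, o, -, hw, e, hs⟩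
  · rw [e]
  · generalize R.mem (n + 1) = m at e ⊢
    cases e <;> exact le_rfl
  · rw [e]
  · generalize R.mem (n + 1) = m at hs ⊢
    rcases hs with _ | _ | hl | _
    · exact le_rfl
    · exact le_rfl
    · cases hl <;> simp
    · exact le_rfl

/-- Either `next` grows again, or it is stuck at a value beyond the log and hence beyond `t`. -/
theorem exists_lt_next (hs : 0 < s) (hk : op.kind ≠ .stateful) (ht : t ≤ (R.log n).length) :
    ∃ k, n ≤ k ∧ t < (R.mem k).next := by
  induction hd : t + 1 - (R.mem n).next using Nat.strong_induction_on generalizing n with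
  | _ d ih =>
    by_cases hlt : t < (R.mem n).next
    · exact ⟨n, le_rfl, hlt⟩
    · by_cases hst : ∀ k, n ≤ k → (R.mem k).next = (R.mem n).next
      · have : R.Stuck n (R.mem n).next := ⟨hk, hs, hst⟩
        have := this.length_lt
        omega
      · push Not at hst
        obtain ⟨k, hk, hne⟩ := hst
        have := monotone_nat_of_le_succ (f := fun i => (R.mem i).next) R.next_le_succ hk
        simp only at this
        obtain ⟨k', hk', h'⟩ := ih (t + 1 - (R.mem k).next) (by omega)
          (ht.trans (R.log_mono hk).length_le) rfl
        exact ⟨k', by omega, h'⟩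

theorem exists_phase {a : Feed β} (h : (R.ctl n w).phase = some a) :
    ∃ k, n ≤ k ∧ (R.ctl k w).phase = some (.ready []) := by
  induction hr : a.rank using Nat.strong_induction_on generalizing n a with
  | _ c ih =>
    cases hpc : R.ctl n w <;> rw [hpc] at h <;>
      simp only [Pc.phase, Option.some.injEq, reduceCtorEq] at h
    case exitEmpty => exact ⟨n, le_rfl, by rw [hpc]; rfl⟩
    case exitIncr => exact ⟨n, le_rfl, by rw [hpc]; rfl⟩
    case exitSend =>
      subst h
      obtain ⟨k, hk, hwk, m, o, -, ho, hs⟩ := R.follow (worker_eq hpc (by simp))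
      have ho := congrFun ho w
      rw [Function.update_self] at ho
      rcases hs with _ | _ | ⟨⟨⟩⟩ | ⟨⟨⟩, hlt⟩
      · exact ⟨k, hk, by rw [ctl_eq hwk]; rfl⟩
      · obtain ⟨k', hk', h'⟩ := ih _ (hr ▸ hlt) (n := k + 1) (by rw [ctl_eq ho]; rfl) rfl
        exact ⟨k', by omega, h'⟩

/-- The bound `next - 1` serves both cases: outside the sending phase exactly these outputs are out,
and at the end of such a phase the output of `next` is out as well. -/
theorem settles_of_numbered (hk : op.kind ≠ .stateful) (n : ℕ) :
    ∃ k, n ≤ k ∧ R.outMid k = .idle ∧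
      op.outputsOf (R.log k) ((R.mem k).next - 1) <+: R.out k := by
  obtain ⟨_, _, _, hinv⟩ := R.exists_numInv hk n
  by_cases hph : ∀ w, (R.ctl n w).phase = none
  · obtain ⟨h1, h2⟩ := hinv.out.idle hph
    exact ⟨n, le_rfl, h2, by rw [h1]⟩
  · push Not at hph
    obtain ⟨w, hw⟩ := hph
    obtain ⟨a, ha⟩ := Option.ne_none_iff_exists'.1 hw
    obtain ⟨k, hk', h'⟩ := exists_phase ha
    obtain ⟨_, _, _, hinv⟩ := R.exists_numInv hk k
    obtain ⟨-, h2, h3⟩ := hinv.out.send w _ h'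
    refine ⟨k, hk', h3, ?_⟩
    simp only [Feed.rest, List.append_nil] at h2
    rw [h2]
    exact op.outputsOf_mono _ (Nat.sub_le _ _)

theorem exists_again_of_emit {a : Feed β}
    (h : R.worker n w = some (.emit a)) : ∃ k, n ≤ k ∧ R.worker k w = some .again := by
  induction hr : a.rank using Nat.strong_induction_on generalizing n a with
  | _ c ih =>
    obtain ⟨k, hk, hwk, m, o, -, ho, hs⟩ := R.follow h
    have ho := congrFun ho w
    rw [Function.update_self] at ho
    rcases hs with _ | _ | ⟨⟨⟩⟩ | ⟨⟨⟩, hlt⟩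
    · exact ⟨k + 1, by omega, ho⟩
    · obtain ⟨k', hk', h'⟩ := ih _ (by omega) ho rfl
      exact ⟨k', by omega, h'⟩

theorem exists_again_of_store {b : Job α} {c : op.Cell} (hk : op.kind = .stateful)
    (h : R.worker n w = some (.store b c)) : ∃ k, n ≤ k ∧ R.worker k w = some .again := by
  obtain ⟨k, hk', hwk, m, o, -, ho, hs⟩ := R.follow h
  have ho := congrFun ho w
  rw [Function.update_self] at ho
  rcases hs with _ | _ | ⟨_ | _⟩ | ⟨⟨⟩⟩
  · obtain ⟨k', hk'', h'⟩ := exists_again_of_emit ho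
    exact ⟨k', by omega, h'⟩
  · exact absurd hk ‹_›

theorem exists_again_of_stateful (hk : op.kind = .stateful) (hw : R.worker n w = some pc)
    (hpc : pc ≠ .start) : ∃ k, n ≤ k ∧ R.worker k w = some .again := by
  have h := ((R.inv n).stateful hk).active w (by simpa [hw] using hpc)
  simp only [hw, Option.getD_some] at h
  cases pc <;> simp only [StatefulAt] at h
  case start => exact absurd rfl hpc
  case again => exact ⟨n, le_rfl, hw⟩
  case load b =>
    obtain ⟨k, hk', hwk, m, o, -, ho, hs⟩ := R.follow hw
    have ho := congrFun ho w
    rw [Function.update_self] at ho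
    rcases hs with _ | _ | ⟨⟨⟩⟩ | ⟨⟨⟩⟩
    obtain ⟨k', hk'', h'⟩ := exists_again_of_store hk ho
    exact ⟨k', by omega, h'⟩
  case store b c => exact exists_again_of_store hk hw
  case emit a => exact exists_again_of_emit hw

theorem settles_of_stateful (hk : op.kind = .stateful) (n : ℕ) :
    ∃ k, n ≤ k ∧ R.outMid k = .idle ∧ R.out k = op.outputsOf (R.log k) (R.pop k) := by
  by_cases hst : ∀ w, R.ctl n w = .start
  · obtain ⟨-, h1, h2⟩ := ((R.inv n).stateful hk).inactive hst
    exact ⟨n, le_rfl, h2, h1⟩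
  · push Not at hst
    obtain ⟨w, hw⟩ := hst
    obtain ⟨k, hk', h'⟩ := exists_again_of_stateful hk (worker_eq rfl hw) hw
    have h := ((R.inv k).stateful hk).active w (by simp [h'])
    simp only [h', Option.getD_some, StatefulAt] at h
    exact ⟨k, hk', h.2.2, h.2.1⟩

/-- The operator does not pause for ever in the middle of an addition downstream. -/
theorem exists_outMid_idle (n : ℕ) : ∃ k, n ≤ k ∧ R.outMid k = .idle := by
  by_cases hk : op.kind = .stateful
  · obtain ⟨k, hk, h, -⟩ := R.settles_of_stateful hk n
    exact ⟨k, hk, h⟩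
  · obtain ⟨k, hk, h, -⟩ := R.settles_of_numbered hk n
    exact ⟨k, hk, h⟩

/-- The outputs of all tuples that have been added to the operator are sent. -/
theorem exists_outputs_prefix (hs : 0 < s) (n : ℕ) :
    ∃ k, n ≤ k ∧ (op.seqMany op.initStore (R.log n)).2 <+: R.out k := by
  have key : ∀ k i, n ≤ k → (R.log n).length ≤ i →
      (op.seqMany op.initStore (R.log n)).2 <+: op.outputsOf (R.log k) i := by
    intro k i hk hi
    have e : (op.seqMany op.initStore (R.log n)).2 = op.outputsOf (R.log k) (R.log n).length := by
      obtain ⟨r, hr⟩ := R.log_mono hk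
      rw [← hr, op.outputsOf_append le_rfl, Operator.outputsOf, List.take_length]
    rw [e]
    exact op.outputsOf_mono _ hi
  by_cases hk : op.kind = .stateful
  · obtain ⟨k, hk1, h1⟩ := R.exists_le_waiting (n := n) le_rfl
    obtain ⟨k', hk2, h2⟩ := exists_le_pop h1
      fun i _ _ _ w pc hw hpc => exists_again_of_stateful hk hw hpc
    obtain ⟨k'', hk3, -, h3⟩ := R.settles_of_stateful hk k'
    refine ⟨k'', by omega, ?_⟩
    rw [h3]
    exact key _ _ (by omega) (h2.trans (pop_mono hk3))
  · obtain ⟨k, hk1, h1⟩ := R.exists_lt_next hs hk (n := n) le_rfl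
    obtain ⟨k', hk2, -, h2⟩ := R.settles_of_numbered hk k
    have := monotone_nat_of_le_succ (f := fun i => (R.mem i).next) R.next_le_succ hk2
    simp only at this
    exact ⟨k', by omega, (key _ _ (by omega) (by omega)).trans h2⟩

end OpRun

end

/-! ## The operators of the pipeline -/

section

variable {P : Pipeline.{u, v}} {N : ℕ} {input : Stream'.Seq (P.Ty 0)}

open Classical in
/-- The control state of a worker in the state `o` if it is allotted to operator `j`. -/
noncomputable def workerAt (o : Option ((j : Fin P.len) × Pc (P.op j))) (j : Fin P.len) :
    Option (Pc (P.op j)) :=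
  if h : ∃ pc, o = some ⟨j, pc⟩ then some h.choose else none

theorem workerAt_eq_some {o : Option ((j : Fin P.len) × Pc (P.op j))} {j : Fin P.len}
    {pc : Pc (P.op j)} : workerAt o j = some pc ↔ o = some ⟨j, pc⟩ := by
  unfold workerAt
  split
  · rename_i h
    have h' := h.choose_spec
    constructor
    · intro e
      rw [h']
      simpa using e
    · intro e
      simpa using h'.symm.trans e
  · rename_i h
    simp only [reduceCtorEq, false_iff]
    exact fun e => h ⟨pc, e⟩

theorem workerAt_self {j : Fin P.len} (pc : Pc (P.op j)) :
    workerAt (some ⟨j, pc⟩) j = some pc :=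
  workerAt_eq_some.2 rfl

theorem workerAt_none (j : Fin P.len) :
    workerAt (none : Option ((j : Fin P.len) × Pc (P.op j))) j = none := by
  simp [workerAt]

theorem workerAt_of_ne {j j' : Fin P.len} (h : j' ≠ j) (pc : Pc (P.op j)) :
    workerAt (some ⟨j, pc⟩) j' = none := by
  refine Option.eq_none_iff_forall_ne_some.2 fun pc' e => h ?_
  rw [workerAt_eq_some] at e
  simp only [Option.some.injEq, Sigma.mk.injEq] at e
  exact e.1.symm

theorem workerAt_ne_none {S : State P N} {w : Fin N} {j : Fin P.len} :
    workerAt (S.worker w) j ≠ none ↔ S.AllottedTo w j := by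
  rw [Option.ne_none_iff_exists']
  exact exists_congr fun _ => workerAt_eq_some

theorem pcAt_eq (o : Option ((j : Fin P.len) × Pc (P.op j))) (j : Fin P.len) :
    pcAt o j = (workerAt o j).getD .start := by
  unfold pcAt workerAt
  split <;> rfl

theorem workerAt_update (wk : Fin N → Option ((j : Fin P.len) × Pc (P.op j))) (w : Fin N)
    (o : Option ((j : Fin P.len) × Pc (P.op j))) (j : Fin P.len) :
    (fun w' => workerAt (update wk w o w') j) =
      update (fun w' => workerAt (wk w') j) w (workerAt o j) := by
  funext w'
  simp only [Function.update_apply]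
  split <;> rfl

theorem Deliver.preserves {k : ℕ} {a a' : Feed (P.Ty k)} {S S' : State P N}
    (h : Deliver k a S a' S') : S'.worker = S.worker ∧ S'.source = S.source ∧
      S'.arrived = S.arrived ∧ a'.rank < a.rank ∧
      (∀ j : Fin P.len, j.val ≠ k → S'.mem j = S.mem j) ∧
      ∀ j : Fin P.len, S'.mem j = S.mem j ∨ ∃ a a', FeedStep (P.op j) a (S.mem j) a' (S'.mem j) := by
  rcases h with ⟨h, hs⟩ | ⟨h⟩
  · refine ⟨rfl, rfl, rfl, hs.rank_lt, fun j hj => ?_, fun j => ?_⟩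
    · exact Function.update_of_ne (fun e => hj (by rw [e])) _ _
    · by_cases e : j = ⟨k, h⟩
      · subst e
        exact Or.inr ⟨a, a', by simpa using hs⟩
      · exact Or.inl (Function.update_of_ne e _ _)
  · exact ⟨rfl, rfl, rfl, by simp [Feed.rank], fun _ _ => rfl, fun _ => Or.inl rfl⟩

/-- The effect of a step of the system on operator `j` and its workers. -/
def SeenAt (j : Fin P.len) (ag : Agent N) (S S' : State P N) : Prop :=
  ((∀ w, ag = .worker w → ¬ S.AllottedTo w j) ∧
    (fun w => workerAt (S'.worker w) j) = (fun w => workerAt (S.worker w) j) ∧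
    (S'.mem j = S.mem j ∨ ∃ a a', FeedStep (P.op j) a (S.mem j) a' (S'.mem j))) ∨
  ((∀ w, ag = .worker w → ¬ S.AllottedTo w j) ∧ S'.mem j = S.mem j ∧
    ∃ w, workerAt (S.worker w) j = none ∧ (fun w => workerAt (S'.worker w) j) =
      update (fun w => workerAt (S.worker w) j) w (some .start)) ∨
  (∃ w pc o, ag = .worker w ∧ workerAt (S.worker w) j = some pc ∧
    (fun w => workerAt (S'.worker w) j) = update (fun w => workerAt (S.worker w) j) w o ∧
    WorkerStep (P.op j) (P.bufSize j) (S.mem j) pc (S'.mem j) o)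

/-- A step made elsewhere reaches operator `j` only as an addition to its worklist. When a worker of
`j` sends, the addition goes to stage `j + 1`, so the memory of `j` is untouched. -/
theorem Step.seenAt {ag : Agent N} {S S' : State P N} (h : Step input ag S S') (j : Fin P.len) :
    SeenAt j ag S S' := by
  have other : ∀ {w : Fin N} {i : Fin P.len} {pc : Pc (P.op i)}, S.worker w = some ⟨i, pc⟩ →
      j ≠ i → workerAt (S.worker w) j = none := by
    intro w i pc hw hne
    rw [hw, workerAt_of_ne hne]
  have other' : ∀ {w : Fin N} {i : Fin P.len} {pc : Pc (P.op i)}, S.worker w = some ⟨i, pc⟩ →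
      j ≠ i → ∀ w', Agent.worker w = Agent.worker w' → ¬ S.AllottedTo w' j := by
    intro w i pc hw hne w' e
    obtain rfl : w = w' := by simpa using e
    rw [← workerAt_ne_none, not_not]
    exact other hw hne
  have upd : ∀ (wk : Fin N → Option ((j : Fin P.len) × Pc (P.op j))) (w : Fin N)
      (o : Option ((j : Fin P.len) × Pc (P.op j))), wk = S.worker →
      workerAt (S.worker w) j = workerAt o j →
      (fun w' => workerAt (update wk w o w') j) = (fun w => workerAt (S.worker w) j) := by
    rintro wk w o rfl h
    rw [workerAt_update, ← h]
    exact Function.update_eq_self _ _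
  have sends : ∀ {S'' : State P N} {w : Fin N} {i : Fin P.len} {pc pc' : Pc (P.op i)}
      {a a' : Feed (P.Ty (i.val + 1))}, S.worker w = some ⟨i, pc⟩ → SendStep pc a a' pc' →
      Deliver (i.val + 1) a S a' S'' → ag = .worker w →
      S' = { S'' with worker := update S''.worker w (some ⟨i, pc'⟩) } →
      SeenAt j ag S S' := by
    rintro S'' w i pc pc' a a' hw hs hd rfl rfl
    obtain ⟨h1, -, -, h2, h3, h4⟩ := hd.preserves
    by_cases e : j = i
    · subst e
      refine Or.inr (Or.inr ⟨w, pc, some pc', rfl, workerAt_eq_some.2 hw, ?_, ?_⟩)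
      · simp only [workerAt_update, workerAt_self, h1]
      · rw [h3 j (by omega)]
        exact .send hs h2
    · exact Or.inl ⟨other' hw e, upd _ _ _ h1 (by rw [other hw e, workerAt_of_ne e]), h4 j⟩
  cases h with
  | arrive h1 h2 => exact Or.inl ⟨by simp, rfl, Or.inl rfl⟩
  | @ingress _ S'' a' hd =>
    obtain ⟨h1, -, -, h2, h3, h4⟩ := hd.preserves
    exact Or.inl ⟨by simp, by simp only [h1], h4 j⟩
  | @allot _ w i hw hk =>
    by_cases e : j = i
    · subst e
      refine Or.inr (Or.inl ⟨by simp, rfl, w, by rw [hw, workerAt_none], ?_⟩)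
      simp only [workerAt_update, workerAt_self]
    · exact Or.inl ⟨by simp, upd _ _ _ rfl (by rw [hw, workerAt_none, workerAt_of_ne e]),
        Or.inl rfl⟩
  | @leaveEmpty _ w i hw he =>
    by_cases e : j = i
    · subst e
      refine Or.inr (Or.inr ⟨w, .start, none, rfl, workerAt_eq_some.2 hw, ?_, .leaveEmpty he⟩)
      simp only [workerAt_update, workerAt_none]
    · exact Or.inl ⟨other' hw e, upd _ _ _ rfl (by rw [other hw e, workerAt_none]), Or.inl rfl⟩
  | @leave _ w i hw =>
    by_cases e : j = i
    · subst e
      refine Or.inr (Or.inr ⟨w, .again, none, rfl, workerAt_eq_some.2 hw, ?_, .leave⟩)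
      simp only [workerAt_update, workerAt_none]
    · exact Or.inl ⟨other' hw e, upd _ _ _ rfl (by rw [other hw e, workerAt_none]), Or.inl rfl⟩
  | emit hw hd => exact sends hw .emit hd rfl rfl
  | exitSend hw hd => exact sends hw .exitSend hd rfl rfl
  | _ =>
    rename_i w i pc pc' m' hw hl
    by_cases e : j = i
    · subst e
      refine Or.inr (Or.inr ⟨w, pc, some pc', rfl, workerAt_eq_some.2 hw, ?_, ?_⟩)
      · simp only [workerAt_update, workerAt_self]
      · simpa using .local hl
    · exact Or.inl ⟨other' hw e, upd _ _ _ rfl (by rw [other hw e, workerAt_of_ne e]),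
        Or.inl (Function.update_of_ne e _ _)⟩

namespace Execution

variable {E : Execution P N input}

theorem allotted_succ {n : ℕ} {w : Fin N} {j : Fin P.len} (h : (E.state n).AllottedTo w j)
    (ha : E.act n ≠ some (.worker w)) : (E.state (n + 1)).AllottedTo w j := by
  cases hact : E.act n with
  | none => rwa [E.stay n hact]
  | some ag =>
    rw [← workerAt_ne_none] at h ⊢
    rcases (E.step n ag hact).seenAt j with ⟨-, e, -⟩ | ⟨-, -, w', -, e⟩ | ⟨w', pc, o, rfl, -, e, -⟩
    · rwa [congrFun e w]
    · rw [congrFun e w, Function.update_apply]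
      split
      · simp
      · exact h
    · have : w ≠ w' := by
        rintro rfl
        exact ha hact
      rwa [congrFun e w, Function.update_of_ne this]

open Classical in
/-- A complete execution as it is seen by operator `j`. -/
noncomputable def opRun (E : Execution P N input) (hE : E.Complete) {g : ℕ → Ghost P}
    (hg : ∀ n, GlobalInv input (E.state n) (g n))
    (hle : ∀ n, (g n).Le (E.state n) (E.state (n + 1)) (g (n + 1))) (j : Fin P.len)
    (hmid : ∀ n, ∃ k, n ≤ k ∧ (g k).mid j = .idle) :
    OpRun (P.op j) (Fin N) (P.bufSize j) where
  mem n := (E.state n).mem j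
  worker n w := workerAt ((E.state n).worker w) j
  act n :=
    if h : ∃ w, E.act n = some (.worker w) ∧ (E.state n).AllottedTo w j then some h.choose else none
  log n := (g n).log j
  mid n := (g n).mid j
  pop n := (g n).pop j
  out n := (g n).log (j + 1)
  outMid n := (g n).mid (j + 1)
  inv n := by
    have := (hg n).op j
    have e : pcOf (E.state n).worker j =
        fun w => (workerAt ((E.state n).worker w) j).getD .start :=
      funext fun w => pcAt_eq _ _
    rwa [e] at this
  step n := by
    cases ha : E.act n with
    | none =>
      rw [E.stay n ha]
      exact Or.inl ⟨by simp, rfl, Or.inl rfl⟩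
    | some ag =>
      rcases (E.step n ag ha).seenAt j with ⟨h1, h2⟩ | ⟨h1, h2⟩ | ⟨w, pc, o, rfl, h1, h2⟩
      · refine Or.inl ⟨dif_neg ?_, h2⟩
        rintro ⟨w, hw, hw'⟩
        exact h1 w (by simpa using hw) hw'
      · refine Or.inr (Or.inl ⟨dif_neg ?_, h2⟩)
        rintro ⟨w, hw, hw'⟩
        exact h1 w (by simpa using hw) hw'
      · refine Or.inr (Or.inr ⟨w, pc, o, ?_, h1, h2⟩)
        have hex : ∃ w', some (Agent.worker w) = some (.worker w') ∧
            (E.state n).AllottedTo w' j := ⟨w, rfl, pc, workerAt_eq_some.1 h1⟩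
        rw [dif_pos hex]
        simpa using hex.choose_spec.1.symm
  log_prefix n := (hle n).log j
  pop_le n := (hle n).pop j
  waiting_le n := (hle n).waiting j
  -- A worker ceases to be allotted only through a step of its own, so either alternative of
  -- completeness forces a step while it is still at operator `j`.
  fair_worker n w hw := by
    by_contra! hno
    have hno' : ∀ k, n ≤ k → (E.state k).AllottedTo w j → E.act k ≠ some (.worker w) := by
      intro k hk hw ha
      refine hno k hk ?_
      have hex : ∃ w', E.act k = some (.worker w') ∧ (E.state k).AllottedTo w' j := ⟨w, ha, hw⟩
      rw [dif_pos hex]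
      simpa using hex.choose_spec.1.symm.trans ha
    have hall : ∀ k, n ≤ k → (E.state k).AllottedTo w j := by
      intro k hk
      induction k, hk using Nat.le_induction with
      | base => exact workerAt_ne_none.1 hw
      | succ k hk ih => exact allotted_succ ih (hno' k hk ih)
    obtain ⟨k, hk, h | h⟩ := hE.worker w n
    · exact hno' k hk (hall k hk) h
    · obtain ⟨pc, hpc⟩ := hall k hk
      simp [h] at hpc
  fair_scheduler n := by
    obtain ⟨k, hk, h | ⟨w, hw⟩⟩ := hE.scheduler j n
    · exact ⟨k, hk, Or.inl h⟩
    · exact ⟨k, hk, Or.inr ⟨w, workerAt_ne_none.2 hw⟩⟩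
  fair_mid := hmid

/-! ## The ingress thread -/

theorem source_of_ne {ag : Agent N} {S S' : State P N} (h : Step input ag S S')
    (ha : ag ≠ .ingress) : S'.source = S.source ∧ S'.arrived = S.arrived := by
  cases h with
  | arrive => exact absurd rfl ha
  | ingress => exact absurd rfl ha
  | emit _ hd => exact ⟨hd.preserves.2.1, hd.preserves.2.2.1⟩
  | exitSend _ hd => exact ⟨hd.preserves.2.1, hd.preserves.2.2.1⟩
  | _ => exact ⟨rfl, rfl⟩

/-- The ingress thread performs another step unless all inputs have been added. -/
theorem exists_ingress (hE : E.Complete) (n : ℕ) :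
    ∃ k, n ≤ k ∧ (E.state k).source = (E.state n).source ∧
      (E.state k).arrived = (E.state n).arrived ∧ (E.act k = some .ingress ∨
        ((E.state k).source = .ready [] ∧ input.get? (E.state k).arrived = none)) := by
  classical
  have hex := hE.ingress n
  obtain ⟨hk, h⟩ := Nat.find_spec hex
  have hmin := fun i => Nat.find_min (H := hex) (m := i)
  set k := Nat.find hex
  have key : ∀ i, n ≤ i → i ≤ k → (E.state i).source = (E.state n).source ∧
      (E.state i).arrived = (E.state n).arrived := by
    intro i hi
    induction i, hi using Nat.le_induction with
    | base => exact fun _ => ⟨rfl, rfl⟩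
    | succ i hni ih =>
      intro hik
      have hi := ih (by omega)
      cases ha : E.act i with
      | none => rwa [E.stay i ha]
      | some ag =>
        have := source_of_ne (E.step i ag ha) fun e => hmin i (by omega) ⟨hni, Or.inl (e ▸ ha)⟩
        rwa [this.1, this.2]
  exact ⟨k, hk, (key k hk le_rfl).1, (key k hk le_rfl).2, h⟩

theorem exists_source_ready (hE : E.Complete) (n : ℕ) :
    ∃ k, n ≤ k ∧ (E.state k).source = .ready [] := by
  induction hr : (E.state n).source.rank using Nat.strong_induction_on generalizing n with
  | _ c ih =>
    obtain ⟨k, hk, h1, -, ha | ⟨h2, -⟩⟩ := exists_ingress hE n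
    · have hs := E.step k _ ha
      generalize hS : E.state (k + 1) = S' at hs
      cases hs with
      | arrive h2 => exact ⟨k, hk, h2⟩
      | @ingress _ S'' a' hd =>
        have hlt := hd.preserves.2.2.2.1
        rw [h1, hr] at hlt
        obtain ⟨k', hk', h'⟩ := ih _ hlt (k + 1) (by rw [hS])
        exact ⟨k', by omega, h'⟩
    · exact ⟨k, hk, h2⟩

theorem arrived_mono {n k : ℕ} (h : n ≤ k) : (E.state n).arrived ≤ (E.state k).arrived := by
  induction k, h using Nat.le_induction with
  | base => exact le_rfl
  | succ k _ ih =>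
    refine ih.trans ?_
    cases ha : E.act k with
    | none => rw [E.stay k ha]
    | some ag =>
      have hs := E.step k ag ha
      by_cases e : ag = .ingress
      · subst e
        generalize E.state (k + 1) = S' at hs
        cases hs with
        | arrive => exact Nat.le_succ _
        | ingress hd => exact hd.preserves.2.2.1.ge
      · exact (source_of_ne hs e).2.ge

theorem exists_arrived (hE : E.Complete) (m : ℕ) :
    ∃ n, m ≤ (E.state n).arrived ∨ input.get? (E.state n).arrived = none := by
  induction m with
  | zero => exact ⟨0, Or.inl (Nat.zero_le _)⟩
  | succ m ih =>
    obtain ⟨n, h | h⟩ := ih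
    · obtain ⟨k, hk, h1⟩ := exists_source_ready hE n
      obtain ⟨k', hk', h2, h3, ha | ⟨-, h4⟩⟩ := exists_ingress hE k
      · have hs := E.step k' _ ha
        have hle := arrived_mono (E := E) (hk.trans hk')
        rw [h1] at h2
        refine ⟨k' + 1, Or.inl ?_⟩
        generalize E.state (k' + 1) = S' at hs
        cases hs with
        | arrive => simp only; omega
        -- Nothing is left to add, so the step of the ingress thread can only be an arrival.
        | ingress hd =>
          have := hd.preserves.2.2.2.1
          simp [h2, Feed.rank] at this
      · exact ⟨k', Or.inr h4⟩
    · exact ⟨n, Or.inr h⟩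

theorem Seq_take_prefix {α : Type*} (s : Stream'.Seq α) {m n : ℕ}
    (h : m ≤ n) : s.take m <+: s.take n := by
  induction n, h using Nat.le_induction with
  | base => exact List.prefix_rfl
  | succ n _ ih =>
    rw [Seq_take_succ]
    exact ih.trans (List.prefix_append _ _)

theorem Seq_take_eq_of_get?_eq_none {α : Type*} (s : Stream'.Seq α) {m n : ℕ}
    (hs : s.get? m = none) (h : m ≤ n) : s.take n = s.take m := by
  induction n, h using Nat.le_induction with
  | base => rfl
  | succ n hn ih => rw [Seq_take_succ, ih, s.le_stable hn hs]; simp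

theorem exists_take_prefix (hE : E.Complete) (m : ℕ) :
    ∃ n, input.take m <+: input.take (E.state n).arrived := by
  obtain ⟨n, h | h⟩ := exists_arrived hE m
  · exact ⟨n, Seq_take_prefix _ h⟩
  · refine ⟨n, ?_⟩
    rcases le_total m (E.state n).arrived with h' | h'
    · exact Seq_take_prefix _ h'
    · rw [Seq_take_eq_of_get?_eq_none _ h h']

/-! ## Liveness -/

/-- That no addition pauses for ever is proved together with the growth of the log: it is the
fairness that operator `k` needs from its producer in order to act as a fair producer for stage `k +
1`. -/
theorem exists_stage_prefix (hE : E.Complete) {g : ℕ → Ghost P}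
    (hg : ∀ n, GlobalInv input (E.state n) (g n))
    (hle : ∀ n, (g n).Le (E.state n) (E.state (n + 1)) (g (n + 1))) (k : ℕ) (hk : k ≤ P.len) :
    (∀ n, ∃ i, n ≤ i ∧ (g i).mid k = .idle) ∧
      ∀ m, ∃ n, P.stage (input.take m) k <+: (g n).log k := by
  induction k with
  | zero =>
    refine ⟨fun n => ?_, fun m => ?_⟩
    · obtain ⟨i, hi, h⟩ := exists_source_ready hE n
      exact ⟨i, hi, by rw [(hg i).source_mid, h]; rfl⟩
    · obtain ⟨n, hn⟩ := exists_take_prefix hE m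
      obtain ⟨i, hi, h⟩ := exists_source_ready hE n
      refine ⟨i, ?_⟩
      have := (hg i).source
      rw [h] at this
      simp only [Feed.rest, List.append_nil] at this
      rw [this]
      exact hn.trans (Seq_take_prefix _ (arrived_mono hi))
  | succ k ih =>
    obtain ⟨hmid, hlog⟩ := ih (by omega)
    let R := E.opRun hE hg hle ⟨k, hk⟩ hmid
    refine ⟨fun n => R.exists_outMid_idle n, fun m => ?_⟩
    obtain ⟨n, hn⟩ := hlog m
    obtain ⟨i, -, hi⟩ := R.exists_outputs_prefix (P.bufSize_pos _) n
    refine ⟨i, ?_⟩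
    rw [Pipeline.stage_succ _ ⟨k, hk⟩]
    exact (Operator.seqMany_prefix _ _ hn).trans hi

theorem getElem?_of_prefix {α : Type*} {l l' : List α} (h : l <+: l') {i : ℕ} {y : α}
    (hy : l[i]? = some y) : l'[i]? = some y := by
  obtain ⟨hi, rfl⟩ := List.getElem?_eq_some_iff.1 hy
  rw [List.getElem?_eq_getElem (hi.trans_le h.length_le), h.getElem hi]

/-- In a complete execution all outputs of the sequential execution are eventually output. -/
theorem Complete.exists_prefix_out (hE : E.Complete) (m : ℕ) :
    ∃ n, P.seqOutput (input.take m) <+: (E.state n).out := by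
  obtain ⟨g, hg, hle⟩ := E.exists_ghost
  obtain ⟨n, hn⟩ := (exists_stage_prefix hE hg hle P.len le_rfl).2 m
  refine ⟨n, ?_⟩
  rw [Pipeline.seqOutput_eq_stage, ← (hg n).out]
  exact hn

theorem out_prefix (E : Execution P N input) (n : ℕ) :
    (E.state n).out <+: P.seqOutput (input.take (E.state n).arrived) := by
  obtain ⟨g, hg, -⟩ := E.exists_ghost
  exact (hg n).out_prefix

theorem Complete.ordered (hE : E.Complete) : E.Ordered := by
  intro i y
  constructor
  · rintro ⟨n, hn⟩
    exact ⟨_, getElem?_of_prefix (E.out_prefix n) hn⟩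
  · rintro ⟨m, hm⟩
    obtain ⟨n, hn⟩ := hE.exists_prefix_out m
    exact ⟨n, getElem?_of_prefix hn hm⟩

end Execution

end

end OrderedStream

theorem mainTheorem3 (P : OrderedStream.Pipeline.{u, v}) (N : ℕ) (input : Stream'.Seq (P.Ty 0))
    (E : OrderedStream.Execution P N input) :
    (∀ n, (E.state n).out <+: P.seqOutput (input.take (E.state n).arrived)) ∧
    (E.Complete → E.Ordered) :=
  ⟨E.out_prefix, fun hE => hE.ordered⟩
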